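/- Let $N\ge 0$ be an integer, $a,b\ge 0$ and $\omega>0$ real numbers. On $\mathbb C[x]=\mathbb C[x_1,\dots,x_N]$ let $K_{jk}$ exchange $x_j$ and $x_k$, let $t_j$ replace $x_j$ by $-x_j$, and let $$\nabla_j^{(A)}=\frac{\partial}{\partial x_j}+a\sum_{k\ne j}\frac{1}{x_j-x_k}(1-K_{jk}),$$ $$\nabla_j^{(B)}=\frac{\partial}{\partial x_j}+a\sum_{k\ne j}\Bigl(\frac{1}{x_j-x_k}(1-K_{jk})+\frac{1}{x_j+x_k}(1-t_jt_kK_{jk})\Bigr)+\frac{b}{x_j}(1-t_j)$$ be the Dunkl operators. With $\alpha_j^{\dagger}=x_j-\frac1{2\omega}\nabla_j$ and $\alpha_j=\frac1{2\omega}\nabla_j$ for each type, the Cherednik operators are $$d_j^{(A)}=2\omega\,\alpha_j^{(A)\dagger}\alpha_j^{(A)}+a\sum_{k>j}K_{jk},\qquad d_j^{(B)}=2\omega\,\alpha_j^{(B)\dagger}\alpha_j^{(B)}+a\sum_{k>j}(1+t_jt_k)K_{jk}+b\,t_j .$$ Let $\varepsilon_1,\dots,\varepsilon_N$ be the standard orthonormal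 basis of $\mathbb R^N$, $R_+=\{\varepsilon_j-\varepsilon_k: j<k\}$, $R_-=-R_+$, $Q_+=\bigoplus_{j<N}\mathbb Z_{\ge0}(\varepsilon_j-\varepsilon_{j+1})$, and let $W=\mathfrak S_N$ act by $w(\varepsilon_j)=\varepsilon_{w(j)}$. Put $R_w=R_+\cap w^{-1}R_-$, $\ell(w)=|R_w|$, $\rho=\frac12\sum_{\alpha\in R_+}\alpha$, $\delta=\sum_j(N-j)\varepsilon_j$, $1^N=\sum_j\varepsilon_j$. Let $P=\mathbb Z_{\ge0}^N$ (compositions) and let $P_+\subset P$ be the set of partitions $\mu_1\ge\dots\ge\mu_N\ge0$. For $\mu\in P$ let $|\mu|=\sum_j\mu_j$, let $W(\mu)$ be its $W$-orbit, $w_\mu$ the shortest $w\in W$ with $w^{-1}(\mu)\in P_+$, and $\mu^+=w_\mu^{-1}(\mu)$. For $\mu,\nu\in P$ write $\nu\preceq\mu$ if either $\nu\notin W(\mu^+)$ and $\nu^+$ is strictly smaller than $\mu^+$ in the dominance order (on partitions of the same degree), or $\nu\in W(\mu^+)$ and $\mu-\nu\in Q_+$. **Theorem.** (0) For every $\mu\in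 P$ there are a unique polynomial $h_\mu^{(A)}$ and a unique polynomial $h_\mu^{(B)}$, each of the form $x^\mu+\sum_{\nu}v_{\nu}x^\nu$ (sum over $\nu\ne\mu$ with $\nu\preceq\mu$ or $|\nu|<|\mu|$), such that for all $\lambda\in P$ $$\sum_j\lambda_jd_j^{(A)}h_\mu^{(A)}=\langle\lambda,\mu+a\,w_\mu(\delta)\rangle h_\mu^{(A)},\qquad \sum_j\lambda_jd_j^{(B)}h_\mu^{(B)}=\langle\lambda,\mu+w_\mu(2a\delta+b1^N)\rangle h_\mu^{(B)} .$$ These are the monic non-symmetric multivariable Hermite and Laguerre polynomials. For $\mu^+\in P_+$ put $$H^{(A,B)\pm}_{\mu^+}=\sum_{\mu\in W(\mu^+)}b^{(A,B)\pm}_{\mu^+\mu}h^{(A,B)}_\mu,$$ $$b^{(A)\pm}_{\mu^+\mu}=\prod_{\alpha\in R_{w_\mu}}\pm\frac{\langle\alpha,\mu^++a\rho\rangle\mp a}{\langle\alpha,\mu^++a\rho\rangle},\qquad b^{(B)\pm}_{\mu^+\mu}=\prod_{\alpha\in R_{w_\mu}}\pm\frac{\langle\alpha,\mu^++2a\rho\rangle\mp2a}{\langle\alpha,\mu^++2a\rho\rangle}.$$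 Then: 1. $H^{(A)+}_{\mu^+}$ is symmetric for every $\mu^+\in P_+$; 2. $H^{(A)-}_{\mu^+}$ is anti-symmetric for every $\mu^+\in P_++\delta$; 3. $H^{(B)+}_{\mu^+}$ is symmetric for every $\mu^+\in P_+$ whose parts are all even or all odd; 4. $H^{(B)-}_{\mu^+}$ is anti-symmetric for every $\mu^+\in P_++2\delta$ whose parts are all even or all odd. Here $f\in\mathbb C[x]$ is symmetric (anti-symmetric) if every permutation $w\in\mathfrak S_N$ of the variables sends $f$ to $f$ (to $\operatorname{sgn}(w)f$). -/

import Mathlib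

open scoped Matrix

namespace Calogero

noncomputable section

/-! ## Root system of type A and compositions

The vector space `V` with orthonormal basis `ε_j` is `Fin N → ℝ` with the dot product; the Weyl
group is `Equiv.Perm (Fin N)`. A composition is a function `Fin N → ℕ`. Indices run over
`Fin N = {0, …, N - 1}`, so that the `j`-th index of the mathematics is `j + 1`. -/

/-- The Weyl group action by permutation of coordinates: `w (ε_j) = ε_{w j}`. -/
def act {N : ℕ} {M : Type*} (w : Equiv.Perm (Fin N)) (v : Fin N → M) : Fin N → M :=
  fun i => v (w⁻¹ i)

/-- The basis vector `ε_j`. -/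
def eps {N : ℕ} (j : Fin N) : Fin N → ℝ := Pi.single j 1

/-- A composition, seen as a vector of `V`. -/
def toVec {N : ℕ} (μ : Fin N → ℕ) : Fin N → ℝ := fun j => (μ j : ℝ)

open Classical in
/-- The positive roots `ε_j - ε_k`, `j < k`. -/
def posRoots (N : ℕ) : Finset (Fin N → ℝ) :=
  (Finset.univ.filter fun p : Fin N × Fin N => p.1 < p.2).image fun p => eps p.1 - eps p.2

/-- The simple roots `ε_j - ε_{j+1}`. -/
def simpleRoots (N : ℕ) : Set (Fin N → ℝ) :=
  {α | ∃ j k : Fin N, (j : ℕ) + 1 = (k : ℕ) ∧ α = eps j - eps k}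

/-- The positive root lattice `Q_+`: combinations of simple roots with coefficients in `ℕ`. -/
def posRootLattice (N : ℕ) : AddSubmonoid (Fin N → ℝ) := AddSubmonoid.closure (simpleRoots N)

open Classical in
/-- `R_w = R_+ ∩ w⁻¹ R_-`, where `R_- = -R_+`. -/
def invRoots {N : ℕ} (w : Equiv.Perm (Fin N)) : Finset (Fin N → ℝ) :=
  (posRoots N).filter fun α => -(act w α) ∈ posRoots N

/-- The length of a Weyl group element. -/
def length {N : ℕ} (w : Equiv.Perm (Fin N)) : ℕ := (invRoots w).card

/-- `P_+`: partitions, i.e. weakly decreasing compositions. -/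
def IsPartition {N : ℕ} (μ : Fin N → ℕ) : Prop := Antitone μ

/-- `w` is a shortest Weyl group element with `w⁻¹ μ ∈ P_+`. -/
def IsShortestSort {N : ℕ} (μ : Fin N → ℕ) (w : Equiv.Perm (Fin N)) : Prop :=
  IsPartition (act w⁻¹ μ) ∧
    ∀ w' : Equiv.Perm (Fin N), IsPartition (act w'⁻¹ μ) → length w ≤ length w'

theorem exists_isShortestSort {N : ℕ} (μ : Fin N → ℕ) : ∃ w, IsShortestSort μ w := by
  classical
  have hne : (Finset.univ.filter fun w : Equiv.Perm (Fin N) =>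
      IsPartition (act w⁻¹ μ)).Nonempty := by
    refine ⟨Tuple.sort (fun i => OrderDual.toDual (μ i)), ?_⟩
    rw [Finset.mem_filter]
    refine ⟨Finset.mem_univ _, ?_⟩
    intro i j hij
    have h := Tuple.monotone_sort (fun i => OrderDual.toDual (μ i)) hij
    simpa [act] using h
  obtain ⟨w, hw, hmin⟩ := Finset.exists_min_image _ length hne
  refine ⟨w, (Finset.mem_filter.mp hw).2, fun w' hw' => hmin w' ?_⟩
  exact Finset.mem_filter.mpr ⟨Finset.mem_univ _, hw'⟩

/-- `w_μ`, the shortest Weyl group element with `w_μ⁻¹ μ ∈ P_+`. -/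
def sortElt {N : ℕ} (μ : Fin N → ℕ) : Equiv.Perm (Fin N) :=
  Classical.choose (exists_isShortestSort μ)

/-- `μ⁺`, the partition in the orbit of `μ`. -/
def toPartition {N : ℕ} (μ : Fin N → ℕ) : Fin N → ℕ := act (sortElt μ)⁻¹ μ

/-- The orbit `W(μ)`. -/
def orbit {N : ℕ} (μ : Fin N → ℕ) : Finset (Fin N → ℕ) :=
  Finset.univ.image fun w : Equiv.Perm (Fin N) => act w μ

/-- The degree `|μ|`. -/
def degree {N : ℕ} (μ : Fin N → ℕ) : ℕ := ∑ j, μ j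

/-- The strict dominance order on partitions. -/
def DominanceLT {N : ℕ} (ν μ : Fin N → ℕ) : Prop :=
  ν ≠ μ ∧ degree ν = degree μ ∧
    ∀ l : Fin N, ∑ k ∈ Finset.univ.filter (fun k => k ≤ l), ν k
      ≤ ∑ k ∈ Finset.univ.filter (fun k => k ≤ l), μ k

/-- The order `ν ⪯ μ` on compositions. -/
def CompLE {N : ℕ} (ν μ : Fin N → ℕ) : Prop :=
  (ν ∉ orbit (toPartition μ) ∧ DominanceLT (toPartition ν) (toPartition μ)) ∨
  (ν ∈ orbit (toPartition μ) ∧ toVec μ - toVec ν ∈ posRootLattice N)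

/-- `ρ`, half the sum of the positive roots: its `j`-th coordinate is `(N - 2 j + 1) / 2`,
for `j = 1, …, N`. -/
def rho (N : ℕ) : Fin N → ℝ := fun j => ((N : ℝ) - 2 * ((j : ℝ) + 1) + 1) / 2

/-- `δ = (N - 1, N - 2, …, 0)`. -/
def delta (N : ℕ) : Fin N → ℕ := fun j => N - ((j : ℕ) + 1)

/-- `ρ_k^{(B)}`, with coordinates `2 a (N - j) + b`, for `j = 1, …, N`. -/
def rhoB (N : ℕ) (a b : ℝ) : Fin N → ℝ := fun j => 2 * a * (delta N j : ℝ) + b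

/-! ## Exchange, reflection, Dunkl and Cherednik operators -/

/-- `K_{jk}`, exchange of `x_j` and `x_k`. -/
def exch {N : ℕ} (j k : Fin N) : MvPolynomial (Fin N) ℂ →ₐ[ℂ] MvPolynomial (Fin N) ℂ :=
  MvPolynomial.rename (Equiv.swap j k)

/-- `t_j`, the substitution `x_j ↦ -x_j`. -/
def reflect {N : ℕ} (j : Fin N) : MvPolynomial (Fin N) ℂ →ₐ[ℂ] MvPolynomial (Fin N) ℂ :=
  MvPolynomial.aeval fun i => if i = j then -MvPolynomial.X i else MvPolynomial.X i

theorem dvd_sub_of_dvd_X {N : ℕ} (p : MvPolynomial (Fin N) ℂ)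
    (s : MvPolynomial (Fin N) ℂ →ₐ[ℂ] MvPolynomial (Fin N) ℂ)
    (h : ∀ i, p ∣ MvPolynomial.X i - s (MvPolynomial.X i)) (f : MvPolynomial (Fin N) ℂ) :
    p ∣ f - s f := by
  induction f using MvPolynomial.induction_on with
  | C c =>
    have : s (MvPolynomial.C c) = MvPolynomial.C c := s.commutes c
    simp [this]
  | add f g hf hg =>
    have : f + g - s (f + g) = (f - s f) + (g - s g) := by rw [map_add]; ring
    rw [this]
    exact dvd_add hf hg
  | mul_X f i hf =>
    have : f * MvPolynomial.X i - s (f * MvPolynomial.X i)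
        = (f - s f) * MvPolynomial.X i + s f * (MvPolynomial.X i - s (MvPolynomial.X i)) := by
      rw [map_mul]; ring
    rw [this]
    exact dvd_add (hf.mul_right _) ((h i).mul_left _)

theorem dvd_sub_exch {N : ℕ} (j k : Fin N) (f : MvPolynomial (Fin N) ℂ) :
    MvPolynomial.X j - MvPolynomial.X k ∣ f - exch j k f := by
  refine dvd_sub_of_dvd_X _ _ (fun i => ?_) f
  by_cases hj : i = j
  · subst hj; simp [exch]
  by_cases hk : i = k
  · subst hk
    simp only [exch, MvPolynomial.rename_X, Equiv.swap_apply_right]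
    exact ⟨-1, by ring⟩
  · simp [exch, Equiv.swap_apply_of_ne_of_ne hj hk]

theorem dvd_sub_reflect_exch {N : ℕ} (j k : Fin N) (hkj : k ≠ j) (f : MvPolynomial (Fin N) ℂ) :
    MvPolynomial.X j + MvPolynomial.X k
      ∣ f - ((reflect j).comp ((reflect k).comp (exch j k))) f := by
  refine dvd_sub_of_dvd_X _ _ (fun i => ?_) f
  by_cases hj : i = j
  · subst hj; simp [exch, reflect, hkj]
  by_cases hk : i = k
  · subst hk
    simp [exch, reflect, Ne.symm hkj, add_comm]
  · simp [exch, reflect, Equiv.swap_apply_of_ne_of_ne hj hk, hj, hk]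

theorem dvd_sub_reflect {N : ℕ} (j : Fin N) (f : MvPolynomial (Fin N) ℂ) :
    MvPolynomial.X j ∣ f - reflect j f := by
  refine dvd_sub_of_dvd_X _ _ (fun i => ?_) f
  by_cases hj : i = j
  · subst hj; simp [reflect]
  · simp [reflect, hj]

theorem X_sub_X_ne_zero {N : ℕ} {j k : Fin N} (hkj : k ≠ j) :
    (MvPolynomial.X j - MvPolynomial.X k : MvPolynomial (Fin N) ℂ) ≠ 0 := by
  intro h
  exact hkj (MvPolynomial.X_injective (sub_eq_zero.mp h)).symm

theorem X_add_X_ne_zero {N : ℕ} {j k : Fin N} (hkj : k ≠ j) :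
    (MvPolynomial.X j + MvPolynomial.X k : MvPolynomial (Fin N) ℂ) ≠ 0 := by
  intro h
  have := congrArg (MvPolynomial.eval (Pi.single j (1 : ℂ))) h
  simp [hkj] at this

/-- The operator `p⁻¹ (1 - s)`: the value at `f` is the polynomial `g` with `p g = f - s f`. -/
def divDiff {N : ℕ} (p : MvPolynomial (Fin N) ℂ)
    (s : MvPolynomial (Fin N) ℂ →ₐ[ℂ] MvPolynomial (Fin N) ℂ) (hp : p ≠ 0)
    (h : ∀ f, p ∣ f - s f) : Module.End ℂ (MvPolynomial (Fin N) ℂ) where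
  toFun f := Classical.choose (h f)
  map_add' f g := by
    apply mul_left_cancel₀ hp
    rw [mul_add, ← Classical.choose_spec (h (f + g)), ← Classical.choose_spec (h f),
      ← Classical.choose_spec (h g), map_add]
    ring
  map_smul' c f := by
    apply mul_left_cancel₀ hp
    rw [RingHom.id_apply, mul_smul_comm, ← Classical.choose_spec (h (c • f)),
      ← Classical.choose_spec (h f), map_smul, smul_sub]

theorem mul_divDiff {N : ℕ} (p : MvPolynomial (Fin N) ℂ)
    (s : MvPolynomial (Fin N) ℂ →ₐ[ℂ] MvPolynomial (Fin N) ℂ) (hp : p ≠ 0)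
    (h : ∀ f, p ∣ f - s f) (f : MvPolynomial (Fin N) ℂ) :
    p * divDiff p s hp h f = f - s f :=
  (Classical.choose_spec (h f)).symm

/-- The partial derivative `∂ / ∂ x_j`. -/
def deriv {N : ℕ} (j : Fin N) : Module.End ℂ (MvPolynomial (Fin N) ℂ) :=
  (MvPolynomial.pderiv j).toLinearMap

/-- Multiplication by `x_j`. -/
def mulX {N : ℕ} (j : Fin N) : Module.End ℂ (MvPolynomial (Fin N) ℂ) :=
  LinearMap.mulLeft ℂ (MvPolynomial.X j)

/-- The Dunkl operator of type A. -/
def dunklA {N : ℕ} (a : ℝ) (j : Fin N) : Module.End ℂ (MvPolynomial (Fin N) ℂ) :=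
  deriv j + (a : ℂ) • ∑ k : {k : Fin N // k ≠ j},
    divDiff (MvPolynomial.X j - MvPolynomial.X k.1) (exch j k.1) (X_sub_X_ne_zero k.2)
      (dvd_sub_exch j k.1)

/-- The Dunkl operator of type B. -/
def dunklB {N : ℕ} (a b : ℝ) (j : Fin N) : Module.End ℂ (MvPolynomial (Fin N) ℂ) :=
  deriv j + (a : ℂ) • ∑ k : {k : Fin N // k ≠ j},
    (divDiff (MvPolynomial.X j - MvPolynomial.X k.1) (exch j k.1) (X_sub_X_ne_zero k.2)
        (dvd_sub_exch j k.1)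
      + divDiff (MvPolynomial.X j + MvPolynomial.X k.1)
        ((reflect j).comp ((reflect k.1).comp (exch j k.1))) (X_add_X_ne_zero k.2)
        (dvd_sub_reflect_exch j k.1 k.2))
  + (b : ℂ) • divDiff (MvPolynomial.X j) (reflect j) (MvPolynomial.X_ne_zero j)
      (dvd_sub_reflect j)

/-- The annihilation-like operator `∇ / (2 ω)` attached to a Dunkl operator `∇`. -/
def annihilation {N : ℕ} (ω : ℝ) (D : Module.End ℂ (MvPolynomial (Fin N) ℂ)) :
    Module.End ℂ (MvPolynomial (Fin N) ℂ) :=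
  (1 / (2 * (ω : ℂ))) • D

/-- The creation-like operator `x_j - ∇ / (2 ω)` attached to a Dunkl operator `∇ = ∇_j`. -/
def creation {N : ℕ} (ω : ℝ) (j : Fin N) (D : Module.End ℂ (MvPolynomial (Fin N) ℂ)) :
    Module.End ℂ (MvPolynomial (Fin N) ℂ) :=
  mulX j - (1 / (2 * (ω : ℂ))) • D

/-- The Cherednik operator of type A. -/
def cherednikA {N : ℕ} (a ω : ℝ) (j : Fin N) : Module.End ℂ (MvPolynomial (Fin N) ℂ) :=
  (2 * (ω : ℂ)) • (creation ω j (dunklA a j) * annihilation ω (dunklA a j))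
    + (a : ℂ) • ∑ k ∈ Finset.univ.filter (fun k => j < k), (exch j k).toLinearMap

/-- The Cherednik operator of type B. -/
def cherednikB {N : ℕ} (a b ω : ℝ) (j : Fin N) : Module.End ℂ (MvPolynomial (Fin N) ℂ) :=
  (2 * (ω : ℂ)) • (creation ω j (dunklB a b j) * annihilation ω (dunklB a b j))
    + (a : ℂ) • ∑ k ∈ Finset.univ.filter (fun k => j < k),
        (1 + (reflect j).toLinearMap * (reflect k).toLinearMap) * (exch j k).toLinearMap
    + (b : ℂ) • (reflect j).toLinearMap

/-- `d^λ = ∑ λ_j d_j`, type A. -/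
def cherednikPowA {N : ℕ} (a ω : ℝ) (lam : Fin N → ℕ) :
    Module.End ℂ (MvPolynomial (Fin N) ℂ) :=
  ∑ j, (lam j : ℂ) • cherednikA a ω j

/-- `d^λ = ∑ λ_j d_j`, type B. -/
def cherednikPowB {N : ℕ} (a b ω : ℝ) (lam : Fin N → ℕ) :
    Module.End ℂ (MvPolynomial (Fin N) ℂ) :=
  ∑ j, (lam j : ℂ) • cherednikB a b ω j

/-! ## Non-symmetric Hermite and Laguerre polynomials -/

/-- `h` is `x^μ` plus a combination of `x^ν` with `ν ≠ μ` and (`ν ⪯ μ` or `|ν| < |μ|`). -/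
def IsMonicTriangular {N : ℕ} (μ : Fin N → ℕ) (h : MvPolynomial (Fin N) ℂ) : Prop :=
  h.coeff (Finsupp.equivFunOnFinite.symm μ) = 1 ∧
    ∀ ν : Fin N → ℕ, ν ≠ μ → h.coeff (Finsupp.equivFunOnFinite.symm ν) ≠ 0 →
      CompLE ν μ ∨ degree ν < degree μ

/-- The defining property of the monic non-symmetric Hermite polynomial `h_μ^{(A)}`:
triangularity, and `d^λ h = ⟨λ, μ + a δ(μ)⟩ h` with `δ(μ) = w_μ(δ)`, for all `λ ∈ P`. -/
def IsNonsymHermite {N : ℕ} (a ω : ℝ) (μ : Fin N → ℕ) (h : MvPolynomial (Fin N) ℂ) : Prop :=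
  IsMonicTriangular μ h ∧
    ∀ lam : Fin N → ℕ, cherednikPowA a ω lam h =
      ((toVec lam ⬝ᵥ (toVec μ + a • act (sortElt μ) (toVec (delta N))) : ℝ) : ℂ) • h

/-- The defining property of the monic non-symmetric Laguerre polynomial `h_μ^{(B)}`:
triangularity, and `d^λ h = ⟨λ, μ + w_μ(ρ_k^{(B)})⟩ h` for all `λ ∈ P`. -/
def IsNonsymLaguerre {N : ℕ} (a b ω : ℝ) (μ : Fin N → ℕ) (h : MvPolynomial (Fin N) ℂ) : Prop :=
  IsMonicTriangular μ h ∧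
    ∀ lam : Fin N → ℕ, cherednikPowB a b ω lam h =
      ((toVec lam ⬝ᵥ (toVec μ + act (sortElt μ) (rhoB N a b)) : ℝ) : ℂ) • h

/-- The non-symmetric Hermite polynomial `h_μ^{(A)}`: the polynomial with the defining property
(its existence and uniqueness are part of the theorem). -/
def nonsymHermite {N : ℕ} (a ω : ℝ) (μ : Fin N → ℕ) : MvPolynomial (Fin N) ℂ :=
  Classical.epsilon (IsNonsymHermite a ω μ)

/-- The non-symmetric Laguerre polynomial `h_μ^{(B)}`: the polynomial with the defining property
(its existence and uniqueness are part of the theorem). -/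
def nonsymLaguerre {N : ℕ} (a b ω : ℝ) (μ : Fin N → ℕ) : MvPolynomial (Fin N) ℂ :=
  Classical.epsilon (IsNonsymLaguerre a b ω μ)

/-! ## Symmetrization and anti-symmetrization -/

/-- `∏_{α ∈ R_{w_μ}} ε (⟨α, μ⁺ + κ ρ⟩ - ε κ) / ⟨α, μ⁺ + κ ρ⟩`, where the sign `ε` is `1` or `-1`.
The coefficients `b^{(A)±}` and `b^{(B)±}` are the cases `κ = a` and `κ = 2 a`. -/
def symCoeff {N : ℕ} (κ ε : ℝ) (μp μ : Fin N → ℕ) : ℝ :=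
  ∏ α ∈ invRoots (sortElt μ),
    ε * ((α ⬝ᵥ (toVec μp + κ • rho N) - ε * κ) / (α ⬝ᵥ (toVec μp + κ • rho N)))

/-- `H_{μ⁺}^{(A)±}`; the sign `±` is `ε = ±1`. -/
def hermiteH {N : ℕ} (a ω ε : ℝ) (μp : Fin N → ℕ) : MvPolynomial (Fin N) ℂ :=
  ∑ μ ∈ orbit μp, ((symCoeff a ε μp μ : ℝ) : ℂ) • nonsymHermite a ω μ

/-- `H_{μ⁺}^{(B)±}`; the sign `±` is `ε = ±1`. -/
def laguerreH {N : ℕ} (a b ω ε : ℝ) (μp : Fin N → ℕ) : MvPolynomial (Fin N) ℂ :=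
  ∑ μ ∈ orbit μp, ((symCoeff (2 * a) ε μp μ : ℝ) : ℂ) • nonsymLaguerre a b ω μ

/-- Anti-symmetric polynomials: a permutation of the variables acts by its signature. -/
def IsAntisymmetric {N : ℕ} (f : MvPolynomial (Fin N) ℂ) : Prop :=
  ∀ w : Equiv.Perm (Fin N),
    MvPolynomial.rename w f = ((Equiv.Perm.sign w : ℤ) : ℂ) • f

/-- All parts of `μ` have the same parity: all even or all odd. -/
def SameParity {N : ℕ} (μ : Fin N → ℕ) : Prop :=
  (∀ j, Even (μ j)) ∨ (∀ j, Odd (μ j))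

end

end Calogero

namespace Calogero

noncomputable section

variable {N : ℕ}

set_option linter.unusedSimpArgs false

/-! ## Sorting a composition -/

/-! Both types belong to one family `dunklOp a e b`: type A is e = b = 0, type B is e = 1. With s =
1/(2ω) the Cherednik operators are d_i = (x_i - s∇_i)∇_i + b t_i + ∑_{k>i} S_{ik}, where S_{ik} =
a(1 + e t_i t_k)K_{ik}, and their spectrum depends only on κ = a(1 + e) and β = b.

Existence and uniqueness follow by linear algebra from three facts. (i) The d_i commute. The
commutator of two Dunkl operators commutes with every x_k and kills 1, hence vanishes. The rest is a
formal computation (`DunklSystem.d_comm`) from the relations in `DunklSystem`, and these survive the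
replacement of x_i by x_i - s∇_i. (ii) On monomials d_i is triangular for the transitive relation
`Low`, with diagonal entry η_i(μ) = μ_i + κ·#{k : k follows i} + β (`suppIn_cherednikOp`,
`diag_cherednikOp`). This is the eigenvalue in the theorem, because the shortest sorting permutation
w_μ is the stable sort (`sortElt_lt_iff`). (iii) Since κ ≥ 0, the vector η(μ) determines μ
(`eq_comp_of_eta_eq`). A product of factors d_i - η_i(ν), one for each ν strictly below μ, then
sends x^μ to a nonzero multiple of a joint eigenvector. Conversely the top exponent of a joint
eigenvector has its spectrum, so an eigenvector with spectrum η(μ) is determined by its coefficient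
at x^μ.

Symmetry is tested on an adjacent exchange K = K_{i,i+1}; write sμ for μ with these two parts
exchanged. From K d_{i+1} = (d_i - S_{i,i+1})K and uniqueness one finds, with x = κ/(η_i(μ) -
η_{i+1}(μ)), that K h_μ = h_μ if μ_i = μ_{i+1} and K h_μ = x h_μ + h_{sμ} if μ_i < μ_{i+1}; the
third case follows from K² = 1. In type B this needs t_i t_{i+1} h_μ = h_μ, which the parity
condition supplies: t_i commutes with all d_j, so t_i h_μ = (-1)^{μ_i} h_μ. For μ_i < μ_{i+1} the
coefficients satisfy b_μ = (ε + x) b_{sμ} (`symCoeff_eq_mul`), which is what K H = εH requires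
(`exchOp_sum_orbit`). For ε = -1 equal adjacent parts must not occur; adding δ or 2δ to a partition
makes the parts distinct. -/

theorem perm_apply_inv (w : Equiv.Perm (Fin N)) (i : Fin N) : w (w⁻¹ i) = i :=
  w.apply_symm_apply i

theorem act_eps (w : Equiv.Perm (Fin N)) (p : Fin N) : act w (eps p) = eps (w p) := by
  funext i
  simp only [act, eps, Pi.single_apply, Equiv.Perm.inv_eq_iff_eq]

theorem act_sub (w : Equiv.Perm (Fin N)) (u v : Fin N → ℝ) : act w (u - v) = act w u - act w v :=
  rfl

theorem eps_sub_eps_inj {p q p' q' : Fin N} (hpq : p ≠ q)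
    (h : eps p - eps q = eps p' - eps q') : p = p' ∧ q = q' := by
  have h1 := congrFun h p
  have h2 := congrFun h q
  simp only [Pi.sub_apply, eps, Pi.single_apply, if_true, if_neg hpq, if_neg hpq.symm] at h1 h2
  constructor
  · by_contra hne
    rw [if_neg hne] at h1
    split_ifs at h1 <;> norm_num at h1
  · by_contra hne
    rw [if_neg hne] at h2
    split_ifs at h2 <;> norm_num at h2

theorem eps_sub_eps_mem_posRoots {p q : Fin N} : eps p - eps q ∈ posRoots N ↔ p < q := by
  classical
  simp only [posRoots, Finset.mem_image, Finset.mem_filter, Finset.mem_univ, true_and, Prod.exists]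
  constructor
  · rintro ⟨p', q', hlt, h⟩
    obtain ⟨rfl, rfl⟩ := eps_sub_eps_inj hlt.ne h
    exact hlt
  · exact fun h => ⟨p, q, h, rfl⟩

/-- The inversions of `w⁻¹`, as pairs of indices. -/
def invPairs (w : Equiv.Perm (Fin N)) : Finset (Fin N × Fin N) :=
  Finset.univ.filter fun p => p.1 < p.2 ∧ w⁻¹ p.2 < w⁻¹ p.1

open Classical in
-- Indexing the roots of R_w by the inversions j < k of w⁻¹, that is by positions in μ instead of
-- positions in μ⁺, is what later lets the products over R_w be read off from μ.
theorem invRoots_eq_image (w : Equiv.Perm (Fin N)) :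
    invRoots w = (invPairs w).image fun p => eps (w⁻¹ p.2) - eps (w⁻¹ p.1) := by
  ext α
  simp only [invRoots, invPairs, Finset.mem_filter, Finset.mem_image, Finset.mem_univ, true_and,
    Prod.exists]
  constructor
  · rintro ⟨h1, h2⟩
    simp only [posRoots, Finset.mem_image, Finset.mem_filter, Finset.mem_univ, true_and,
      Prod.exists] at h1
    obtain ⟨p, q, hlt, rfl⟩ := h1
    rw [act_sub, act_eps, act_eps, neg_sub, eps_sub_eps_mem_posRoots] at h2
    exact ⟨w q, w p, ⟨h2, by simpa using hlt⟩, by simp⟩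
  · rintro ⟨j, k, ⟨h1, h2⟩, rfl⟩
    rw [act_sub, act_eps, act_eps, neg_sub, eps_sub_eps_mem_posRoots, eps_sub_eps_mem_posRoots]
    exact ⟨h2, by simpa using h1⟩

theorem invPairs_injOn (w : Equiv.Perm (Fin N)) :
    Set.InjOn (fun p : Fin N × Fin N => eps (w⁻¹ p.2) - eps (w⁻¹ p.1)) (invPairs w) := by
  rintro ⟨j, k⟩ h ⟨j', k'⟩ - heq
  simp only [invPairs, Finset.coe_filter, Finset.mem_univ, true_and, Set.mem_ofPred_eq] at h
  obtain ⟨h1, h2⟩ := eps_sub_eps_inj h.2.ne heq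
  rw [Prod.mk.injEq]
  exact ⟨w⁻¹.injective h2, w⁻¹.injective h1⟩

theorem length_eq (w : Equiv.Perm (Fin N)) : length w = (invPairs w).card := by
  classical
  rw [length, invRoots_eq_image, Finset.card_image_of_injOn (invPairs_injOn w)]

theorem prod_invRoots (w : Equiv.Perm (Fin N)) (f : (Fin N → ℝ) → ℝ) :
    ∏ α ∈ invRoots w, f α = ∏ p ∈ invPairs w, f (eps (w⁻¹ p.2) - eps (w⁻¹ p.1)) := by
  classical
  rw [invRoots_eq_image, Finset.prod_image (invPairs_injOn w)]

/-- The index `k` comes after the index `j` when `μ` is sorted stably into decreasing order. -/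
def Follows (μ : Fin N → ℕ) (k j : Fin N) : Prop := μ k < μ j ∨ (μ k = μ j ∧ j < k)

theorem Follows.trichotomy (μ : Fin N → ℕ) {k j : Fin N} (h : k ≠ j) :
    Follows μ k j ∨ Follows μ j k := by
  rcases lt_trichotomy (μ k) (μ j) with h1 | h1 | h1
  · exact Or.inl (Or.inl h1)
  · rcases lt_or_gt_of_ne h with h2 | h2
    · exact Or.inr (Or.inr ⟨h1.symm, h2⟩)
    · exact Or.inl (Or.inr ⟨h1, h2⟩)
  · exact Or.inr (Or.inl h1)

theorem Follows.asymm {μ : Fin N → ℕ} {k j : Fin N} (h : Follows μ k j) : ¬ Follows μ j k := by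
  unfold Follows at *
  omega

/-- Sort by the lexicographic key (μ_i descending, i ascending). The key is injective, so the sorted
sequence of keys is strictly increasing and ties are decided by the index. -/
theorem exists_stable_sort (μ : Fin N → ℕ) :
    ∃ w : Equiv.Perm (Fin N), IsPartition (act w⁻¹ μ) ∧
      ∀ j k, w⁻¹ j < w⁻¹ k ↔ Follows μ k j := by
  set g : Fin N → (ℕᵒᵈ ×ₗ Fin N) := fun i => toLex (OrderDual.toDual (μ i), i) with hg
  have hginj : Function.Injective g := fun i j h => by
    have := congrArg (fun x => (ofLex x).2) h
    exact this
  have hmono : StrictMono (g ∘ Tuple.sort g) :=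
    (Tuple.monotone_sort g).strictMono_of_injective
      (hginj.comp (Tuple.sort g).injective)
  have key : ∀ j k, (Tuple.sort g)⁻¹ j < (Tuple.sort g)⁻¹ k ↔ Follows μ k j := by
    intro j k
    rw [← hmono.lt_iff_lt]
    simp only [Function.comp_apply, perm_apply_inv, hg, Prod.Lex.toLex_lt_toLex,
      OrderDual.toDual_lt_toDual, Follows, EmbeddingLike.apply_eq_iff_eq]
    tauto
  refine ⟨Tuple.sort g, ?_, key⟩
  intro p q hpq
  simp only [act, inv_inv]
  rcases hpq.eq_or_lt with rfl | h
  · exact le_rfl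
  · have := (key (Tuple.sort g p) (Tuple.sort g q)).1 (by simpa using h)
    unfold Follows at this
    omega

theorem sortElt_spec (μ : Fin N → ℕ) : IsShortestSort μ (sortElt μ) :=
  Classical.choose_spec (exists_isShortestSort μ)

theorem inv_lt_of_isPartition {μ : Fin N → ℕ} {w : Equiv.Perm (Fin N)}
    (h : IsPartition (act w⁻¹ μ)) {j k : Fin N} (hjk : μ j < μ k) : w⁻¹ k < w⁻¹ j := by
  by_contra hle
  have := h (not_lt.1 hle)
  simp only [act, inv_inv, perm_apply_inv] at this
  omega

/-- The inversions of the stable sort come from strict inequalities between parts, so every sorting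
permutation has them. Minimal length then makes the two inversion sets equal, and the inversion set
determines the relative order of all positions. -/
theorem sortElt_lt_iff (μ : Fin N → ℕ) (j k : Fin N) :
    (sortElt μ)⁻¹ j < (sortElt μ)⁻¹ k ↔ Follows μ k j := by
  obtain ⟨hpart, hmin⟩ := sortElt_spec μ
  obtain ⟨w₀, hw₀, hw₀lt⟩ := exists_stable_sort μ
  have hsub : invPairs w₀ ⊆ invPairs (sortElt μ) := by
    intro p hp
    simp only [invPairs, Finset.mem_filter, Finset.mem_univ, true_and, hw₀lt] at hp ⊢
    refine ⟨hp.1, inv_lt_of_isPartition hpart ?_⟩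
    rcases hp.2 with h | h
    · exact h
    · exact absurd hp.1 (by have := h.2; omega)
  have heq : invPairs w₀ = invPairs (sortElt μ) := by
    refine Finset.eq_of_subset_of_card_le hsub ?_
    rw [← length_eq, ← length_eq]
    exact hmin w₀ hw₀
  have key : ∀ j k : Fin N, j < k → ((sortElt μ)⁻¹ k < (sortElt μ)⁻¹ j ↔ Follows μ j k) := by
    intro j k hjk
    have := Finset.ext_iff.1 heq (j, k)
    simp only [invPairs, Finset.mem_filter, Finset.mem_univ, true_and, hjk, hw₀lt] at this
    exact this.symm
  rcases lt_trichotomy j k with h | rfl | h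
  · rw [← not_iff_not, ← (show Follows μ j k ↔ ¬ Follows μ k j from
      ⟨Follows.asymm, (Follows.trichotomy μ h.ne).resolve_right⟩), ← key j k h, not_lt]
    have : (sortElt μ)⁻¹ j ≠ (sortElt μ)⁻¹ k := fun e => h.ne ((sortElt μ)⁻¹.injective e)
    exact ⟨fun h => lt_of_le_of_ne h this.symm, le_of_lt⟩
  · simp [Follows]
  · exact key k j h

open Classical in
/-- The number of indices that come after `j` in the stable sort of `μ`. -/
def followCount (μ : Fin N → ℕ) (j : Fin N) : ℕ :=
  (Finset.univ.filter fun k => Follows μ k j).card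

/-- An entry of δ counts the positions after it, and w_μ carries these to the indices that follow j.
-/
theorem delta_sortElt (μ : Fin N → ℕ) (j : Fin N) :
    delta N ((sortElt μ)⁻¹ j) = followCount μ j := by
  classical
  have h : delta N ((sortElt μ)⁻¹ j) = (Finset.Ioi ((sortElt μ)⁻¹ j)).card := by
    simp [delta, Nat.sub_sub, add_comm]
  rw [h, followCount]
  refine Finset.card_bij (fun q _ => sortElt μ q) ?_ ?_ ?_
  · intro q hq
    simp only [Finset.mem_filter, Finset.mem_univ, true_and, ← sortElt_lt_iff]
    simpa using hq
  · intro q _ q' _ h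
    exact (sortElt μ).injective h
  · intro k hk
    simp only [Finset.mem_filter, Finset.mem_univ, true_and, ← sortElt_lt_iff] at hk
    exact ⟨(sortElt μ)⁻¹ k, by simpa using hk, by simp⟩

/-- The spectral vector `μ + κ w_μ(δ) + β 1^N`. -/
def eta (κ β : ℝ) (μ : Fin N → ℕ) (j : Fin N) : ℝ := μ j + κ * followCount μ j + β

theorem eta_eq_hermite (a : ℝ) (μ : Fin N → ℕ) :
    toVec μ + a • act (sortElt μ) (toVec (delta N)) = eta a 0 μ := by
  funext j
  simp only [eta, toVec, act, delta_sortElt, Pi.add_apply, Pi.smul_apply, smul_eq_mul, add_zero]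

theorem eta_eq_laguerre (a b : ℝ) (μ : Fin N → ℕ) :
    toVec μ + act (sortElt μ) (rhoB N a b) = eta (2 * a) b μ := by
  funext j
  simp only [eta, toVec, act, delta_sortElt, rhoB, Pi.add_apply, add_assoc]

theorem Follows.followCount_lt {μ : Fin N → ℕ} {k j : Fin N} (h : Follows μ k j) :
    followCount μ k < followCount μ j := by
  classical
  refine Finset.card_lt_card (Finset.ssubset_iff_of_subset ?_ |>.2 ⟨k, ?_, ?_⟩)
  · intro l hl
    simp only [Finset.mem_filter, Finset.mem_univ, true_and] at hl ⊢
    unfold Follows at *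
    omega
  · simpa using h
  · exact fun h => (Finset.mem_filter.1 h).2.asymm (Finset.mem_filter.1 h).2

/-- The count of followers drops by at least one along `Follows`. This gap later keeps the
denominators η_i - η_{i+1} away from zero when the parts differ. -/
theorem Follows.eta_le {κ : ℝ} (hκ : 0 ≤ κ) (β : ℝ) {μ : Fin N → ℕ} {k j : Fin N}
    (h : Follows μ k j) : ((μ j : ℝ) - μ k) + κ ≤ eta κ β μ j - eta κ β μ k := by
  have h1 : (followCount μ k : ℝ) + 1 ≤ followCount μ j := by exact_mod_cast h.followCount_lt
  unfold eta
  nlinarith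

theorem eta_lt_of_lt {κ : ℝ} (hκ : 0 ≤ κ) (β : ℝ) {μ : Fin N → ℕ} {k j : Fin N}
    (h : μ k < μ j) : eta κ β μ k < eta κ β μ j := by
  have h1 := Follows.eta_le hκ β (Or.inl h : Follows μ k j)
  have h2 : (μ k : ℝ) < μ j := by exact_mod_cast h
  linarith

theorem eta_lt_iff {κ : ℝ} (hκ : 0 < κ) (β : ℝ) (μ : Fin N → ℕ) (k j : Fin N) :
    eta κ β μ k < eta κ β μ j ↔ Follows μ k j := by
  have key : ∀ k j, Follows μ k j → eta κ β μ k < eta κ β μ j := by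
    intro k j h
    have h1 := h.eta_le hκ.le β
    have h2 : (μ k : ℝ) ≤ μ j := by
      have : μ k ≤ μ j := by unfold Follows at h; omega
      exact_mod_cast this
    linarith
  refine ⟨fun h => ?_, key k j⟩
  by_cases hkj : k = j
  · subst hkj; exact absurd h (lt_irrefl _)
  · exact (Follows.trichotomy μ hkj).resolve_right fun h' => lt_asymm h (key j k h')

/-- The spectral vector determines the composition, equivariantly. -/
theorem eq_comp_of_eta_eq {κ : ℝ} (hκ : 0 ≤ κ) (β : ℝ) {μ ν : Fin N → ℕ}
    (σ : Equiv.Perm (Fin N)) (h : ∀ j, eta κ β ν j = eta κ β μ (σ j)) : ∀ j, ν j = μ (σ j) := by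
  classical
  intro j
  have hj := h j
  -- For κ = 0 the entries of η are the parts up to the constant β. For κ > 0 the order of the
  -- entries recovers `Follows`, hence the counts, hence the parts.
  rcases hκ.eq_or_lt with rfl | hκ
  · simpa [eta] using hj
  · have hc : followCount ν j = followCount μ (σ j) := by
      refine Finset.card_bij (fun k _ => σ k) ?_ ?_ ?_
      · intro k hk
        simp only [Finset.mem_filter, Finset.mem_univ, true_and, ← eta_lt_iff hκ β, h] at hk ⊢
        exact hk
      · intro k _ k' _ e
        exact σ.injective e
      · intro k hk
        refine ⟨σ⁻¹ k, ?_, by simp⟩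
        simp only [Finset.mem_filter, Finset.mem_univ, true_and, ← eta_lt_iff hκ β, h] at hk ⊢
        simpa using hk
    unfold eta at hj
    rw [hc] at hj
    have : (ν j : ℝ) = μ (σ j) := by linarith
    exact_mod_cast this

/-! ## Adjacent transpositions -/

/-- No index lies strictly between i and i', so the exchange reverses only the pair (i, i'). -/
theorem swap_lt_swap_iff {i i' : Fin N} (hi : (i : ℕ) + 1 = i') {j k : Fin N}
    (h : ¬ (j = i ∧ k = i')) (h' : ¬ (j = i' ∧ k = i)) :
    Equiv.swap i i' j < Equiv.swap i i' k ↔ j < k := by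
  simp only [Equiv.swap_apply_def, Fin.ext_iff, Fin.lt_def] at *
  split_ifs <;> omega

/-- Only the pair (i, i') changes its index order, and for that pair `Follows` is decided by the
unequal parts, not by the indices. -/
theorem follows_comp_swap {μ : Fin N → ℕ} {i i' : Fin N} (hi : (i : ℕ) + 1 = i') (hne : μ i ≠ μ i')
    (j k : Fin N) :
    Follows (μ ∘ Equiv.swap i i') k j ↔ Follows μ (Equiv.swap i i' k) (Equiv.swap i i' j) := by
  simp only [Follows, Function.comp_apply]
  by_cases h : j = i ∧ k = i'
  · obtain ⟨rfl, rfl⟩ := h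
    simp [hne]
  by_cases h' : j = i' ∧ k = i
  · obtain ⟨rfl, rfl⟩ := h'
    simp [hne.symm]
  rw [swap_lt_swap_iff hi h h']

theorem followCount_comp_swap {μ : Fin N → ℕ} {i i' : Fin N} (hi : (i : ℕ) + 1 = i')
    (hne : μ i ≠ μ i') (j : Fin N) :
    followCount (μ ∘ Equiv.swap i i') j = followCount μ (Equiv.swap i i' j) := by
  classical
  refine Finset.card_bij (fun k _ => Equiv.swap i i' k) ?_ ?_ ?_
  · intro k hk
    simpa [follows_comp_swap hi hne] using hk
  · intro k _ k' _ e
    exact (Equiv.swap i i').injective e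
  · intro k hk
    exact ⟨Equiv.swap i i' k, by simpa [follows_comp_swap hi hne] using hk, by simp⟩

theorem eta_comp_swap (κ β : ℝ) {μ : Fin N → ℕ} {i i' : Fin N} (hi : (i : ℕ) + 1 = i')
    (hne : μ i ≠ μ i') (j : Fin N) :
    eta κ β (μ ∘ Equiv.swap i i') j = eta κ β μ (Equiv.swap i i' j) := by
  simp [eta, followCount_comp_swap hi hne]

/-- With equal adjacent parts, the indices following i are those following i' together with i'
itself. -/
theorem eta_sub_eta_of_eq (κ β : ℝ) {μ : Fin N → ℕ} {i i' : Fin N} (hi : (i : ℕ) + 1 = i')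
    (he : μ i = μ i') : eta κ β μ i = eta κ β μ i' + κ := by
  classical
  have hc : followCount μ i = followCount μ i' + 1 := by
    unfold followCount
    rw [show (Finset.univ.filter fun k => Follows μ k i)
        = insert i' (Finset.univ.filter fun k => Follows μ k i') from ?_, Finset.card_insert_of_notMem]
    · exact fun h => (Finset.mem_filter.1 h).2.asymm (Finset.mem_filter.1 h).2
    · ext k
      simp only [Finset.mem_filter, Finset.mem_univ, true_and, Finset.mem_insert, Follows,
        Fin.lt_def, Fin.ext_iff]
      constructor
      · rintro (h | ⟨h, h2⟩)
        · exact Or.inr (Or.inl (he ▸ h))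
        · by_cases hk : (k : ℕ) = i'
          · exact Or.inl hk
          · exact Or.inr (Or.inr ⟨h.trans he, by omega⟩)
      · rintro (h | h | ⟨h, h2⟩)
        · exact Or.inr ⟨by rw [Fin.ext h, he], by omega⟩
        · exact Or.inl (he ▸ h)
        · exact Or.inr ⟨h.trans he.symm, by omega⟩
  unfold eta
  rw [hc, he]
  push_cast
  ring

/-! ## The coefficients of the symmetrization -/

theorem mem_orbit {μ ν : Fin N → ℕ} : ν ∈ orbit μ ↔ ∃ w : Equiv.Perm (Fin N), ν = μ ∘ w := by
  simp only [orbit, Finset.mem_image, Finset.mem_univ, true_and]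
  exact ⟨fun ⟨w, h⟩ => ⟨w⁻¹, h.symm⟩, fun ⟨w, h⟩ => ⟨w⁻¹, by rw [h]; funext i; simp [act]⟩⟩

theorem toPartition_eq_of_mem_orbit {μp μ : Fin N → ℕ} (hp : IsPartition μp) (h : μ ∈ orbit μp) :
    toPartition μ = μp := by
  obtain ⟨w, rfl⟩ := mem_orbit.1 h
  have h1 : Monotone ((fun i => OrderDual.toDual (μp i)) ∘ (w * sortElt (μp ∘ w) : Equiv.Perm _)) := by
    intro p q hpq
    have := (sortElt_spec (μp ∘ w)).1 hpq
    simpa [act] using this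
  have h2 : Monotone ((fun i => OrderDual.toDual (μp i)) ∘ (1 : Equiv.Perm (Fin N))) :=
    fun p q hpq => hp hpq
  have := Tuple.unique_monotone h1 h2
  funext i
  have := congrFun this i
  simpa [toPartition, act] using this

/-- Since ρ and δ differ by a multiple of 1^N, which is orthogonal to all roots, pairing μ⁺ + κρ
with the root of the inversion (j, k) gives η_k(μ) - η_j(μ). -/
theorem symCoeff_eq (κ β ε : ℝ) {μp μ : Fin N → ℕ} (hp : IsPartition μp) (h : μ ∈ orbit μp) :
    symCoeff κ ε μp μ = ∏ p ∈ Finset.univ.filter (fun p : Fin N × Fin N => p.1 < p.2 ∧ μ p.1 < μ p.2),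
      ε * ((eta κ β μ p.2 - eta κ β μ p.1 - ε * κ) / (eta κ β μ p.2 - eta κ β μ p.1)) := by
  have hset : invPairs (sortElt μ)
      = Finset.univ.filter (fun p : Fin N × Fin N => p.1 < p.2 ∧ μ p.1 < μ p.2) := by
    ext p
    simp only [invPairs, Finset.mem_filter, Finset.mem_univ, true_and, sortElt_lt_iff, Follows]
    constructor
    · rintro ⟨h1, h2⟩; exact ⟨h1, by omega⟩
    · rintro ⟨h1, h2⟩; exact ⟨h1, Or.inl h2⟩
  rw [symCoeff, prod_invRoots, hset]
  refine Finset.prod_congr rfl fun p _ => ?_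
  have hdot : ∀ j k : Fin N, (eps ((sortElt μ)⁻¹ k) - eps ((sortElt μ)⁻¹ j)) ⬝ᵥ
      (toVec μp + κ • rho N) = eta κ β μ k - eta κ β μ j := by
    intro j k
    rw [← toPartition_eq_of_mem_orbit hp h]
    have hd : ∀ p : Fin N, rho N p = (delta N p : ℝ) + (1 - (N : ℝ)) / 2 := by
      intro p
      have : (delta N p : ℝ) = (N : ℝ) - (p + 1) := by
        unfold delta
        rw [Nat.cast_sub (by omega)]
        push_cast
        ring
      rw [this, rho]
      ring
    simp only [eps, sub_dotProduct, single_one_dotProduct, Pi.add_apply, Pi.smul_apply, toVec,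
      toPartition, act, inv_inv, perm_apply_inv, hd, delta_sortElt, smul_eq_mul, eta]
    ring
  rw [hdot]

/-- The exchange maps the inversions of μ other than (i, i') bijectively onto the inversions of the
exchanged composition and transports η accordingly. Only the factor of (i, i') is left over. -/
theorem symCoeff_eq_mul {κ : ℝ} (hκ : 0 ≤ κ) (β ε : ℝ) {μp μ : Fin N → ℕ} (hp : IsPartition μp)
    (h : μ ∈ orbit μp) {i i' : Fin N} (hi : (i : ℕ) + 1 = i') (hlt : μ i < μ i') :
    symCoeff κ ε μp μ = ε * (1 - ε * (κ / (eta κ β μ i' - eta κ β μ i))) *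
      symCoeff κ ε μp (μ ∘ Equiv.swap i i') := by
  classical
  have h' : μ ∘ Equiv.swap i i' ∈ orbit μp := by
    obtain ⟨w, rfl⟩ := mem_orbit.1 h
    exact mem_orbit.2 ⟨w * Equiv.swap i i', by simp [Function.comp_assoc]⟩
  have hii : i < i' := by rw [Fin.lt_def]; omega
  have hmem : (i, i') ∈ Finset.univ.filter
      (fun p : Fin N × Fin N => p.1 < p.2 ∧ μ p.1 < μ p.2) := by
    simp [hlt, hii]
  rw [symCoeff_eq κ β ε hp h, symCoeff_eq κ β ε hp h', ← Finset.mul_prod_erase _ _ hmem]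
  congr 1
  · have : eta κ β μ i' - eta κ β μ i ≠ 0 := (sub_pos.2 (eta_lt_of_lt hκ β hlt)).ne'
    field_simp
  · refine Finset.prod_bij (fun p _ => (Equiv.swap i i' p.1, Equiv.swap i i' p.2)) ?_ ?_ ?_ ?_
    · rintro ⟨j, k⟩ hp
      simp only [Finset.mem_erase, Finset.mem_filter, Finset.mem_univ, true_and, ne_eq,
        Prod.mk.injEq] at hp
      have hlt' : Equiv.swap i i' j < Equiv.swap i i' k :=
        (swap_lt_swap_iff hi hp.1 (fun e => by
          have := hp.2.1; rw [e.1, e.2] at this; exact lt_asymm this hii)).2 hp.2.1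
      simp [hlt', hp.2.2]
    · rintro ⟨j, k⟩ _ ⟨j', k'⟩ _ e
      simpa using e
    · rintro ⟨j, k⟩ hp
      simp only [Finset.mem_filter, Finset.mem_univ, true_and, Function.comp_apply] at hp
      refine ⟨(Equiv.swap i i' j, Equiv.swap i i' k), ?_, by simp⟩
      have hjk : ¬ (j = i ∧ k = i') := by
        rintro ⟨rfl, rfl⟩
        simp only [Equiv.swap_apply_left, Equiv.swap_apply_right] at hp
        omega
      have hjk' : ¬ (j = i' ∧ k = i) := by
        rintro ⟨rfl, rfl⟩
        exact lt_asymm hp.1 hii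
      have hlt' := (swap_lt_swap_iff hi hjk hjk').2 hp.1
      simp only [Finset.mem_erase, Finset.mem_filter, Finset.mem_univ, ne_eq,
        Prod.mk.injEq, hlt', hp.2, and_true]
      rintro ⟨e1, e2⟩
      rw [Equiv.swap_apply_eq_iff] at e1 e2
      exact hjk' ⟨by simpa using e1, by simpa using e2⟩
    · rintro ⟨j, k⟩ _
      simp [eta_comp_swap κ β hi hlt.ne]

/-! ## A transitive order on compositions refining `CompLE` -/

/-- Every partial sum of `ν` is bounded by a partial sum of `μ` with the same number of terms. -/
def Dom (ν μ : Fin N → ℕ) : Prop :=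
  ∀ I : Finset (Fin N), ∃ J : Finset (Fin N), J.card = I.card ∧ ∑ i ∈ I, ν i ≤ ∑ i ∈ J, μ i

theorem Dom.trans {κ ν μ : Fin N → ℕ} (h1 : Dom κ ν) (h2 : Dom ν μ) : Dom κ μ := fun I => by
  obtain ⟨J, hJ, hJ'⟩ := h1 I
  obtain ⟨L, hL, hL'⟩ := h2 J
  exact ⟨L, hL.trans hJ, hJ'.trans hL'⟩

theorem dom_comp_left (μ : Fin N → ℕ) (w : Equiv.Perm (Fin N)) : Dom (μ ∘ w) μ := fun I =>
  ⟨I.map w.toEmbedding, by simp, by simp⟩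

theorem dom_comp_right (μ : Fin N → ℕ) (w : Equiv.Perm (Fin N)) : Dom μ (μ ∘ w) := by
  have := dom_comp_left (μ ∘ w) w⁻¹
  rwa [show (μ ∘ w) ∘ (w⁻¹ : Equiv.Perm (Fin N)) = μ from
    funext fun i => by simp [Function.comp_apply]] at this

/-- The sum of the squares of the parts. -/
def sqSum (μ : Fin N → ℕ) : ℕ := ∑ j, μ j ^ 2

theorem sqSum_comp (μ : Fin N → ℕ) (w : Equiv.Perm (Fin N)) : sqSum (μ ∘ w) = sqSum μ :=
  Equiv.sum_comp w fun j => μ j ^ 2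

theorem degree_comp (μ : Fin N → ℕ) (w : Equiv.Perm (Fin N)) : degree (μ ∘ w) = degree μ :=
  Equiv.sum_comp w μ

/-- A linear function that is positive on the positive roots. -/
def weight (μ : Fin N → ℕ) : ℕ := ∑ j, delta N j * μ j

/-- The transitive relation that governs the Cherednik operators on monomials. -/
def Low (ν μ : Fin N → ℕ) : Prop :=
  degree ν < degree μ ∨ (degree ν = degree μ ∧ Dom ν μ ∧ sqSum ν < sqSum μ) ∨
    ((∃ w : Equiv.Perm (Fin N), ν = μ ∘ w) ∧ toVec μ - toVec ν ∈ posRootLattice N)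

theorem Low.refl (μ : Fin N → ℕ) : Low μ μ :=
  Or.inr (Or.inr ⟨⟨1, rfl⟩, by rw [sub_self]; exact zero_mem _⟩)

theorem Low.degree_le {ν μ : Fin N → ℕ} (h : Low ν μ) : degree ν ≤ degree μ := by
  rcases h with h | h | ⟨⟨w, rfl⟩, -⟩
  · exact h.le
  · exact h.1.le
  · exact (degree_comp μ w).le

/-- Degree and `sqSum` are invariant under permutations and `Dom` absorbs them, so the clauses can
be mixed. Transitivity is what makes products of triangular operators triangular. -/
theorem Low.trans {κ ν μ : Fin N → ℕ} (h1 : Low κ ν) (h2 : Low ν μ) : Low κ μ := by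
  rcases h1 with h1 | ⟨h1, h1', h1''⟩ | ⟨⟨w, rfl⟩, h1⟩
  · exact Or.inl (h1.trans_le h2.degree_le)
  · rcases h2 with h2 | ⟨h2, h2', h2''⟩ | ⟨⟨w, rfl⟩, h2⟩
    · exact Or.inl (h1.trans_lt h2)
    · exact Or.inr (Or.inl ⟨h1.trans h2, h1'.trans h2', h1''.trans h2''⟩)
    · refine Or.inr (Or.inl ⟨h1.trans (degree_comp _ _), h1'.trans (dom_comp_left _ _), ?_⟩)
      rwa [sqSum_comp] at h1''
  · rcases h2 with h2 | ⟨h2, h2', h2''⟩ | ⟨⟨w', rfl⟩, h2⟩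
    · exact Or.inl (by rwa [degree_comp])
    · refine Or.inr (Or.inl ⟨by rwa [degree_comp], (dom_comp_left _ _).trans h2', ?_⟩)
      rwa [sqSum_comp]
    · refine Or.inr (Or.inr ⟨⟨w' * w, rfl⟩, ?_⟩)
      have := add_mem h1 h2
      rwa [sub_add_sub_cancel'] at this

/-- Pairing with δ takes the value 1 on every simple root. -/
theorem posRootLattice_cases {v : Fin N → ℝ} (hv : v ∈ posRootLattice N) :
    v = 0 ∨ 0 < ∑ j, (delta N j : ℝ) * v j := by
  induction hv using AddSubmonoid.closure_induction with
  | mem x hx =>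
    obtain ⟨j, k, hjk, rfl⟩ := hx
    right
    have h : ∀ i : Fin N, ∑ x, (delta N x : ℝ) * eps i x = delta N i := fun i => by
      simp [eps, Pi.single_apply]
    simp only [Pi.sub_apply, mul_sub, Finset.sum_sub_distrib, h, sub_pos, Nat.cast_lt]
    unfold delta
    omega
  | zero => exact Or.inl rfl
  | add x y _ _ hx hy =>
    rcases hx with rfl | hx
    · simpa using hy
    rcases hy with rfl | hy
    · right; simpa using hx
    · right
      simp only [Pi.add_apply, mul_add, Finset.sum_add_distrib]
      exact add_pos hx hy

/-- A rank function that is strictly monotone with respect to `Low`. -/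
def rank (μ : Fin N → ℕ) : ℕ ×ₗ ℕ ×ₗ ℕ := toLex (degree μ, toLex (sqSum μ, weight μ))

theorem weight_lt_of_sub_mem {ν μ : Fin N → ℕ} (h : toVec μ - toVec ν ∈ posRootLattice N)
    (hne : ν ≠ μ) : weight ν < weight μ := by
  rcases posRootLattice_cases h with h | h
  · refine absurd (funext fun j => ?_) hne
    have := congrFun (sub_eq_zero.1 h) j
    simp only [toVec, Nat.cast_inj] at this
    exact this.symm
  · simp only [Pi.sub_apply, toVec, mul_sub, Finset.sum_sub_distrib, sub_pos] at h
    unfold weight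
    exact_mod_cast h

theorem Low.rank_lt {ν μ : Fin N → ℕ} (h : Low ν μ) (hne : ν ≠ μ) : rank ν < rank μ := by
  simp only [rank, Prod.Lex.toLex_lt_toLex]
  rcases h with h | ⟨h, -, h'⟩ | ⟨⟨w, rfl⟩, h⟩
  · exact Or.inl h
  · exact Or.inr ⟨h, Or.inl h'⟩
  · exact Or.inr ⟨degree_comp _ _, Or.inr ⟨sqSum_comp _ _, weight_lt_of_sub_mem h hne⟩⟩

/-- Exchange the entries outside the initial segment against those missing from it: the former are
at most f l, the latter at least f l, and there are equally many. -/
theorem sum_le_sum_Iic {f : Fin N → ℕ} (hf : Antitone f) (l : Fin N) (s : Finset (Fin N))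
    (hs : s.card = (Finset.univ.filter fun k => k ≤ l).card) :
    ∑ i ∈ s, f i ≤ ∑ i ∈ Finset.univ.filter (fun k => k ≤ l), f i := by
  set t := Finset.univ.filter fun k => k ≤ l
  have hcard : (s \ t).card = (t \ s).card := Finset.card_sdiff_comm hs
  have h1 : ∑ i ∈ s \ t, f i ≤ (s \ t).card • f l := by
    refine Finset.sum_le_card_nsmul _ _ _ fun i hi => hf ?_
    simp only [t, Finset.mem_sdiff, Finset.mem_filter, Finset.mem_univ, true_and] at hi
    omega
  have h2 : (t \ s).card • f l ≤ ∑ i ∈ t \ s, f i := by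
    refine Finset.card_nsmul_le_sum _ _ _ fun i hi => hf ?_
    simp only [t, Finset.mem_sdiff, Finset.mem_filter, Finset.mem_univ, true_and] at hi
    exact hi.1
  rw [hcard] at h1
  rw [← Finset.sum_inter_add_sum_sdiff s t, ← Finset.sum_inter_add_sum_sdiff t s,
    Finset.inter_comm t s]
  exact Nat.add_le_add_left (h1.trans h2) _

theorem toPartition_eq_comp (μ : Fin N → ℕ) : toPartition μ = μ ∘ sortElt μ := by
  funext i
  simp [toPartition, act]

theorem mem_orbit_toPartition {ν μ : Fin N → ℕ} :
    ν ∈ orbit (toPartition μ) ↔ ∃ w : Equiv.Perm (Fin N), ν = μ ∘ w := by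
  rw [mem_orbit, toPartition_eq_comp]
  constructor
  · rintro ⟨w, rfl⟩
    exact ⟨sortElt μ * w, rfl⟩
  · rintro ⟨w, rfl⟩
    exact ⟨(sortElt μ)⁻¹ * w, by funext i; simp⟩

/-- The bridge from the working order to the order of the theorem; the converse is not needed. A
strict drop of `sqSum` excludes the same orbit, and `Dom` between the sorted compositions, tested on
initial segments, is dominance. -/
theorem Low.compLE_or {ν μ : Fin N → ℕ} (h : Low ν μ) :
    CompLE ν μ ∨ degree ν < degree μ := by
  rcases h with h | ⟨h, h', h''⟩ | ⟨hw, h⟩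
  · exact Or.inr h
  · refine Or.inl (Or.inl ⟨?_, ?_, ?_, ?_⟩)
    · rw [mem_orbit_toPartition]
      rintro ⟨w, rfl⟩
      rw [sqSum_comp] at h''
      exact lt_irrefl _ h''
    · intro e
      have := congrArg sqSum e
      rw [toPartition_eq_comp, toPartition_eq_comp, sqSum_comp, sqSum_comp] at this
      omega
    · rw [toPartition_eq_comp, toPartition_eq_comp, degree_comp, degree_comp, h]
    · intro l
      have hdom : Dom (toPartition ν) (toPartition μ) := by
        rw [toPartition_eq_comp, toPartition_eq_comp]
        exact ((dom_comp_left _ _).trans h').trans (dom_comp_right _ _)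
      obtain ⟨J, hJ, hJ'⟩ := hdom (Finset.univ.filter fun k => k ≤ l)
      exact hJ'.trans (sum_le_sum_Iic (sortElt_spec μ).1 l J hJ)
  · exact Or.inl (Or.inr ⟨mem_orbit_toPartition.2 hw, h⟩)

/-! ### Moves on exponents that go down in the order -/

theorem eps_sub_eps_mem_posRootLattice {j k : Fin N} (h : j < k) :
    eps j - eps k ∈ posRootLattice N := by
  obtain ⟨k, hk⟩ := k
  induction k with
  | zero => simp [Fin.lt_def] at h
  | succ k ih =>
    have hk' : k < N := by omega
    have hs : eps ⟨k, hk'⟩ - eps ⟨k + 1, hk⟩ ∈ posRootLattice N :=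
      AddSubmonoid.subset_closure ⟨_, _, rfl, rfl⟩
    by_cases hjk : j = ⟨k, hk'⟩
    · rwa [hjk]
    · have hlt : j < ⟨k, hk'⟩ := by
        simp only [Fin.lt_def, Fin.ext_iff] at h hjk ⊢
        omega
      have := add_mem (ih hk' hlt) hs
      rwa [sub_add_sub_cancel] at this

theorem toVec_sub_toVec_comp_swap (μ : Fin N → ℕ) {j k : Fin N} (hjk : j ≠ k) :
    toVec μ - toVec (μ ∘ Equiv.swap j k) = ((μ j : ℝ) - μ k) • (eps j - eps k) := by
  funext i
  simp only [Pi.sub_apply, toVec, Function.comp_apply, Pi.smul_apply, smul_eq_mul, eps,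
    Pi.single_apply]
  by_cases hj : i = j
  · subst hj; simp [hjk]
  by_cases hk : i = k
  · subst hk; simp [hj]
  · simp [Equiv.swap_apply_of_ne_of_ne hj hk, hj, hk]

theorem low_comp_swap {μ : Fin N → ℕ} {j k : Fin N} (hjk : j < k) (h : μ k ≤ μ j) :
    Low (μ ∘ Equiv.swap j k) μ := by
  refine Or.inr (Or.inr ⟨⟨_, rfl⟩, ?_⟩)
  rw [toVec_sub_toVec_comp_swap μ hjk.ne, ← Nat.cast_sub h, Nat.cast_smul_eq_nsmul]
  exact nsmul_mem (eps_sub_eps_mem_posRootLattice hjk) _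

theorem sum_eq_add_add {M : Type*} [AddCommMonoid M] (f : Fin N → M) {I : Finset (Fin N)}
    {j k : Fin N} (hjk : j ≠ k) (hj : j ∈ I) (hk : k ∈ I) :
    ∑ i ∈ I, f i = f j + (f k + ∑ i ∈ (I.erase j).erase k, f i) := by
  rw [Finset.add_sum_erase _ _ (Finset.mem_erase.2 ⟨hjk.symm, hk⟩), Finset.add_sum_erase _ _ hj]

/-- Moving two parts strictly towards each other with fixed sum lowers the sum of squares and bounds
each partial sum by one of equal size. -/
theorem low_of_between_aux {ν μ : Fin N → ℕ} {j k : Fin N} (hjk : j ≠ k)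
    (hoff : ∀ i, i ≠ j → i ≠ k → ν i = μ i) (hsum : ν j + ν k = μ j + μ k)
    (h1 : μ k < ν j) (h2 : ν j < μ j) : Low ν μ := by
  have hrest : ∀ (f : ℕ → ℕ) (I : Finset (Fin N)),
      ∑ i ∈ (I.erase j).erase k, f (ν i) = ∑ i ∈ (I.erase j).erase k, f (μ i) := by
    intro f I
    refine Finset.sum_congr rfl fun i hi => ?_
    simp only [Finset.mem_erase] at hi
    rw [hoff i hi.2.1 hi.1]
  refine Or.inr (Or.inl ⟨?_, ?_, ?_⟩)
  · have := hrest id Finset.univ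
    simp only [id] at this
    rw [degree, degree, sum_eq_add_add ν hjk (Finset.mem_univ j) (Finset.mem_univ k),
      sum_eq_add_add μ hjk (Finset.mem_univ j) (Finset.mem_univ k), this]
    omega
  · intro I
    by_cases hj : j ∈ I
    · refine ⟨I, rfl, ?_⟩
      by_cases hk : k ∈ I
      · have := hrest id I
        simp only [id] at this
        rw [sum_eq_add_add ν hjk hj hk, sum_eq_add_add μ hjk hj hk, this]
        omega
      · refine Finset.sum_le_sum fun i hi => ?_
        by_cases hij : i = j
        · subst hij; exact h2.le
        · exact (hoff i hij (fun e => hk (e ▸ hi))).le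
    -- When j is absent, the part ν_k, if present, is bounded by μ_j rather than by μ_k; hence the
    -- exchanged index set.
    · refine ⟨I.map (Equiv.swap j k).toEmbedding, by simp, ?_⟩
      rw [Finset.sum_map]
      refine Finset.sum_le_sum fun i hi => ?_
      have hij : i ≠ j := fun e => hj (e ▸ hi)
      by_cases hik : i = k
      · subst hik
        simp only [Equiv.coe_toEmbedding, Equiv.swap_apply_right]
        omega
      · simp [Equiv.swap_apply_of_ne_of_ne hij hik, hoff i hij hik]
  · have := hrest (fun x => x ^ 2) Finset.univ
    rw [sqSum, sqSum, sum_eq_add_add _ hjk (Finset.mem_univ j) (Finset.mem_univ k),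
      sum_eq_add_add (fun i => μ i ^ 2) hjk (Finset.mem_univ j) (Finset.mem_univ k), this]
    nlinarith

theorem low_of_between {ν μ : Fin N → ℕ} {j k : Fin N} (hjk : j ≠ k)
    (hoff : ∀ i, i ≠ j → i ≠ k → ν i = μ i) (hsum : ν j + ν k = μ j + μ k)
    (h : (μ k < ν j ∧ ν j < μ j) ∨ (μ j < ν j ∧ ν j < μ k)) : Low ν μ := by
  rcases h with ⟨h1, h2⟩ | ⟨h1, h2⟩
  · exact low_of_between_aux hjk hoff hsum h1 h2
  · exact low_of_between_aux hjk.symm (fun i hk hj => hoff i hj hk) (by omega) (by omega)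
      (by omega)

/-- Undoing the exchange goes down, so the exchanged composition has larger `weight`, against any
difference in Q_+. Consequently h_μ has no term x^{sμ} when μ_j < μ_k. -/
theorem not_compLE_comp_swap {μ : Fin N → ℕ} {j k : Fin N} (hjk : j < k) (h : μ j < μ k) :
    ¬ (CompLE (μ ∘ Equiv.swap j k) μ ∨ degree (μ ∘ Equiv.swap j k) < degree μ) := by
  rw [degree_comp]
  have hne : μ ∘ Equiv.swap j k ≠ μ := fun e => by
    have := congrFun e j
    simp at this
    omega
  rintro ((⟨h1, -⟩ | ⟨-, h1⟩) | h1)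
  · exact h1 (mem_orbit_toPartition.2 ⟨_, rfl⟩)
  · have h2 := weight_lt_of_sub_mem h1 hne
    have h3 : Low ((μ ∘ Equiv.swap j k) ∘ Equiv.swap j k) (μ ∘ Equiv.swap j k) :=
      low_comp_swap hjk (by simpa using h.le)
    have e : (μ ∘ Equiv.swap j k) ∘ Equiv.swap j k = μ := by funext i; simp
    rw [e] at h3
    have h4 := h3.rank_lt hne.symm
    simp only [rank, Prod.Lex.toLex_lt_toLex, degree_comp, sqSum_comp] at h4
    omega
  · exact lt_irrefl _ h1

/-! ## Monomials and coefficients -/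

/-- The linear operators on polynomials. -/
abbrev Op (N : ℕ) := Module.End ℂ (MvPolynomial (Fin N) ℂ)

/-- The monomial `x^μ`. -/
def mono (μ : Fin N → ℕ) : MvPolynomial (Fin N) ℂ :=
  MvPolynomial.monomial (Finsupp.equivFunOnFinite.symm μ) 1

/-- The coefficient of `x^ν`. -/
def cf (ν : Fin N → ℕ) : MvPolynomial (Fin N) ℂ →ₗ[ℂ] ℂ :=
  MvPolynomial.lcoeff ℂ (Finsupp.equivFunOnFinite.symm ν)

theorem cf_apply (ν : Fin N → ℕ) (f : MvPolynomial (Fin N) ℂ) :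
    cf ν f = f.coeff (Finsupp.equivFunOnFinite.symm ν) := rfl

theorem cf_mono (ν μ : Fin N → ℕ) : cf ν (mono μ) = if ν = μ then 1 else 0 := by
  rw [cf_apply, mono, MvPolynomial.coeff_monomial]
  simp [eq_comm]

theorem ext_cf {f g : MvPolynomial (Fin N) ℂ} (h : ∀ ν, cf ν f = cf ν g) : f = g := by
  ext m
  have := h (Finsupp.equivFunOnFinite m)
  simpa [cf_apply] using this

/-- The exponents of the monomials of `f`. -/
def expts (f : MvPolynomial (Fin N) ℂ) : Finset (Fin N → ℕ) :=
  f.support.map Finsupp.equivFunOnFinite.toEmbedding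

theorem mem_expts {f : MvPolynomial (Fin N) ℂ} {ν : Fin N → ℕ} : ν ∈ expts f ↔ cf ν f ≠ 0 := by
  simp only [expts, Finset.mem_map_equiv, MvPolynomial.mem_support_iff, cf_apply]

theorem eq_sum_mono (f : MvPolynomial (Fin N) ℂ) : f = ∑ κ ∈ expts f, cf κ f • mono κ := by
  refine ext_cf fun ν => ?_
  simp only [map_sum, map_smul, cf_mono, smul_eq_mul, mul_ite, mul_one, mul_zero,
    Finset.sum_ite_eq]
  split_ifs with h
  · rfl
  · rw [mem_expts, not_not] at h
    exact h

theorem cf_op_apply (A : Op N) (f : MvPolynomial (Fin N) ℂ) (ν : Fin N → ℕ) :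
    cf ν (A f) = ∑ κ ∈ expts f, cf κ f * cf ν (A (mono κ)) := by
  conv_lhs => rw [eq_sum_mono f]
  simp

theorem op_ext {A B : Op N} (h : ∀ μ, A (mono μ) = B (mono μ)) : A = B := by
  refine LinearMap.ext fun f => ext_cf fun ν => ?_
  rw [cf_op_apply, cf_op_apply]
  simp [h]

theorem mono_mul_mono (μ ν : Fin N → ℕ) : mono μ * mono ν = mono (μ + ν) := by
  rw [mono, mono, mono, MvPolynomial.monomial_mul, one_mul,
    show Finsupp.equivFunOnFinite.symm μ + Finsupp.equivFunOnFinite.symm ν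
      = Finsupp.equivFunOnFinite.symm (μ + ν) from Finsupp.ext fun _ => rfl]

theorem X_pow_eq_mono (j : Fin N) (p : ℕ) :
    (MvPolynomial.X j : MvPolynomial (Fin N) ℂ) ^ p = mono (Pi.single j p) := by
  rw [MvPolynomial.X_pow_eq_monomial, mono]
  congr 1
  ext i
  simp

theorem mono_eq_prod (μ : Fin N → ℕ) : mono μ = ∏ i, MvPolynomial.X i ^ μ i := by
  rw [mono, MvPolynomial.monomial_eq]
  simp [Finsupp.prod_fintype]

/-! ## Permutations and reflections of the variables -/

/-- The permutation `w` of the variables. -/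
def permOp (w : Equiv.Perm (Fin N)) : Op N :=
  (MvPolynomial.rename w : MvPolynomial (Fin N) ℂ →ₐ[ℂ] MvPolynomial (Fin N) ℂ).toLinearMap

/-- The reflection `t_j`. -/
def reflOp (j : Fin N) : Op N := (reflect j).toLinearMap

theorem permOp_apply (w : Equiv.Perm (Fin N)) (f : MvPolynomial (Fin N) ℂ) :
    permOp w f = MvPolynomial.rename w f := rfl

theorem reflOp_apply (j : Fin N) (f : MvPolynomial (Fin N) ℂ) : reflOp j f = reflect j f := rfl

theorem permOp_mul_apply (w : Equiv.Perm (Fin N)) (f g : MvPolynomial (Fin N) ℂ) :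
    permOp w (f * g) = permOp w f * permOp w g := map_mul (MvPolynomial.rename w) f g

theorem reflOp_mul_apply (j : Fin N) (f g : MvPolynomial (Fin N) ℂ) :
    reflOp j (f * g) = reflOp j f * reflOp j g := map_mul (reflect j) f g

theorem permOp_X (w : Equiv.Perm (Fin N)) (i : Fin N) :
    permOp w (MvPolynomial.X i) = MvPolynomial.X (w i) := MvPolynomial.rename_X _ _

theorem permOp_mul (w w' : Equiv.Perm (Fin N)) : permOp w * permOp w' = permOp (w * w') := by
  refine LinearMap.ext fun f => ?_
  simp [permOp_apply, MvPolynomial.rename_rename]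

theorem permOp_one : permOp (1 : Equiv.Perm (Fin N)) = 1 := by
  refine LinearMap.ext fun f => ?_
  simp [permOp_apply]

theorem cf_permOp (w : Equiv.Perm (Fin N)) (f : MvPolynomial (Fin N) ℂ) (ν : Fin N → ℕ) :
    cf ν (permOp w f) = cf (ν ∘ w) f := by
  have h : (Finsupp.equivFunOnFinite.symm ν : Fin N →₀ ℕ)
      = (Finsupp.equivFunOnFinite.symm (ν ∘ w)).mapDomain w := by
    ext i
    obtain ⟨i, rfl⟩ := w.surjective i
    rw [Finsupp.mapDomain_apply w.injective]
    rfl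
  rw [cf_apply, h, permOp_apply, MvPolynomial.coeff_rename_mapDomain _ w.injective, cf_apply]

theorem permOp_mono (w : Equiv.Perm (Fin N)) (μ : Fin N → ℕ) :
    permOp w (mono μ) = mono (μ ∘ (w⁻¹ : Equiv.Perm (Fin N))) := by
  refine ext_cf fun ν => ?_
  rw [cf_permOp, cf_mono, cf_mono]
  congr 1
  rw [eq_iff_iff]
  constructor
  · rintro rfl; funext i; simp
  · rintro rfl; funext i; simp

theorem permOp_swap_mono (j k : Fin N) (μ : Fin N → ℕ) :
    permOp (Equiv.swap j k) (mono μ) = mono (μ ∘ Equiv.swap j k) := by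
  rw [permOp_mono, Equiv.swap_inv]

theorem reflect_X (j i : Fin N) :
    reflect j (MvPolynomial.X i) = (if i = j then (-1 : ℂ) else 1) • MvPolynomial.X i := by
  simp only [reflect, MvPolynomial.aeval_X]
  split_ifs <;> simp

theorem reflOp_mono (j : Fin N) (μ : Fin N → ℕ) :
    reflOp j (mono μ) = (-1 : ℂ) ^ μ j • mono μ := by
  rw [reflOp_apply, mono_eq_prod, map_prod]
  simp only [map_pow, reflect_X, smul_pow]
  rw [Finset.prod_smul]
  congr 1
  simp [ite_pow]

theorem cf_reflOp (j : Fin N) (f : MvPolynomial (Fin N) ℂ) (ν : Fin N → ℕ) :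
    cf ν (reflOp j f) = (-1) ^ ν j * cf ν f := by
  conv_lhs => rw [eq_sum_mono f]
  conv_rhs => rw [eq_sum_mono f]
  simp only [map_sum, map_smul, reflOp_mono, Finset.mul_sum, cf_mono, smul_eq_mul]
  refine Finset.sum_congr rfl fun κ _ => ?_
  split_ifs with h
  · subst h; ring
  · ring

theorem reflOp_mul_self (j : Fin N) : reflOp j * reflOp j = 1 := by
  refine LinearMap.ext fun f => ext_cf fun ν => ?_
  rw [Module.End.mul_apply, cf_reflOp, cf_reflOp, ← mul_assoc, ← mul_pow]
  simp

theorem reflOp_comm (j k : Fin N) : reflOp j * reflOp k = reflOp k * reflOp j := by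
  refine LinearMap.ext fun f => ext_cf fun ν => ?_
  simp only [Module.End.mul_apply, cf_reflOp]
  ring

theorem permOp_mul_reflOp (w : Equiv.Perm (Fin N)) (j : Fin N) :
    permOp w * reflOp j = reflOp (w j) * permOp w := by
  refine LinearMap.ext fun f => ext_cf fun ν => ?_
  simp only [Module.End.mul_apply, cf_reflOp, cf_permOp, Function.comp_apply]

/-! ## Supports of operators -/

/-- The monomials `x^ν` of `A x^μ` satisfy `R ν μ`. -/
def SuppIn (R : (Fin N → ℕ) → (Fin N → ℕ) → Prop) (A : Op N) : Prop :=
  ∀ μ ν, cf ν (A (mono μ)) ≠ 0 → R ν μ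

/-- The diagonal coefficient of an operator. -/
def diag (μ : Fin N → ℕ) : Op N →ₗ[ℂ] ℂ := (cf μ).comp (LinearMap.applyₗ (mono μ))

theorem diag_apply (μ : Fin N → ℕ) (A : Op N) : diag μ A = cf μ (A (mono μ)) := rfl

namespace SuppIn

variable {R R' R'' : (Fin N → ℕ) → (Fin N → ℕ) → Prop} {A B : Op N}

theorem mono_rel (hA : SuppIn R A) (h : ∀ μ ν, R ν μ → R' ν μ) : SuppIn R' A :=
  fun μ ν hne => h μ ν (hA μ ν hne)

theorem add (hA : SuppIn R A) (hB : SuppIn R B) : SuppIn R (A + B) := fun μ ν h => by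
  by_contra hR
  rw [LinearMap.add_apply, map_add, not_not.1 (mt (hA μ ν) hR), not_not.1 (mt (hB μ ν) hR)] at h
  exact h (add_zero 0)

theorem smul (c : ℂ) (hA : SuppIn R A) : SuppIn R (c • A) := fun μ ν h => hA μ ν fun h' => h <| by
  rw [LinearMap.smul_apply, map_smul, h', smul_zero]

theorem sub (hA : SuppIn R A) (hB : SuppIn R B) : SuppIn R (A - B) := by
  have := hA.add (hB.smul (-1))
  rwa [show (-1 : ℂ) • B = -B from neg_one_smul ℂ B, ← sub_eq_add_neg] at this

theorem zero : SuppIn R (0 : Op N) := fun _ _ h => absurd (by simp) h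

theorem sum {ι : Type*} (s : Finset ι) (F : ι → Op N) (h : ∀ i ∈ s, SuppIn R (F i)) :
    SuppIn R (∑ i ∈ s, F i) := by
  classical
  induction s using Finset.induction_on with
  | empty => exact zero
  | insert i s hi ih =>
    rw [Finset.sum_insert hi]
    exact (h i (Finset.mem_insert_self i s)).add
      (ih fun k hk => h k (Finset.mem_insert_of_mem hk))

theorem mul (hA : SuppIn R A) (hB : SuppIn R' B) (h : ∀ κ ν μ, R κ ν → R' ν μ → R'' κ μ) :
    SuppIn R'' (A * B) := fun μ κ hne => by
  rw [Module.End.mul_apply, cf_op_apply] at hne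
  obtain ⟨ν, -, hν⟩ := Finset.exists_ne_zero_of_sum_ne_zero hne
  exact h κ ν μ (hA ν κ (right_ne_zero_of_mul hν)) (hB μ ν (left_ne_zero_of_mul hν))

theorem conj_reflOp (hA : SuppIn R A) (k : Fin N) : SuppIn R (reflOp k * A * reflOp k) :=
  fun μ ν hne => hA μ ν fun h => hne <| by
    simp only [Module.End.mul_apply, reflOp_mono, map_smul, cf_reflOp, h, mul_zero, smul_zero]

end SuppIn

theorem suppIn_permOp (w : Equiv.Perm (Fin N)) :
    SuppIn (fun ν μ => degree ν ≤ degree μ) (permOp w) := fun μ ν h => by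
  rw [permOp_mono, cf_mono] at h
  have : ν = μ ∘ (w⁻¹ : Equiv.Perm (Fin N)) := by
    by_contra hne
    rw [if_neg hne] at h
    exact h rfl
  rw [this, degree_comp]

theorem diag_conj_reflOp (μ : Fin N → ℕ) (A : Op N) (k : Fin N) :
    diag μ (reflOp k * A * reflOp k) = diag μ A := by
  simp only [diag_apply, Module.End.mul_apply, reflOp_mono, map_smul, cf_reflOp, smul_eq_mul]
  rw [← mul_assoc, ← mul_pow]
  simp

theorem suppIn_low_of_diagonal {A : Op N} {c : (Fin N → ℕ) → ℂ}
    (h : ∀ μ, A (mono μ) = c μ • mono μ) : SuppIn Low A := fun μ ν hne => by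
  rw [h, map_smul, cf_mono] at hne
  by_cases e : ν = μ
  · subst e; exact Low.refl ν
  · simp [e] at hne

theorem diag_eq_of_diagonal {A : Op N} {c : (Fin N → ℕ) → ℂ}
    (h : ∀ μ, A (mono μ) = c μ • mono μ) (μ : Fin N → ℕ) : diag μ A = c μ := by
  rw [diag_apply, h, map_smul, cf_mono]
  simp

theorem mulX_apply (j : Fin N) (f : MvPolynomial (Fin N) ℂ) : mulX j f = MvPolynomial.X j * f := rfl

/-- An operator that does not raise degrees after multiplication by `x_j` lowers degrees. -/
theorem suppIn_degree_lt_of_mulX {A : Op N} {j : Fin N}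
    (h : SuppIn (fun ν μ => degree ν ≤ degree μ) (mulX j * A)) :
    SuppIn (fun ν μ => degree ν < degree μ) A := fun μ ν hne => by
  have h1 : cf (Pi.single j 1 + ν) ((mulX j * A) (mono μ)) = cf ν (A (mono μ)) := by
    rw [Module.End.mul_apply, mulX_apply, cf_apply,
      show (Finsupp.equivFunOnFinite.symm (Pi.single j 1 + ν) : Fin N →₀ ℕ)
        = Finsupp.single j 1 + Finsupp.equivFunOnFinite.symm ν from ?_, MvPolynomial.coeff_X_mul,
      cf_apply]
    ext i
    simp [Finsupp.single_apply, Pi.single_apply, eq_comm]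
  have h2 := h μ _ (h1.symm ▸ hne)
  have h3 : degree (Pi.single j 1 + ν) = 1 + degree ν := by
    simp [degree, Finset.sum_add_distrib]
  omega

/-! ## Divided differences -/

/-- The divided difference `(x_j - x_k)⁻¹ (1 - K_{jk})`, which is zero for `j = k`. -/
def divOp (j k : Fin N) : Op N :=
  if h : k ≠ j then divDiff (MvPolynomial.X j - MvPolynomial.X k) (exch j k) (X_sub_X_ne_zero h)
      (dvd_sub_exch j k) else 0

theorem mul_divOp (j k : Fin N) (f : MvPolynomial (Fin N) ℂ) :
    (MvPolynomial.X j - MvPolynomial.X k) * divOp j k f = f - permOp (Equiv.swap j k) f := by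
  unfold divOp
  split_ifs with h
  · exact mul_divDiff _ _ _ _ f
  · rw [not_not] at h
    subst h
    rw [Equiv.swap_self]
    change _ = f - permOp 1 f
    rw [permOp_one]
    simp

theorem divOp_self (j : Fin N) : divOp j j = 0 := by simp [divOp]

theorem divOp_eq_of_mul {j k : Fin N} (h : k ≠ j) {f g : MvPolynomial (Fin N) ℂ}
    (hg : (MvPolynomial.X j - MvPolynomial.X k) * g = f - permOp (Equiv.swap j k) f) :
    divOp j k f = g :=
  mul_left_cancel₀ (X_sub_X_ne_zero h) ((mul_divOp j k f).trans hg.symm)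

/-- The composition `μ` with the parts `μ_j`, `μ_k` replaced. -/
def setParts (μ : Fin N → ℕ) (j k : Fin N) (p q : ℕ) : Fin N → ℕ :=
  fun i => if i = j then p else if i = k then q else μ i

theorem mono_setParts (μ : Fin N → ℕ) {j k : Fin N} (h : k ≠ j) (p q : ℕ) :
    mono (setParts μ j k p q)
      = mono (setParts μ j k 0 0) * (MvPolynomial.X j ^ p * MvPolynomial.X k ^ q) := by
  rw [X_pow_eq_mono, X_pow_eq_mono, mono_mul_mono, mono_mul_mono]
  congr 1
  funext i
  simp only [setParts, Pi.add_apply, Pi.single_apply]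
  by_cases hj : i = j
  · subst hj; simp [h.symm]
  · by_cases hk : i = k
    · subst hk; simp [h]
    · simp [hj, hk]

theorem X_mul_geom {R : Type*} [CommRing R] (c x y : R) (q m : ℕ) :
    x * (c * (x * y) ^ q * ∑ r ∈ Finset.range (m + 1), x ^ r * y ^ (m + 1 - 1 - r))
      = ∑ r ∈ Finset.range m, c * (x ^ (q + r + 1) * y ^ (q + (m - r)))
        + c * (x ^ (q + m + 1) * y ^ q) := by
  rw [Finset.sum_range_succ, mul_add, mul_add, Finset.mul_sum, Finset.mul_sum]
  congr 1
  · refine Finset.sum_congr rfl fun r _ => ?_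
    rw [Nat.add_sub_cancel, mul_pow]
    ring
  · rw [Nat.add_sub_cancel, Nat.sub_self, mul_pow]
    ring

/-- The terms of `x_j (x_j - x_k)⁻¹ (1 - K_{jk}) x^μ` strictly between `x^μ` and `K_{jk} x^μ`. -/
def betweenSum (μ : Fin N → ℕ) (j k : Fin N) (q m : ℕ) : MvPolynomial (Fin N) ℂ :=
  ∑ r ∈ Finset.range m, mono (setParts μ j k (q + r + 1) (q + (m - r)))

theorem setParts_self {μ : Fin N → ℕ} {j k : Fin N} {p q : ℕ} (hj : μ j = p) (hk : μ k = q) :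
    setParts μ j k p q = μ := by
  funext i
  simp only [setParts]
  split_ifs with h1 h2
  · rw [h1, hj]
  · rw [h2, hk]
  · rfl

theorem setParts_swap {μ : Fin N → ℕ} {j k : Fin N} {p q : ℕ} (hj : μ j = q)
    (hk : μ k = p) : setParts μ j k p q = μ ∘ Equiv.swap j k := by
  funext i
  simp only [setParts, Function.comp_apply, Equiv.swap_apply_def]
  split_ifs with h1 h2
  · exact hk.symm
  · exact hj.symm
  · rfl

theorem X_mul_divOp_mono_of_gt {μ : Fin N → ℕ} {j k : Fin N} (h : k ≠ j) {q m : ℕ}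
    (hj : μ j = q + m + 1) (hk : μ k = q) :
    MvPolynomial.X j * divOp j k (mono μ) = betweenSum μ j k q m + mono μ := by
  set c := mono (setParts μ j k 0 0)
  have hμ : mono μ = c * (MvPolynomial.X j ^ (q + m + 1) * MvPolynomial.X k ^ q) := by
    rw [← mono_setParts μ h, setParts_self hj hk]
  have hs : mono (μ ∘ Equiv.swap j k)
      = c * (MvPolynomial.X j ^ q * MvPolynomial.X k ^ (q + m + 1)) := by
    rw [← mono_setParts μ h, Equiv.swap_comm]
    congr 1
    rw [← setParts_swap hk hj]
    funext i
    simp only [setParts]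
    split_ifs with h1 h2 <;> simp_all
  -- After the common factor (x_j x_k)^q is taken out, the quotient is the geometric sum for the
  -- exponent m + 1.
  have hg : divOp j k (mono μ) = c * (MvPolynomial.X j * MvPolynomial.X k) ^ q *
      ∑ r ∈ Finset.range (m + 1), MvPolynomial.X j ^ r * MvPolynomial.X k ^ (m + 1 - 1 - r) := by
    refine divOp_eq_of_mul h ?_
    rw [mul_comm, mul_assoc, geom_sum₂_mul, permOp_swap_mono, hμ, hs]
    ring
  rw [hg, X_mul_geom, betweenSum, hμ]
  simp only [← mono_setParts μ h, c]

/-- Since (1 - K)K = -(1 - K), the divided difference changes sign when its argument is exchanged,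
and the case of the larger first part applies. -/
theorem X_mul_divOp_mono_of_lt {μ : Fin N → ℕ} {j k : Fin N} (h : k ≠ j) {q m : ℕ}
    (hj : μ j = q) (hk : μ k = q + m + 1) :
    MvPolynomial.X j * divOp j k (mono μ)
      = -betweenSum μ j k q m - mono (μ ∘ Equiv.swap j k) := by
  have h1 := X_mul_divOp_mono_of_gt (μ := μ ∘ Equiv.swap j k) h (q := q) (m := m)
    (by simp [hk]) (by simp [hj])
  have h2 : divOp j k (mono (μ ∘ Equiv.swap j k)) = - divOp j k (mono μ) := by
    refine divOp_eq_of_mul h ?_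
    rw [mul_neg, mul_divOp, permOp_swap_mono, permOp_swap_mono, neg_sub]
    congr 2
    funext i
    simp
  have h3 : betweenSum (μ ∘ Equiv.swap j k) j k q m = betweenSum μ j k q m := by
    unfold betweenSum
    refine Finset.sum_congr rfl fun r _ => ?_
    congr 1
    funext i
    simp only [setParts, Function.comp_apply, Equiv.swap_apply_def]
    split_ifs <;> rfl
  rw [h2, h3, mul_neg] at h1
  rw [neg_eq_iff_eq_neg.1 h1]
  ring

theorem divOp_mono_of_eq {μ : Fin N → ℕ} {j k : Fin N} (h : k ≠ j) (he : μ j = μ k) :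
    divOp j k (mono μ) = 0 := by
  refine divOp_eq_of_mul h ?_
  rw [permOp_swap_mono, ← setParts_swap rfl rfl, ← he, mul_zero, setParts_self rfl he.symm,
    sub_self]

theorem cf_betweenSum {μ ν : Fin N → ℕ} {j k : Fin N} {q m : ℕ}
    (h : cf ν (betweenSum μ j k q m) ≠ 0) :
    ∃ r < m, ν = setParts μ j k (q + r + 1) (q + (m - r)) := by
  rw [betweenSum, map_sum] at h
  obtain ⟨r, hr, hne⟩ := Finset.exists_ne_zero_of_sum_ne_zero h
  refine ⟨r, Finset.mem_range.1 hr, ?_⟩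
  rw [cf_mono] at hne
  by_contra e
  simp [e] at hne

theorem low_of_cf_betweenSum {μ ν : Fin N → ℕ} {j k : Fin N} (hkj : k ≠ j) {q m : ℕ}
    (hμ : (μ j = q + m + 1 ∧ μ k = q) ∨ (μ j = q ∧ μ k = q + m + 1))
    (h : cf ν (betweenSum μ j k q m) ≠ 0) : Low ν μ ∧ ν ≠ μ := by
  obtain ⟨r, hr, rfl⟩ := cf_betweenSum h
  have h1 : setParts μ j k (q + r + 1) (q + (m - r)) j = q + r + 1 := by simp [setParts]
  have h2 : setParts μ j k (q + r + 1) (q + (m - r)) k = q + (m - r) := by simp [setParts, hkj]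
  constructor
  · refine low_of_between hkj.symm (fun i hj hk => by simp [setParts, hj, hk]) ?_ ?_
    · rw [h1, h2]; omega
    · rw [h1]; omega
  · intro e
    rw [e] at h1
    omega

/-- The operator `x_j (x_j - x_k)⁻¹ (1 - K_{jk})`, corrected by `K_{jk}` for `j < k`. -/
def pairOp (j k : Fin N) : Op N :=
  mulX j * divOp j k + if j < k then permOp (Equiv.swap j k) else 0

open Classical in
-- The correction by K_{jk} is what makes the operator triangular. For j < k and μ_j < μ_k it
-- cancels the term -K_{jk} x^μ, which lies above x^μ; for μ_j = μ_k it supplies the diagonal entry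
-- decided by the tie-break; for μ_j > μ_k it only adds a lower monomial. For k < j no correction is
-- needed, as the exchanged monomial, when it occurs, is already lower.
theorem pairOp_mono {j k : Fin N} (h : k ≠ j) (μ : Fin N → ℕ) :
    ∃ g, pairOp j k (mono μ) = (if Follows μ k j then (1 : ℂ) else 0) • mono μ + g ∧
      ∀ ν, cf ν g ≠ 0 → Low ν μ ∧ ν ≠ μ := by
  have key : pairOp j k (mono μ) = MvPolynomial.X j * divOp j k (mono μ)
      + if j < k then mono (μ ∘ Equiv.swap j k) else 0 := by
    rw [pairOp, LinearMap.add_apply, Module.End.mul_apply, mulX_apply]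
    congr 1
    split_ifs
    · exact permOp_swap_mono j k μ
    · rfl
  have hne : ∀ i i' : Fin N, μ i ≠ μ i' → μ ∘ Equiv.swap i i' ≠ μ := fun i i' hi e => by
    have := congrFun e i
    simp only [Function.comp_apply, Equiv.swap_apply_left] at this
    exact hi this.symm
  have hswap : ∀ i i' : Fin N, i < i' → μ i' < μ i → ∀ (c : ℂ) ν,
      cf ν (c • mono (μ ∘ Equiv.swap i i')) ≠ 0 → Low ν μ ∧ ν ≠ μ := fun i i' hi hlt c ν hν => by
    rw [map_smul, cf_mono] at hν
    have e : ν = μ ∘ Equiv.swap i i' := by by_contra e; simp [e] at hν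
    rw [e]
    exact ⟨low_comp_swap hi hlt.le, hne i i' hlt.ne'⟩
  have hadd : ∀ (g g' : MvPolynomial (Fin N) ℂ), (∀ ν, cf ν g ≠ 0 → Low ν μ ∧ ν ≠ μ) →
      (∀ ν, cf ν g' ≠ 0 → Low ν μ ∧ ν ≠ μ) → ∀ ν, cf ν (g + g') ≠ 0 → Low ν μ ∧ ν ≠ μ := by
    intro g g' hg hg' ν hν
    by_cases e : cf ν g = 0
    · rw [map_add, e, zero_add] at hν
      exact hg' ν hν
    · exact hg ν e
  rw [key]
  rcases lt_trichotomy (μ k) (μ j) with hlt | heq | hlt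
  · obtain ⟨m, hm⟩ := Nat.exists_eq_add_of_lt hlt
    refine ⟨betweenSum μ j k (μ k) m + if j < k then mono (μ ∘ Equiv.swap j k) else 0, ?_, ?_⟩
    · have hF : Follows μ k j := Or.inl hlt
      rw [X_mul_divOp_mono_of_gt h hm rfl, if_pos hF, one_smul]
      ring
    · refine hadd _ _ (fun ν => low_of_cf_betweenSum h (Or.inl ⟨hm, rfl⟩)) ?_
      split_ifs with hjk
      · have := hswap j k hjk hlt 1
        rwa [one_smul] at this
      · simp
  · refine ⟨0, ?_, by simp⟩
    have hc : μ ∘ Equiv.swap j k = μ := by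
      rw [← setParts_swap rfl rfl, heq, setParts_self rfl heq]
    have hF : Follows μ k j ↔ j < k := by
      unfold Follows
      omega
    rw [divOp_mono_of_eq h heq.symm, hc]
    simp only [hF]
    split_ifs <;> simp
  · obtain ⟨m, hm⟩ := Nat.exists_eq_add_of_lt hlt
    have hF : ¬ Follows μ k j := Follows.asymm (Or.inl hlt)
    have hb : ∀ ν, cf ν (-betweenSum μ j k (μ j) m) ≠ 0 → Low ν μ ∧ ν ≠ μ := fun ν hν =>
      low_of_cf_betweenSum h (Or.inr ⟨rfl, hm⟩) (by simpa using hν)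
    rw [X_mul_divOp_mono_of_lt h rfl hm, if_neg hF]
    rcases lt_or_gt_of_ne h with hjk | hjk
    · refine ⟨-betweenSum μ j k (μ j) m + (-1 : ℂ) • mono (μ ∘ Equiv.swap j k), ?_,
        hadd _ _ hb ?_⟩
      · rw [if_neg hjk.le.not_gt, neg_one_smul ℂ (mono (μ ∘ Equiv.swap j k))]
        simp [sub_eq_add_neg]
      · rw [Equiv.swap_comm]
        exact hswap k j hjk hlt (-1)
    · refine ⟨-betweenSum μ j k (μ j) m, ?_, hb⟩
      rw [if_pos hjk]
      simp

theorem suppIn_pairOp {j k : Fin N} (h : k ≠ j) : SuppIn Low (pairOp j k) := fun μ ν hne => by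
  obtain ⟨g, hg, hlow⟩ := pairOp_mono h μ
  by_cases e : ν = μ
  · rw [e]; exact Low.refl μ
  · rw [hg, map_add, map_smul, cf_mono, if_neg e, smul_zero, zero_add] at hne
    exact (hlow ν hne).1

open Classical in
theorem diag_pairOp {j k : Fin N} (h : k ≠ j) (μ : Fin N → ℕ) :
    diag μ (pairOp j k) = if Follows μ k j then 1 else 0 := by
  obtain ⟨g, hg, hlow⟩ := pairOp_mono h μ
  have : cf μ g = 0 := by
    by_contra e
    exact (hlow μ e).2 rfl
  rw [diag_apply, hg, map_add, map_smul, cf_mono, this]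
  simp

/-! ## The algebra of Dunkl operators -/

/-- Elements `D_i`, `X_i` of a ring with the relations of Dunkl operators and coordinates; the
elements `S_{ij}`, `S'_{ij}` and `c_i` are the multiples of (combinations of) reflections that
occur in the commutators, and the elements `P_w` permute the indices. -/
structure DunklSystem (N : ℕ) (R : Type*) [Ring R] where
  D : Fin N → R
  X : Fin N → R
  c : Fin N → R
  S : Fin N → Fin N → R
  S' : Fin N → Fin N → R
  P : Equiv.Perm (Fin N) → R
  S_symm : ∀ i j, S i j = S j i
  S'_symm : ∀ i j, S' i j = S' j i
  D_mul_X : ∀ i j, i ≠ j → D i * X j = X j * D i - S' i j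
  D_mul_X_self : ∀ i, D i * X i = X i * D i + 1 + ∑ k ∈ Finset.univ.erase i, S i k + (c i + c i)
  S_mul_D : ∀ i j, i ≠ j → S i j * D i = D j * S' i j
  S'_mul_D : ∀ i j, i ≠ j → S' i j * D i = D j * S i j
  S_mul_D_of_ne : ∀ i j k, i ≠ j → k ≠ i → k ≠ j → S i j * D k = D k * S i j
  S'_mul_D_of_ne : ∀ i j k, i ≠ j → k ≠ i → k ≠ j → S' i j * D k = D k * S' i j
  S_mul_X : ∀ i j, i ≠ j → S i j * X i = X j * S' i j
  S_mul_X_of_ne : ∀ i j k, i ≠ j → k ≠ i → k ≠ j → S i j * X k = X k * S i j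
  c_mul_D : ∀ i, c i * D i = -(D i * c i)
  c_mul_D_of_ne : ∀ i j, i ≠ j → c i * D j = D j * c i
  c_mul_X : ∀ i, c i * X i = -(X i * c i)
  c_mul_X_of_ne : ∀ i j, i ≠ j → c i * X j = X j * c i
  c_comm : ∀ i j, c i * c j = c j * c i
  S_mul_c : ∀ i j, i ≠ j → S i j * c i = c j * S i j
  S_mul_c_of_ne : ∀ i j k, i ≠ j → k ≠ i → k ≠ j → S i j * c k = c k * S i j
  c_mul_S : ∀ i j, i ≠ j → c i * S i j = c j * S i j
  S_mul_S : ∀ i j l, i ≠ j → i ≠ l → j ≠ l → S j l * S i j = S i l * S j l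
  S_mul_S_of_ne : ∀ i j k l, i ≠ k → j ≠ l → i ≠ j → i ≠ l → k ≠ j → k ≠ l →
    S j l * S i k = S i k * S j l
  P_mul_D : ∀ w i, P w * D i = D (w i) * P w
  P_mul_X : ∀ w i, P w * X i = X (w i) * P w
  P_mul_c : ∀ w i, P w * c i = c (w i) * P w
  P_mul_S : ∀ w i j, P w * S i j = S (w i) (w j) * P w

namespace DunklSystem

variable {R : Type*} [Ring R] (T : DunklSystem N R)

/-- By the Jacobi identity the commutator of [D_i, D_j] with X_j is [D_i, [D_j, X_j]] - [D_j, [D_i,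
X_j]]. In the first term only S_{ij} fails to commute with D_i, and the relations S_{ij}D_i =
D_jS'_{ij} and S'_{ij}D_j = D_iS_{ij} make everything cancel. -/
theorem commutator_mul_X_right {i j : Fin N} (h : i ≠ j) :
    (T.D i * T.D j - T.D j * T.D i) * T.X j = T.X j * (T.D i * T.D j - T.D j * T.D i) := by
  have h1 := T.D_mul_X_self j
  have h2 := T.D_mul_X i j h
  have hsum : T.D i * ∑ k ∈ Finset.univ.erase j, T.S j k
      - (∑ k ∈ Finset.univ.erase j, T.S j k) * T.D i = T.D i * T.S i j - T.S i j * T.D i := by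
    rw [Finset.mul_sum, Finset.sum_mul, ← Finset.sum_sub_distrib,
      Finset.sum_eq_single_of_mem i (Finset.mem_erase.2 ⟨h, Finset.mem_univ i⟩), T.S_symm j i]
    intro k hk hki
    rw [T.S_mul_D_of_ne j k i (Finset.ne_of_mem_erase hk).symm h hki.symm, sub_self]
  have h3 := T.S'_mul_D j i h.symm
  rw [T.S'_symm, T.S_symm] at h3
  have h4 := T.S_mul_D i j h
  have h5 := T.c_mul_D_of_ne j i h.symm
  generalize (∑ k ∈ Finset.univ.erase j, T.S j k) = Z at *
  linear_combination (norm := noncomm_ring) T.D i * h1 + h2 * T.D j - T.D j * h2 - h1 * T.D i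
    + hsum - h3 - h4 - 2 * h5

theorem commutator_mul_X (i j k : Fin N) :
    (T.D i * T.D j - T.D j * T.D i) * T.X k = T.X k * (T.D i * T.D j - T.D j * T.D i) := by
  by_cases hij : i = j
  · subst hij; simp
  by_cases hjk : j = k
  · subst hjk; exact T.commutator_mul_X_right hij
  by_cases hik : i = k
  · subst hik
    have := T.commutator_mul_X_right (Ne.symm hij)
    linear_combination (norm := noncomm_ring) -this
  have h1 := T.D_mul_X i k hik
  have h2 := T.D_mul_X j k hjk
  have h3 := T.S'_mul_D_of_ne i k j hik (Ne.symm hij) hjk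
  have h4 := T.S'_mul_D_of_ne j k i hjk hij hik
  linear_combination (norm := noncomm_ring) T.D i * h2 + h1 * T.D j - T.D j * h1 - h2 * T.D i
    - h3 + h4

/-- The operators `X_i D_i + c_i`. -/
def u (i : Fin N) : R := T.X i * T.D i + T.c i

/-- The Cherednik operators `X_i D_i + c_i + ∑_{k > i} S_{ik}`. -/
def d (i : Fin N) : R := T.u i + ∑ k ∈ Finset.univ.filter (fun k => i < k), T.S i k

theorem S_mul_u {i j : Fin N} (h : i ≠ j) : T.S i j * T.u i = T.u j * T.S i j := by
  have h1 := T.S_mul_X i j h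
  have h2 := T.S'_mul_D i j h
  have h3 := T.S_mul_c i j h
  unfold u
  linear_combination (norm := noncomm_ring) h1 * T.D i + T.X j * h2 + h3

theorem S_mul_u_of_ne {i j k : Fin N} (h : i ≠ j) (hi : k ≠ i) (hj : k ≠ j) :
    T.S i j * T.u k = T.u k * T.S i j := by
  have h1 := T.S_mul_X_of_ne i j k h hi hj
  have h2 := T.S_mul_D_of_ne i j k h hi hj
  have h3 := T.S_mul_c_of_ne i j k h hi hj
  unfold u
  linear_combination (norm := noncomm_ring) h1 * T.D k + T.X k * h2 + h3

theorem P_mul_u (w : Equiv.Perm (Fin N)) (i : Fin N) : T.P w * T.u i = T.u (w i) * T.P w := by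
  have h1 := T.P_mul_X w i
  have h2 := T.P_mul_D w i
  have h3 := T.P_mul_c w i
  unfold u
  linear_combination (norm := noncomm_ring) h1 * T.D i + T.X (w i) * h2 + h3

theorem c_mul_u (i j : Fin N) : T.c i * T.u j = T.u j * T.c i := by
  have h3 := T.c_comm i j
  unfold u
  by_cases h : i = j
  · subst h
    have h1 := T.c_mul_X i
    have h2 := T.c_mul_D i
    linear_combination (norm := noncomm_ring) h1 * T.D i - T.X i * h2
  · have h1 := T.c_mul_X_of_ne i j h
    have h2 := T.c_mul_D_of_ne i j h
    linear_combination (norm := noncomm_ring) h1 * T.D j + T.X j * h2 + h3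

/-- The parts without reflections cancel because the X and the D commute. Moving D past X leaves
(X_j D_j - X_i D_i)S_{ij}, and c_i S_{ij} = c_j S_{ij} turns this into (u_j - u_i)S_{ij}. -/
theorem u_commutator (hX : ∀ i j, T.X i * T.X j = T.X j * T.X i)
    (hD : ∀ i j, T.D i * T.D j = T.D j * T.D i) {i j : Fin N} (h : i ≠ j) :
    T.u i * T.u j - T.u j * T.u i = T.u j * T.S i j - T.u i * T.S i j := by
  have h1 := T.D_mul_X i j h
  have h2 := T.D_mul_X j i h.symm
  have h3 := T.S'_mul_D i j h
  have h4 := T.S'_mul_D j i h.symm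
  have hs := T.S_symm i j
  have hs' := T.S'_symm i j
  have hc := T.c_mul_S i j h
  have hci := T.c_mul_u i j
  have hcj := T.c_mul_u j i
  have hcc := T.c_comm i j
  rw [← hs, ← hs'] at h4
  rw [← hs'] at h2
  unfold u at hci hcj ⊢
  linear_combination (norm := noncomm_ring) T.X i * h1 * T.D j - T.X j * h2 * T.D i
    + hX i j * T.D i * T.D j + T.X j * T.X i * hD i j + hci - hcj + hc - hcc
    - T.X i * h4 + T.X j * h3

/-- Moving S_{jl} through the sum exchanges S_{ij} with S_{il} and leaves the other terms alone;
both j and l lie in the range of summation. -/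
theorem sum_S_mul_S {i j l : Fin N} (hij : i < j) (hjl : j < l) :
    (∑ k ∈ Finset.univ.filter (fun k => i < k), T.S i k) * T.S j l
      = T.S j l * ∑ k ∈ Finset.univ.filter (fun k => i < k), T.S i k := by
  have hil := hij.trans hjl
  rw [Finset.sum_mul, Finset.mul_sum]
  refine Finset.sum_bij (fun k _ => Equiv.swap j l k) ?_ ?_ ?_ ?_
  · intro k hk
    simp only [Finset.mem_filter, Finset.mem_univ, true_and, Equiv.swap_apply_def] at hk ⊢
    split_ifs <;> assumption
  · intro k _ k' _ e
    exact (Equiv.swap j l).injective e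
  · intro k hk
    refine ⟨Equiv.swap j l k, ?_, by simp⟩
    simp only [Finset.mem_filter, Finset.mem_univ, true_and, Equiv.swap_apply_def] at hk ⊢
    split_ifs <;> assumption
  · intro k hk
    simp only [Finset.mem_filter, Finset.mem_univ, true_and] at hk
    by_cases hkj : k = j
    · subst hkj
      rw [Equiv.swap_apply_left, T.S_symm k l, T.S_mul_S i l k hil.ne hij.ne hjl.ne']
    by_cases hkl : k = l
    · subst hkl
      rw [Equiv.swap_apply_right, T.S_mul_S i j k hij.ne hil.ne hjl.ne]
    · rw [Equiv.swap_apply_of_ne_of_ne hkj hkl,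
        T.S_mul_S_of_ne i j k l hk.ne hjl.ne hij.ne hil.ne hkj hkl]

/-- For i < j the commutator of u_i with u_j is cancelled by the commutator of S_{ij}, a term of d_i
only, with u_j. All other cross terms commute. -/
theorem d_comm (hX : ∀ i j, T.X i * T.X j = T.X j * T.X i)
    (hD : ∀ i j, T.D i * T.D j = T.D j * T.D i) (i j : Fin N) :
    T.d i * T.d j = T.d j * T.d i := by
  wlog hij : i < j generalizing i j
  · rcases (not_lt.1 hij).eq_or_lt with rfl | h
    · rfl
    · exact (this j i h).symm
  have h1 : T.u i * ∑ k ∈ Finset.univ.filter (fun k => j < k), T.S j k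
      = (∑ k ∈ Finset.univ.filter (fun k => j < k), T.S j k) * T.u i := by
    rw [Finset.sum_mul, Finset.mul_sum]
    refine Finset.sum_congr rfl fun k hk => ?_
    simp only [Finset.mem_filter, Finset.mem_univ, true_and] at hk
    exact (T.S_mul_u_of_ne hk.ne hij.ne (hij.trans hk).ne).symm
  have h2 : (∑ k ∈ Finset.univ.filter (fun k => i < k), T.S i k) * T.u j
      - T.u j * ∑ k ∈ Finset.univ.filter (fun k => i < k), T.S i k
      = T.u i * T.S i j - T.u j * T.S i j := by
    rw [Finset.sum_mul, Finset.mul_sum, ← Finset.sum_sub_distrib,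
      Finset.sum_eq_single_of_mem j (by simpa using hij)]
    · have := T.S_mul_u hij.ne'
      rw [← T.S_symm i j] at this
      rw [this]
    · intro k hk hkj
      simp only [Finset.mem_filter, Finset.mem_univ, true_and] at hk
      rw [T.S_mul_u_of_ne hk.ne hij.ne' hkj.symm, sub_self]
  have h3 : (∑ k ∈ Finset.univ.filter (fun k => i < k), T.S i k)
        * ∑ k ∈ Finset.univ.filter (fun k => j < k), T.S j k
      = (∑ k ∈ Finset.univ.filter (fun k => j < k), T.S j k)
        * ∑ k ∈ Finset.univ.filter (fun k => i < k), T.S i k := by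
    rw [Finset.mul_sum, Finset.sum_mul]
    refine Finset.sum_congr rfl fun l hl => ?_
    simp only [Finset.mem_filter, Finset.mem_univ, true_and] at hl
    exact T.sum_S_mul_S hij hl
  have h4 := T.u_commutator hX hD hij.ne
  unfold d
  linear_combination (norm := noncomm_ring) h1 + h2 + h3 + h4

/-- The relation between the Cherednik operators and an adjacent transposition. -/
theorem P_swap_mul_d {i i' : Fin N} (hi : (i : ℕ) + 1 = i') :
    T.P (Equiv.swap i i') * T.d i' = (T.d i - T.S i i') * T.P (Equiv.swap i i') := by
  have hset : Finset.univ.filter (fun k => i < k)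
      = insert i' (Finset.univ.filter (fun k => i' < k)) := by
    ext k
    simp only [Finset.mem_filter, Finset.mem_univ, true_and, Finset.mem_insert, Fin.lt_def,
      Fin.ext_iff]
    omega
  rw [d, d, hset, Finset.sum_insert (by simp), mul_add, T.P_mul_u, Equiv.swap_apply_right,
    add_sub_assoc, add_sub_cancel_left, add_mul, Finset.mul_sum, Finset.sum_mul]
  congr 1
  refine Finset.sum_congr rfl fun k hk => ?_
  simp only [Finset.mem_filter, Finset.mem_univ, true_and, Fin.lt_def] at hk
  rw [T.P_mul_S, Equiv.swap_apply_right, Equiv.swap_apply_of_ne_of_ne] <;>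
    (rw [ne_eq, Fin.ext_iff]; omega)

theorem P_swap_mul_d_of_ne {i i' j : Fin N} (hi : (i : ℕ) + 1 = i') (hj : j ≠ i) (hj' : j ≠ i') :
    T.P (Equiv.swap i i') * T.d j = T.d j * T.P (Equiv.swap i i') := by
  have hji : (j : ℕ) ≠ i := fun e => hj (Fin.ext e)
  have hji' : (j : ℕ) ≠ i' := fun e => hj' (Fin.ext e)
  rw [d, mul_add, add_mul, T.P_mul_u, Equiv.swap_apply_of_ne_of_ne hj hj', Finset.mul_sum,
    Finset.sum_mul]
  congr 1
  have hmem : ∀ k : Fin N, j < k → j < Equiv.swap i i' k := fun k hk => by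
    simp only [Equiv.swap_apply_def, Fin.lt_def, Fin.ext_iff] at hk ⊢
    split_ifs <;> omega
  refine Finset.sum_bij (fun k _ => Equiv.swap i i' k) ?_ ?_ ?_ ?_
  · intro k hk
    simp only [Finset.mem_filter, Finset.mem_univ, true_and] at hk ⊢
    exact hmem k hk
  · intro k _ k' _ e
    exact (Equiv.swap i i').injective e
  · intro k hk
    simp only [Finset.mem_filter, Finset.mem_univ, true_and] at hk
    exact ⟨Equiv.swap i i' k, by simpa using hmem k hk, by simp⟩
  · intro k _
    rw [T.P_mul_S, Equiv.swap_apply_of_ne_of_ne hj hj']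

end DunklSystem

/-! ## Relations between permutations, reflections, multiplications and divided differences -/

theorem op_neg_mul (A B : Op N) : -A * B = -(A * B) := neg_mul A B

theorem op_mul_neg (A B : Op N) : A * -B = -(A * B) := mul_neg A B

theorem op_sub_mul (A B C : Op N) : (A - B) * C = A * C - B * C := sub_mul A B C

theorem op_mul_sub (A B C : Op N) : A * (B - C) = A * B - A * C := mul_sub A B C

/-- The exchange `K_{ij}`. -/
abbrev exchOp (i j : Fin N) : Op N := permOp (Equiv.swap i j)

theorem exchOp_comm (i j : Fin N) : exchOp i j = exchOp j i := by
  unfold exchOp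
  rw [Equiv.swap_comm]

theorem exchOp_mul_self (i j : Fin N) : exchOp i j * exchOp i j = 1 := by
  rw [permOp_mul, Equiv.swap_mul_self, permOp_one]

theorem permOp_mul_exchOp (w : Equiv.Perm (Fin N)) (i j : Fin N) :
    permOp w * exchOp i j = exchOp (w i) (w j) * permOp w := by
  rw [permOp_mul, permOp_mul, Equiv.mul_swap_eq_swap_mul]

theorem permOp_mul_mulX (w : Equiv.Perm (Fin N)) (i : Fin N) :
    permOp w * mulX i = mulX (w i) * permOp w := by
  refine LinearMap.ext fun f => ?_
  rw [Module.End.mul_apply, Module.End.mul_apply, mulX_apply, mulX_apply, permOp_mul_apply,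
    permOp_X]

theorem permOp_mul_deriv (w : Equiv.Perm (Fin N)) (i : Fin N) :
    permOp w * deriv i = deriv (w i) * permOp w := by
  refine LinearMap.ext fun f => ?_
  simp only [Module.End.mul_apply, permOp_apply, deriv]
  exact (MvPolynomial.pderiv_rename w.injective i f).symm

theorem permOp_mul_divOp (w : Equiv.Perm (Fin N)) (i j : Fin N) :
    permOp w * divOp i j = divOp (w i) (w j) * permOp w := by
  by_cases h : j = i
  · subst h; rw [divOp_self, divOp_self, mul_zero, zero_mul]
  refine LinearMap.ext fun f => (divOp_eq_of_mul (fun e => h (w.injective e)) ?_).symm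
  rw [Module.End.mul_apply, ← permOp_X w i, ← permOp_X w j, ← map_sub, ← permOp_mul_apply,
    mul_divOp, map_sub]
  exact congrArg _ (LinearMap.congr_fun (permOp_mul_exchOp w i j) f)

theorem reflOp_X_self (i : Fin N) : reflOp i (MvPolynomial.X i) = -MvPolynomial.X i := by
  rw [reflOp_apply, reflect_X, if_pos rfl, neg_one_smul ℂ (MvPolynomial.X i)]

theorem reflOp_X_of_ne {i j : Fin N} (h : j ≠ i) :
    reflOp i (MvPolynomial.X j) = MvPolynomial.X j := by
  rw [reflOp_apply, reflect_X, if_neg h, one_smul]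

theorem reflOp_mul_mulX (i : Fin N) : reflOp i * mulX i = -(mulX i * reflOp i) := by
  refine LinearMap.ext fun f => ?_
  rw [LinearMap.neg_apply, Module.End.mul_apply, Module.End.mul_apply, mulX_apply, mulX_apply,
    reflOp_mul_apply, reflOp_X_self, neg_mul]

theorem reflOp_mul_mulX_of_ne {i j : Fin N} (h : j ≠ i) : reflOp i * mulX j = mulX j * reflOp i := by
  refine LinearMap.ext fun f => ?_
  rw [Module.End.mul_apply, Module.End.mul_apply, mulX_apply, mulX_apply,
    reflOp_mul_apply, reflOp_X_of_ne h]

theorem deriv_mul_mulX (i : Fin N) : deriv i * mulX i = mulX i * deriv i + 1 := by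
  refine LinearMap.ext fun f => ?_
  simp only [Module.End.mul_apply, mulX_apply, LinearMap.add_apply, Module.End.one_apply, deriv,
    Derivation.coeFn_coe, Derivation.leibniz, MvPolynomial.pderiv_X_self, smul_eq_mul, mul_one]

theorem deriv_mul_mulX_of_ne {i j : Fin N} (h : j ≠ i) : deriv i * mulX j = mulX j * deriv i := by
  refine LinearMap.ext fun f => ?_
  simp only [Module.End.mul_apply, mulX_apply, deriv,
    Derivation.coeFn_coe, Derivation.leibniz, MvPolynomial.pderiv_X_of_ne h, smul_eq_mul, mul_zero,
    add_zero]

theorem mulX_mul_deriv_mono (i : Fin N) (μ : Fin N → ℕ) :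
    (mulX i * deriv i) (mono μ) = (μ i : ℂ) • mono μ := by
  rw [Module.End.mul_apply, mulX_apply, deriv, Derivation.coeFn_coe, mono,
    MvPolynomial.X_mul_pderiv_monomial, Nat.cast_smul_eq_nsmul]
  rfl

/-- Polynomials form a domain, so operator identities with the denominator x_i may be checked after
multiplication by x_i. -/
theorem mulX_injective (i : Fin N) {A B : Op N} (h : mulX i * A = mulX i * B) : A = B :=
  LinearMap.ext fun f => mul_left_cancel₀ (MvPolynomial.X_ne_zero i) (LinearMap.congr_fun h f)

theorem mulX_mul_deriv_comm_reflOp (i j : Fin N) :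
    reflOp i * (mulX j * deriv j) = mulX j * deriv j * reflOp i := by
  refine op_ext fun μ => ?_
  rw [Module.End.mul_apply, mulX_mul_deriv_mono, Module.End.mul_apply, reflOp_mono, map_smul,
    map_smul, reflOp_mono, mulX_mul_deriv_mono, smul_comm]

theorem reflOp_mul_deriv (i : Fin N) : reflOp i * deriv i = -(deriv i * reflOp i) := by
  apply mulX_injective i
  have h := mulX_mul_deriv_comm_reflOp i i
  have h' := reflOp_mul_mulX i
  linear_combination (norm := (simp only [mul_add, add_mul, mul_sub,
    sub_mul, op_neg_mul, op_mul_neg, op_mul_sub, op_sub_mul, mul_assoc, mul_one, one_mul]; abel))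
    h' * deriv i - h

theorem reflOp_mul_deriv_of_ne {i j : Fin N} (h : j ≠ i) :
    reflOp i * deriv j = deriv j * reflOp i := by
  apply mulX_injective j
  have h1 := mulX_mul_deriv_comm_reflOp i j
  have h2 := reflOp_mul_mulX_of_ne h
  linear_combination (norm := (simp only [mul_add, add_mul, mul_sub,
    sub_mul, op_neg_mul, op_mul_neg, op_mul_sub, op_sub_mul, mul_assoc, mul_one, one_mul]; abel))
    -h2 * deriv j + h1

theorem divOp_mul_mulX_left {i j : Fin N} (h : j ≠ i) :
    divOp i j * mulX i = mulX i * divOp i j + exchOp i j := by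
  refine LinearMap.ext fun f => divOp_eq_of_mul h ?_
  have h1 := mul_divOp i j f
  simp only [LinearMap.add_apply, Module.End.mul_apply, mulX_apply, permOp_mul_apply, permOp_X,
    Equiv.swap_apply_left] at h1 ⊢
  linear_combination MvPolynomial.X i * h1

theorem divOp_mul_mulX_right {i j : Fin N} (h : j ≠ i) :
    divOp i j * mulX j = mulX j * divOp i j - exchOp i j := by
  refine LinearMap.ext fun f => divOp_eq_of_mul h ?_
  have h1 := mul_divOp i j f
  simp only [LinearMap.sub_apply, Module.End.mul_apply, mulX_apply, permOp_mul_apply, permOp_X,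
    Equiv.swap_apply_right] at h1 ⊢
  linear_combination MvPolynomial.X j * h1

theorem divOp_mul_mulX_of_ne {i j k : Fin N} (hi : k ≠ i) (hj : k ≠ j) :
    divOp i j * mulX k = mulX k * divOp i j := by
  by_cases h : j = i
  · subst h; rw [divOp_self, mul_zero, zero_mul]
  refine LinearMap.ext fun f => divOp_eq_of_mul h ?_
  have h1 := mul_divOp i j f
  simp only [Module.End.mul_apply, mulX_apply, permOp_mul_apply, permOp_X,
    Equiv.swap_apply_of_ne_of_ne hi hj] at h1 ⊢
  linear_combination MvPolynomial.X k * h1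

theorem exchOp_mul_reflOp_left (i j : Fin N) : exchOp i j * reflOp i = reflOp j * exchOp i j := by
  rw [permOp_mul_reflOp, Equiv.swap_apply_left]

theorem exchOp_mul_reflOp_right (i j : Fin N) : exchOp i j * reflOp j = reflOp i * exchOp i j := by
  rw [permOp_mul_reflOp, Equiv.swap_apply_right]

theorem exchOp_mul_reflOp_of_ne {i j k : Fin N} (hi : k ≠ i) (hj : k ≠ j) :
    exchOp i j * reflOp k = reflOp k * exchOp i j := by
  rw [permOp_mul_reflOp, Equiv.swap_apply_of_ne_of_ne hi hj]

theorem reflOp_mul_divOp_of_ne {i j k : Fin N} (hi : k ≠ i) (hj : k ≠ j) :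
    reflOp k * divOp i j = divOp i j * reflOp k := by
  by_cases h : j = i
  · subst h; rw [divOp_self, mul_zero, zero_mul]
  refine LinearMap.ext fun f => (divOp_eq_of_mul h ?_).symm
  have h1 : reflOp k (MvPolynomial.X i - MvPolynomial.X j) = MvPolynomial.X i - MvPolynomial.X j := by
    rw [map_sub, reflOp_X_of_ne hi.symm, reflOp_X_of_ne hj.symm]
  rw [Module.End.mul_apply, ← h1, ← reflOp_mul_apply, mul_divOp, map_sub]
  exact congrArg _ (LinearMap.congr_fun (exchOp_mul_reflOp_of_ne hi hj) f).symm

/-- The product t_i t_j negates x_i - x_j and commutes with K_{ij}. -/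
theorem reflOp_mul_reflOp_mul_divOp (i j : Fin N) :
    reflOp i * reflOp j * divOp i j = -(divOp i j * (reflOp i * reflOp j)) := by
  by_cases h : j = i
  · subst h; rw [divOp_self, mul_zero, zero_mul, neg_zero]
  refine LinearMap.ext fun f => ?_
  rw [LinearMap.neg_apply, ← neg_eq_iff_eq_neg]
  refine (divOp_eq_of_mul h ?_).symm
  have h1 : (reflOp i * reflOp j) (MvPolynomial.X i - MvPolynomial.X j)
      = -(MvPolynomial.X i - MvPolynomial.X j) := by
    rw [map_sub, Module.End.mul_apply, Module.End.mul_apply, reflOp_X_self, map_neg,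
      reflOp_X_of_ne (Ne.symm h), reflOp_X_self, reflOp_X_of_ne h]
    ring
  have h2 : ∀ f g, (reflOp i * reflOp j) (f * g)
      = (reflOp i * reflOp j) f * (reflOp i * reflOp j) g := fun f g => by
    simp only [Module.End.mul_apply, reflOp_mul_apply]
  have h3 : exchOp i j * (reflOp i * reflOp j) = reflOp i * reflOp j * exchOp i j := by
    rw [← mul_assoc, exchOp_mul_reflOp_left, mul_assoc, exchOp_mul_reflOp_right, ← mul_assoc,
      reflOp_comm]
  have h4 := congrArg (reflOp i * reflOp j) (mul_divOp i j f)
  rw [h2, h1, map_sub] at h4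
  rw [Module.End.mul_apply (reflOp i * reflOp j) (divOp i j) f, mul_neg, ← neg_mul, h4]
  exact congrArg _ (LinearMap.congr_fun h3 f).symm

/-- The divided difference `(x_i + x_j)⁻¹ (1 - t_i t_j K_{ij})`. -/
def divOp' (i j : Fin N) : Op N := reflOp j * divOp i j * reflOp j

theorem divOp'_self (i : Fin N) : divOp' i i = 0 := by simp [divOp', divOp_self]

theorem permOp_mul_divOp' (w : Equiv.Perm (Fin N)) (i j : Fin N) :
    permOp w * divOp' i j = divOp' (w i) (w j) * permOp w := by
  unfold divOp'
  rw [mul_assoc (reflOp j), ← mul_assoc, permOp_mul_reflOp, mul_assoc, ← mul_assoc (permOp w),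
    permOp_mul_divOp, mul_assoc (divOp _ _), permOp_mul_reflOp]
  simp only [mul_assoc]

theorem reflOp_mul_divOp'_of_ne {i j k : Fin N} (hi : k ≠ i) (hj : k ≠ j) :
    reflOp k * divOp' i j = divOp' i j * reflOp k := by
  have h1 := reflOp_mul_divOp_of_ne hi hj
  have h2 := reflOp_comm k j
  unfold divOp'
  linear_combination (norm := (simp only [mul_add, add_mul, mul_sub,
    sub_mul, op_neg_mul, op_mul_neg, op_mul_sub, op_sub_mul, mul_assoc, mul_one, one_mul]; abel))
    h2 * divOp i j * reflOp j
    + reflOp j * h1 * reflOp j + reflOp j * divOp i j * h2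

theorem reflOp_right_mul_divOp (i j : Fin N) : reflOp j * divOp i j = divOp' i j * reflOp j := by
  rw [divOp', mul_assoc, reflOp_mul_self, mul_one]

theorem reflOp_right_mul_divOp' (i j : Fin N) : reflOp j * divOp' i j = divOp i j * reflOp j := by
  rw [divOp', ← mul_assoc, ← mul_assoc, reflOp_mul_self, one_mul]

theorem reflOp_left_mul_divOp (i j : Fin N) : reflOp i * divOp i j = -(divOp' i j * reflOp i) := by
  have h1 := reflOp_mul_reflOp_mul_divOp i j
  have h2 := reflOp_mul_self j
  have h3 := reflOp_comm i j
  unfold divOp'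
  linear_combination (norm := (simp only [mul_add, add_mul, mul_sub,
    sub_mul, op_neg_mul, op_mul_neg, op_mul_sub, op_sub_mul, mul_assoc, mul_one, one_mul]; abel))
    reflOp j * h1 - h2 * reflOp i * divOp i j
    - reflOp j * h3 * divOp i j - reflOp j * divOp i j * h3

theorem reflOp_left_mul_divOp' (i j : Fin N) : reflOp i * divOp' i j = -(divOp i j * reflOp i) := by
  have h1 := reflOp_mul_reflOp_mul_divOp i j
  have h2 := reflOp_mul_self j
  unfold divOp'
  linear_combination (norm := (simp only [mul_add, add_mul, mul_sub,
    sub_mul, op_neg_mul, op_mul_neg, op_mul_sub, op_sub_mul, mul_assoc, mul_one, one_mul]; abel))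
    h1 * reflOp j - divOp i j * reflOp i * h2

theorem divOp'_mul_mulX_left {i j : Fin N} (h : j ≠ i) :
    divOp' i j * mulX i = mulX i * divOp' i j + reflOp i * reflOp j * exchOp i j := by
  have h1 := divOp_mul_mulX_left h
  have h2 := reflOp_mul_mulX_of_ne h.symm
  have h3 := exchOp_mul_reflOp_right i j
  have h4 := reflOp_comm i j
  unfold divOp'
  linear_combination (norm := (simp only [mul_add, add_mul, mul_sub,
    sub_mul, op_neg_mul, op_mul_neg, op_mul_sub, op_sub_mul, mul_assoc, mul_one, one_mul]; abel))
    reflOp j * h1 * reflOp j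
    + reflOp j * divOp i j * h2 + h2 * divOp i j * reflOp j + reflOp j * h3 - h4 * exchOp i j

theorem divOp'_mul_mulX_right {i j : Fin N} (h : j ≠ i) :
    divOp' i j * mulX j = mulX j * divOp' i j + reflOp i * reflOp j * exchOp i j := by
  have h1 := divOp_mul_mulX_right h
  have h2 := reflOp_mul_mulX j
  have h3 := exchOp_mul_reflOp_right i j
  have h4 := reflOp_comm i j
  unfold divOp'
  linear_combination (norm := (simp only [mul_add, add_mul, mul_sub,
    sub_mul, op_neg_mul, op_mul_neg, op_mul_sub, op_sub_mul, mul_assoc, mul_one, one_mul]; abel))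
    -reflOp j * h1 * reflOp j
    + reflOp j * divOp i j * h2 - h2 * divOp i j * reflOp j + reflOp j * h3 - h4 * exchOp i j

theorem divOp'_mul_mulX_of_ne {i j k : Fin N} (hi : k ≠ i) (hj : k ≠ j) :
    divOp' i j * mulX k = mulX k * divOp' i j := by
  have h1 := divOp_mul_mulX_of_ne hi hj
  have h2 := reflOp_mul_mulX_of_ne hj
  unfold divOp'
  linear_combination (norm := (simp only [mul_add, add_mul, mul_sub,
    sub_mul, op_neg_mul, op_mul_neg, op_mul_sub, op_sub_mul, mul_assoc, mul_one, one_mul]; abel))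
    reflOp j * h1 * reflOp j
    + reflOp j * divOp i j * h2 + h2 * divOp i j * reflOp j

/-- The divided difference `x_i⁻¹ (1 - t_i)`. -/
def reflDivOp (i : Fin N) : Op N :=
  divDiff (MvPolynomial.X i) (reflect i) (MvPolynomial.X_ne_zero i) (dvd_sub_reflect i)

theorem mulX_mul_reflDivOp (i : Fin N) : mulX i * reflDivOp i = 1 - reflOp i :=
  LinearMap.ext fun f => mul_divDiff _ _ _ _ f

theorem permOp_mul_reflDivOp (w : Equiv.Perm (Fin N)) (i : Fin N) :
    permOp w * reflDivOp i = reflDivOp (w i) * permOp w := by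
  apply mulX_injective (w i)
  have h1 := permOp_mul_mulX w i
  have h2 := mulX_mul_reflDivOp i
  have h3 := mulX_mul_reflDivOp (w i)
  have h4 := permOp_mul_reflOp w i
  linear_combination (norm := (simp only [mul_add, add_mul, mul_sub,
    sub_mul, op_neg_mul, op_mul_neg, op_mul_sub, op_sub_mul, mul_assoc, mul_one, one_mul]; abel))
    -h1 * reflDivOp i + permOp w * h2 - h3 * permOp w - h4

theorem reflOp_mul_reflDivOp (i : Fin N) : reflOp i * reflDivOp i = -(reflDivOp i * reflOp i) := by
  apply mulX_injective i
  have h1 := reflOp_mul_mulX i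
  have h2 := mulX_mul_reflDivOp i
  linear_combination (norm := (simp only [mul_add, add_mul, mul_sub,
    sub_mul, op_neg_mul, op_mul_neg, op_mul_sub, op_sub_mul, mul_assoc, mul_one, one_mul]; abel))
    h1 * reflDivOp i - reflOp i * h2 + h2 * reflOp i

theorem reflOp_mul_reflDivOp_of_ne {i j : Fin N} (h : j ≠ i) :
    reflOp i * reflDivOp j = reflDivOp j * reflOp i := by
  apply mulX_injective j
  have h1 := reflOp_mul_mulX_of_ne h
  have h2 := mulX_mul_reflDivOp j
  have h3 := reflOp_comm i j
  linear_combination (norm := (simp only [mul_add, add_mul, mul_sub,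
    sub_mul, op_neg_mul, op_mul_neg, op_mul_sub, op_sub_mul, mul_assoc, mul_one, one_mul]; abel))
    -h1 * reflDivOp j + reflOp i * h2 - h2 * reflOp i - h3

theorem mulX_comm (i j : Fin N) : (mulX i : Op N) * mulX j = mulX j * mulX i :=
  LinearMap.ext fun f => by
    simp only [Module.End.mul_apply, mulX_apply]
    ring

theorem reflDivOp_mul_mulX (i : Fin N) :
    reflDivOp i * mulX i = mulX i * reflDivOp i + (reflOp i + reflOp i) := by
  apply mulX_injective i
  have h1 := reflOp_mul_mulX i
  have h2 := mulX_mul_reflDivOp i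
  linear_combination (norm := (simp only [mul_add, add_mul, mul_sub,
    sub_mul, op_neg_mul, op_mul_neg, op_mul_sub, op_sub_mul, mul_assoc, mul_one, one_mul]; abel))
    h2 * mulX i - mulX i * h2 - h1

theorem reflDivOp_mul_mulX_of_ne {i j : Fin N} (h : j ≠ i) :
    reflDivOp i * mulX j = mulX j * reflDivOp i := by
  apply mulX_injective i
  have h1 := reflOp_mul_mulX_of_ne h
  have h2 := mulX_mul_reflDivOp i
  have h3 := mulX_comm i j
  linear_combination (norm := (simp only [mul_add, add_mul, mul_sub,
    sub_mul, op_neg_mul, op_mul_neg, op_mul_sub, op_sub_mul, mul_assoc, mul_one, one_mul]; abel))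
    h2 * mulX j - mulX j * h2 - h3 * reflDivOp i - h1

/-! ## The Dunkl operators of both types -/

/-- The Dunkl operators; type A is the case `e = b = 0`, type B the case `e = 1`. -/
def dunklOp (a e b : ℂ) (i : Fin N) : Op N :=
  deriv i + a • ∑ k, (divOp i k + e • divOp' i k) + b • reflDivOp i

/-- The combination `K_{ij} + e t_i t_j K_{ij}` of reflections. -/
def reflPair (e : ℂ) (i j : Fin N) : Op N :=
  exchOp i j + e • (reflOp i * reflOp j * exchOp i j)

theorem permOp_mul_reflPair (e : ℂ) (w : Equiv.Perm (Fin N)) (i j : Fin N) :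
    permOp w * reflPair e i j = reflPair e (w i) (w j) * permOp w := by
  unfold reflPair
  rw [mul_add, add_mul, permOp_mul_exchOp, mul_smul_comm, smul_mul_assoc, ← mul_assoc,
    ← mul_assoc, permOp_mul_reflOp, mul_assoc (reflOp (w i)), permOp_mul_reflOp, mul_assoc,
    mul_assoc, permOp_mul_exchOp]
  simp only [mul_assoc]

theorem reflPair_comm (e : ℂ) (i j : Fin N) : reflPair e i j = reflPair e j i := by
  rw [reflPair, reflPair, exchOp_comm, reflOp_comm]

theorem permOp_mul_dunklOp (a e b : ℂ) (w : Equiv.Perm (Fin N)) (i : Fin N) :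
    permOp w * dunklOp a e b i = dunklOp a e b (w i) * permOp w := by
  unfold dunklOp
  rw [mul_add, mul_add, add_mul, add_mul, permOp_mul_deriv, mul_smul_comm, smul_mul_assoc,
    mul_smul_comm, smul_mul_assoc, permOp_mul_reflDivOp, Finset.mul_sum, Finset.sum_mul]
  congr 3
  refine Finset.sum_equiv w (by simp) fun k _ => ?_
  rw [mul_add, add_mul, mul_smul_comm, smul_mul_assoc, permOp_mul_divOp, permOp_mul_divOp']

theorem reflOp_mul_dunklOp (a b : ℂ) (i : Fin N) :
    reflOp i * dunklOp a 1 b i = -(dunklOp a 1 b i * reflOp i) := by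
  have hs : ∑ k, reflOp i * (divOp i k + (1 : ℂ) • divOp' i k)
      = -∑ k, (divOp i k + (1 : ℂ) • divOp' i k) * reflOp i := by
    rw [← Finset.sum_neg_distrib]
    refine Finset.sum_congr rfl fun k _ => ?_
    rw [one_smul, mul_add, add_mul, reflOp_left_mul_divOp, reflOp_left_mul_divOp', neg_add,
      add_comm]
  unfold dunklOp
  rw [mul_add, mul_add, add_mul, add_mul, reflOp_mul_deriv, mul_smul_comm, smul_mul_assoc,
    mul_smul_comm, smul_mul_assoc, reflOp_mul_reflDivOp, Finset.mul_sum, Finset.sum_mul, hs]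
  module

theorem reflOp_mul_dunklOp_of_ne (a b : ℂ) {i j : Fin N} (h : i ≠ j) :
    reflOp i * dunklOp a 1 b j = dunklOp a 1 b j * reflOp i := by
  unfold dunklOp
  rw [mul_add, mul_add, add_mul, add_mul, reflOp_mul_deriv_of_ne h.symm, mul_smul_comm,
    smul_mul_assoc, mul_smul_comm, smul_mul_assoc, reflOp_mul_reflDivOp_of_ne h.symm,
    Finset.mul_sum, Finset.sum_mul]
  congr 3
  refine Finset.sum_congr rfl fun k _ => ?_
  rw [one_smul, mul_add, add_mul]
  by_cases hk : i = k
  · subst hk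
    rw [reflOp_right_mul_divOp, reflOp_right_mul_divOp', add_comm]
  · rw [reflOp_mul_divOp_of_ne h hk, reflOp_mul_divOp'_of_ne h hk]

/-- A family of operators on which permutations act by permutation of the indices and (if `e ≠ 0`)
reflections act by signs. -/
structure IsVectorFamily (e : ℂ) (Z : Fin N → Op N) : Prop where
  perm : ∀ w i, permOp w * Z i = Z (w i) * permOp w
  refl : e ≠ 0 → ∀ i, reflOp i * Z i = -(Z i * reflOp i)
  refl_of_ne : e ≠ 0 → ∀ i j, i ≠ j → reflOp i * Z j = Z j * reflOp i

namespace IsVectorFamily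

variable {e : ℂ} {Z : Fin N → Op N}

theorem neg_left (h : IsVectorFamily e Z) : IsVectorFamily (-e) Z :=
  ⟨h.perm, fun he => h.refl (neg_ne_zero.1 he), fun he => h.refl_of_ne (neg_ne_zero.1 he)⟩

/-- K_{ij} turns Z_i into Z_j, and t_i t_j then changes the sign of Z_j. So the term with the
reflections picks up a sign, which is why the relations need S' with -e next to S. -/
theorem reflPair_mul (h : IsVectorFamily e Z) {i j : Fin N} (hij : i ≠ j) :
    reflPair e i j * Z i = Z j * reflPair (-e) i j := by
  have h1 : exchOp i j * Z i = Z j * exchOp i j := by rw [h.perm, Equiv.swap_apply_left]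
  by_cases he : e = 0
  · simpa [reflPair, he] using h1
  have h2 : reflOp i * reflOp j * exchOp i j * Z i
      = -(Z j * (reflOp i * reflOp j * exchOp i j)) := by
    have hj := h.refl he j
    have hi := h.refl_of_ne he i j hij
    linear_combination (norm := (simp only [mul_add, add_mul, mul_sub,
      sub_mul, op_neg_mul, op_mul_neg, op_mul_sub, op_sub_mul, mul_assoc, mul_one, one_mul]; abel))
      reflOp i * reflOp j * h1 + reflOp i * hj * exchOp i j - hi * reflOp j * exchOp i j
  rw [reflPair, reflPair, add_mul, mul_add, smul_mul_assoc, mul_smul_comm, h1, h2]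
  module

theorem reflPair_mul_of_ne (h : IsVectorFamily e Z) {i j k : Fin N} (hi : k ≠ i) (hj : k ≠ j) :
    reflPair e i j * Z k = Z k * reflPair e i j := by
  have h1 : exchOp i j * Z k = Z k * exchOp i j := by
    rw [h.perm, Equiv.swap_apply_of_ne_of_ne hi hj]
  by_cases he : e = 0
  · simpa [reflPair, he] using h1
  have h2 : reflOp i * reflOp j * exchOp i j * Z k = Z k * (reflOp i * reflOp j * exchOp i j) := by
    have hj' := h.refl_of_ne he j k hj.symm
    have hi' := h.refl_of_ne he i k hi.symm
    linear_combination (norm := (simp only [mul_add, add_mul, mul_sub,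
      sub_mul, op_neg_mul, op_mul_neg, op_mul_sub, op_sub_mul, mul_assoc, mul_one, one_mul]; abel))
      reflOp i * reflOp j * h1 + reflOp i * hj' * exchOp i j + hi' * reflOp j * exchOp i j
  rw [reflPair, add_mul, mul_add, smul_mul_assoc, mul_smul_comm, h1, h2]

end IsVectorFamily

theorem isVectorFamily_mulX (e : ℂ) : IsVectorFamily (N := N) e mulX :=
  ⟨permOp_mul_mulX, fun _ => reflOp_mul_mulX, fun _ _ _ h => reflOp_mul_mulX_of_ne h.symm⟩

theorem isVectorFamily_dunklOp (a : ℂ) {e b : ℂ} (he : e = 1 ∨ (e = 0 ∧ b = 0)) :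
    IsVectorFamily (N := N) e (dunklOp a e b) := by
  refine ⟨permOp_mul_dunklOp a e b, fun h0 => ?_, fun h0 => ?_⟩
  all_goals
    have h1 : e = 1 := he.resolve_right fun h => h0 h.1
    subst h1
  · exact reflOp_mul_dunklOp a b
  · exact fun i j h => reflOp_mul_dunklOp_of_ne a b h

theorem dunklOp_mul_mulX (a e b : ℂ) {i j : Fin N} (h : i ≠ j) :
    dunklOp a e b i * mulX j = mulX j * dunklOp a e b i - a • reflPair (-e) i j := by
  have hk : ∀ k, (divOp i k + e • divOp' i k) * mulX j
      = mulX j * (divOp i k + e • divOp' i k) - if k = j then reflPair (-e) i j else 0 := by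
    intro k
    rw [add_mul, mul_add, smul_mul_assoc, mul_smul_comm]
    split_ifs with hkj
    · subst hkj
      rw [divOp_mul_mulX_right h.symm, divOp'_mul_mulX_right h.symm, reflPair]
      module
    · rw [divOp_mul_mulX_of_ne h.symm (Ne.symm hkj), divOp'_mul_mulX_of_ne h.symm (Ne.symm hkj),
        sub_zero]
  have hsum : (∑ k, (divOp i k + e • divOp' i k)) * mulX j
      = mulX j * ∑ k, (divOp i k + e • divOp' i k) - reflPair (-e) i j := by
    rw [Finset.sum_mul, Finset.mul_sum, Finset.sum_congr rfl fun k _ => hk k,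
      Finset.sum_sub_distrib]
    simp
  unfold dunklOp
  rw [add_mul, add_mul, mul_add, mul_add, smul_mul_assoc, mul_smul_comm, smul_mul_assoc,
    mul_smul_comm, hsum, deriv_mul_mulX_of_ne h.symm, reflDivOp_mul_mulX_of_ne h.symm]
  module

theorem dunklOp_mul_mulX_self (a e b : ℂ) (i : Fin N) :
    dunklOp a e b i * mulX i = mulX i * dunklOp a e b i + 1
      + ∑ k ∈ Finset.univ.erase i, a • reflPair e i k + (b • reflOp i + b • reflOp i) := by
  have hk : ∀ k, (divOp i k + e • divOp' i k) * mulX i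
      = mulX i * (divOp i k + e • divOp' i k) + if k ≠ i then reflPair e i k else 0 := by
    intro k
    rw [add_mul, mul_add, smul_mul_assoc, mul_smul_comm]
    split_ifs with hki
    · rw [divOp_mul_mulX_left hki, divOp'_mul_mulX_left hki, reflPair]
      module
    · rw [not_not] at hki
      subst hki
      simp [divOp_self, divOp'_self]
  have hsum : (∑ k, (divOp i k + e • divOp' i k)) * mulX i
      = mulX i * ∑ k, (divOp i k + e • divOp' i k) + ∑ k ∈ Finset.univ.erase i, reflPair e i k := by
    rw [Finset.sum_mul, Finset.mul_sum, Finset.sum_congr rfl fun k _ => hk k,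
      Finset.sum_add_distrib, ← Finset.sum_filter, Finset.filter_ne']
  rw [← Finset.smul_sum]
  unfold dunklOp
  rw [add_mul, add_mul, mul_add, mul_add, smul_mul_assoc, mul_smul_comm, smul_mul_assoc,
    mul_smul_comm, hsum, deriv_mul_mulX, reflDivOp_mul_mulX]
  module

theorem dunklOp_one (a e b : ℂ) (i : Fin N) : dunklOp a e b i 1 = 0 := by
  have h1 : ∀ k, divOp i k (1 : MvPolynomial (Fin N) ℂ) = 0 := fun k => by
    by_cases h : k = i
    · subst h; rw [divOp_self, LinearMap.zero_apply]
    · exact divOp_eq_of_mul h (by rw [permOp_apply, map_one, mul_zero, sub_self])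
  have h2 : ∀ k, reflOp k (1 : MvPolynomial (Fin N) ℂ) = 1 := fun k => map_one (reflect k)
  have h3 : reflDivOp i (1 : MvPolynomial (Fin N) ℂ) = 0 := by
    refine mul_left_cancel₀ (MvPolynomial.X_ne_zero i) ?_
    rw [mul_zero]
    have := LinearMap.congr_fun (mulX_mul_reflDivOp i) 1
    rw [LinearMap.sub_apply, h2, Module.End.one_apply, sub_self] at this
    exact this
  simp [dunklOp, divOp', h1, h2, h3, deriv]

theorem reflPair_mul_reflOp (e : ℂ) (i j : Fin N) :
    reflPair e i j * reflOp i = reflOp j * reflPair e i j := by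
  have h1 := exchOp_mul_reflOp_left i j
  have h2 := reflOp_comm i j
  have h3 : reflOp i * reflOp j * exchOp i j * reflOp i
      = reflOp j * (reflOp i * reflOp j * exchOp i j) := by
    linear_combination (norm := (simp only [mul_add, add_mul, mul_sub,
      sub_mul, op_neg_mul, op_mul_neg, op_mul_sub, op_sub_mul, mul_assoc, mul_one, one_mul]; abel))
      reflOp i * reflOp j * h1 + h2 * reflOp j * exchOp i j
  rw [reflPair, add_mul, mul_add, smul_mul_assoc, mul_smul_comm, h1, h3]

theorem reflPair_mul_reflOp_of_ne (e : ℂ) {i j k : Fin N} (hi : k ≠ i) (hj : k ≠ j) :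
    reflPair e i j * reflOp k = reflOp k * reflPair e i j := by
  have h1 := exchOp_mul_reflOp_of_ne hi hj
  have h2 := reflOp_comm i k
  have h3 := reflOp_comm j k
  have h4 : reflOp i * reflOp j * exchOp i j * reflOp k
      = reflOp k * (reflOp i * reflOp j * exchOp i j) := by
    linear_combination (norm := (simp only [mul_add, add_mul, mul_sub,
      sub_mul, op_neg_mul, op_mul_neg, op_mul_sub, op_sub_mul, mul_assoc, mul_one, one_mul]; abel))
      reflOp i * reflOp j * h1 + reflOp i * h3 * exchOp i j + h2 * reflOp j * exchOp i j
  rw [reflPair, add_mul, mul_add, smul_mul_assoc, mul_smul_comm, h1, h4]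

/-- Both sides are (t_i + t_j)K_{ij}. -/
theorem reflOp_mul_reflPair_one (i j : Fin N) :
    reflOp i * reflPair 1 i j = reflOp j * reflPair 1 i j := by
  have h1 := reflOp_mul_self i
  have h2 := reflOp_mul_self j
  have h3 := reflOp_comm i j
  rw [reflPair, one_smul]
  linear_combination (norm := (simp only [mul_add, add_mul, mul_sub,
    sub_mul, op_neg_mul, op_mul_neg, op_mul_sub, op_sub_mul, mul_assoc, mul_one, one_mul]; abel))
    h1 * reflOp j * exchOp i j - reflOp j * h3 * exchOp i j - h2 * reflOp i * exchOp i j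

/-- K_{jl} carries the pair (i, j) to (i, l). For e = 1 the remaining factor 1 + t_j t_l commutes
with the pair (i, l): t_j does not involve its indices, and on that pair t_l acts like t_i. -/
theorem reflPair_mul_reflPair {e : ℂ} (he : e = 1 ∨ e = 0) {i j l : Fin N} (hij : i ≠ j)
    (hil : i ≠ l) (hjl : j ≠ l) :
    reflPair e j l * reflPair e i j = reflPair e i l * reflPair e j l := by
  have h0 : exchOp j l * exchOp i j = exchOp i l * exchOp j l := by
    rw [permOp_mul_exchOp, Equiv.swap_apply_of_ne_of_ne hij hil, Equiv.swap_apply_left]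
  have h1 : exchOp j l * reflPair e i j = reflPair e i l * exchOp j l := by
    rw [permOp_mul_reflPair, Equiv.swap_apply_of_ne_of_ne hij hil, Equiv.swap_apply_left]
  rcases he with rfl | rfl
  · have h2 : reflOp j * reflOp l * reflPair 1 i l = reflPair 1 i l * (reflOp j * reflOp l) := by
      rw [← mul_assoc, reflPair_mul_reflOp_of_ne 1 hij.symm hjl, mul_assoc, mul_assoc,
        reflPair_comm 1 i l, reflPair_mul_reflOp, ← reflOp_mul_reflPair_one]
    have h3 : reflPair 1 j l = (1 + reflOp j * reflOp l) * exchOp j l := by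
      rw [reflPair, one_smul, add_mul, one_mul]
    rw [h3, mul_assoc, h1, ← mul_assoc, ← mul_assoc, add_mul, mul_add, h2, one_mul, mul_one]
  · simpa [reflPair] using h0

theorem reflPair_mul_reflPair_of_ne (e : ℂ) {i j k l : Fin N} (hij : i ≠ j) (hil : i ≠ l)
    (hkj : k ≠ j) (hkl : k ≠ l) :
    reflPair e j l * reflPair e i k = reflPair e i k * reflPair e j l := by
  have h1 : exchOp j l * reflPair e i k = reflPair e i k * exchOp j l := by
    rw [permOp_mul_reflPair, Equiv.swap_apply_of_ne_of_ne hij hil,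
      Equiv.swap_apply_of_ne_of_ne hkj hkl]
  have h2 := reflPair_mul_reflOp_of_ne e hij.symm hkj.symm
  have h3 := reflPair_mul_reflOp_of_ne e hil.symm hkl.symm
  have h4 : reflOp j * reflOp l * exchOp j l * reflPair e i k
      = reflPair e i k * (reflOp j * reflOp l * exchOp j l) := by
    linear_combination (norm := (simp only [mul_add, add_mul, mul_sub,
      sub_mul, op_neg_mul, op_mul_neg, op_mul_sub, op_sub_mul, mul_assoc, mul_one, one_mul]; abel))
      reflOp j * reflOp l * h1 - reflOp j * h3 * exchOp j l - h2 * reflOp l * exchOp j l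
  rw [show reflPair e j l = exchOp j l + e • (reflOp j * reflOp l * exchOp j l) from rfl,
    add_mul, mul_add, smul_mul_assoc, mul_smul_comm, h1, h4]

/-- The Dunkl operators with the coordinates. -/
def dunklSystem (N : ℕ) (a : ℂ) {e b : ℂ} (he : e = 1 ∨ (e = 0 ∧ b = 0)) :
    DunklSystem N (Op N) where
  D := dunklOp a e b
  X := mulX
  c i := b • reflOp i
  S i j := a • reflPair e i j
  S' i j := a • reflPair (-e) i j
  P := permOp
  S_symm i j := by rw [reflPair_comm]
  S'_symm i j := by rw [reflPair_comm]
  D_mul_X i j h := dunklOp_mul_mulX a e b h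
  D_mul_X_self i := dunklOp_mul_mulX_self a e b i
  S_mul_D i j h := by
    rw [smul_mul_assoc, mul_smul_comm, (isVectorFamily_dunklOp a he).reflPair_mul h]
  S'_mul_D i j h := by
    rw [smul_mul_assoc, mul_smul_comm, (isVectorFamily_dunklOp a he).neg_left.reflPair_mul h,
      neg_neg]
  S_mul_D_of_ne i j k _ hi hj := by
    rw [smul_mul_assoc, mul_smul_comm, (isVectorFamily_dunklOp a he).reflPair_mul_of_ne hi hj]
  S'_mul_D_of_ne i j k _ hi hj := by
    rw [smul_mul_assoc, mul_smul_comm,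
      (isVectorFamily_dunklOp a he).neg_left.reflPair_mul_of_ne hi hj]
  S_mul_X i j h := by
    rw [smul_mul_assoc, mul_smul_comm, (isVectorFamily_mulX e).reflPair_mul h]
  S_mul_X_of_ne i j k _ hi hj := by
    rw [smul_mul_assoc, mul_smul_comm, (isVectorFamily_mulX e).reflPair_mul_of_ne hi hj]
  c_mul_D i := by
    rcases he with rfl | ⟨rfl, rfl⟩
    · rw [smul_mul_assoc, mul_smul_comm, reflOp_mul_dunklOp, smul_neg]
    · simp
  c_mul_D_of_ne i j h := by
    rcases he with rfl | ⟨rfl, rfl⟩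
    · rw [smul_mul_assoc, mul_smul_comm, reflOp_mul_dunklOp_of_ne a b h]
    · simp
  c_mul_X i := by rw [smul_mul_assoc, mul_smul_comm, reflOp_mul_mulX, smul_neg]
  c_mul_X_of_ne i j h := by rw [smul_mul_assoc, mul_smul_comm, reflOp_mul_mulX_of_ne h.symm]
  c_comm i j := by
    rw [smul_mul_assoc, mul_smul_comm, smul_mul_assoc, mul_smul_comm, reflOp_comm]
  S_mul_c i j _ := by
    rw [smul_mul_assoc, mul_smul_comm, smul_mul_assoc, mul_smul_comm, reflPair_mul_reflOp,
      smul_comm]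
  S_mul_c_of_ne i j k _ hi hj := by
    rw [smul_mul_assoc, mul_smul_comm, smul_mul_assoc, mul_smul_comm,
      reflPair_mul_reflOp_of_ne e hi hj, smul_comm]
  c_mul_S i j _ := by
    rcases he with rfl | ⟨rfl, rfl⟩
    · rw [smul_mul_assoc, mul_smul_comm, smul_mul_assoc, mul_smul_comm, reflOp_mul_reflPair_one]
    · simp
  S_mul_S i j l hij hil hjl := by
    rw [smul_mul_assoc, mul_smul_comm, smul_mul_assoc, mul_smul_comm,
      reflPair_mul_reflPair (he.imp_right And.left) hij hil hjl]
  S_mul_S_of_ne i j k l _ _ hij hil hkj hkl := by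
    rw [smul_mul_assoc, mul_smul_comm, smul_mul_assoc, mul_smul_comm,
      reflPair_mul_reflPair_of_ne e hij hil hkj hkl]
  P_mul_D := permOp_mul_dunklOp a e b
  P_mul_X := permOp_mul_mulX
  P_mul_c w i := by rw [smul_mul_assoc, mul_smul_comm, permOp_mul_reflOp]
  P_mul_S w i j := by rw [smul_mul_assoc, mul_smul_comm, permOp_mul_reflPair]

/-- All polynomials arise from 1 by linear combinations and multiplications by the coordinates. -/
theorem eq_zero_of_comm_mulX {C : Op N} (h1 : C 1 = 0) (hX : ∀ k, C * mulX k = mulX k * C) :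
    C = 0 := by
  refine LinearMap.ext fun f => ?_
  rw [LinearMap.zero_apply]
  induction f using MvPolynomial.induction_on with
  | C c =>
    rw [← mul_one (MvPolynomial.C c), ← MvPolynomial.smul_eq_C_mul, map_smul, h1, smul_zero]
  | add f g hf hg => rw [map_add, hf, hg, add_zero]
  | mul_X f k hf =>
    have := LinearMap.congr_fun (hX k) f
    rw [Module.End.mul_apply, Module.End.mul_apply, hf, map_zero, mulX_apply] at this
    rwa [mul_comm]

theorem dunklOp_comm (a : ℂ) {e b : ℂ} (he : e = 1 ∨ (e = 0 ∧ b = 0)) (i j : Fin N) :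
    dunklOp a e b i * dunklOp a e b j = dunklOp a e b j * dunklOp a e b i := by
  refine sub_eq_zero.1 (eq_zero_of_comm_mulX ?_ ((dunklSystem N a he).commutator_mul_X i j))
  simp [dunklOp_one]

/-- Replacement of the coordinates by the creation operators `X_i - s D_i`. -/
def DunklSystem.shift {R : Type*} [Ring R] [Algebra ℂ R] (T : DunklSystem N R)
    (hD : ∀ i j, T.D i * T.D j = T.D j * T.D i) (s : ℂ) : DunklSystem N R :=
  { T with
    X := fun i => T.X i - s • T.D i
    D_mul_X := fun i j h => by
      rw [mul_sub, sub_mul, mul_smul_comm, smul_mul_assoc, T.D_mul_X i j h, hD i j]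
      abel
    D_mul_X_self := fun i => by
      rw [mul_sub, sub_mul, mul_smul_comm, smul_mul_assoc, T.D_mul_X_self i]
      abel
    S_mul_X := fun i j h => by
      rw [mul_sub, sub_mul, mul_smul_comm, smul_mul_assoc, T.S_mul_X i j h, T.S_mul_D i j h]
    S_mul_X_of_ne := fun i j k h hi hj => by
      rw [mul_sub, sub_mul, mul_smul_comm, smul_mul_assoc, T.S_mul_X_of_ne i j k h hi hj,
        T.S_mul_D_of_ne i j k h hi hj]
    c_mul_X := fun i => by
      rw [mul_sub, sub_mul, mul_smul_comm, smul_mul_assoc, T.c_mul_X, T.c_mul_D, smul_neg]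
      abel
    c_mul_X_of_ne := fun i j h => by
      rw [mul_sub, sub_mul, mul_smul_comm, smul_mul_assoc, T.c_mul_X_of_ne i j h,
        T.c_mul_D_of_ne i j h]
    P_mul_X := fun w i => by
      rw [mul_sub, sub_mul, mul_smul_comm, smul_mul_assoc, T.P_mul_X, T.P_mul_D] }

/-- The cross terms [X_i, D_j] and [D_i, X_j] are S'_{ji} and -S'_{ij}, which cancel by the symmetry
of S'. -/
theorem DunklSystem.shift_X_comm {R : Type*} [Ring R] [Algebra ℂ R] (T : DunklSystem N R)
    (hD : ∀ i j, T.D i * T.D j = T.D j * T.D i) (hX : ∀ i j, T.X i * T.X j = T.X j * T.X i) (s : ℂ)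
    (i j : Fin N) :
    (T.shift hD s).X i * (T.shift hD s).X j = (T.shift hD s).X j * (T.shift hD s).X i := by
  change (T.X i - s • T.D i) * (T.X j - s • T.D j) = (T.X j - s • T.D j) * (T.X i - s • T.D i)
  by_cases h : i = j
  · rw [h]
  have h1 := T.D_mul_X i j h
  have h2 := T.D_mul_X j i (Ne.symm h)
  rw [T.S'_symm j i] at h2
  simp only [mul_sub, sub_mul, mul_smul_comm, smul_mul_assoc, h1, h2, hX i j, hD i j]
  module

/-! ## Triangularity of the Cherednik operators -/

/-- The Cherednik operators; type A is the case `e = b = 0`, type B the case `e = 1`, and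
`s = 1 / (2 ω)`. -/
def cherednikOp (a : ℂ) {e b : ℂ} (he : e = 1 ∨ (e = 0 ∧ b = 0)) (s : ℂ) (i : Fin N) : Op N :=
  ((dunklSystem N a he).shift (dunklOp_comm a he) s).d i

theorem cherednikOp_eq (a : ℂ) {e b : ℂ} (he : e = 1 ∨ (e = 0 ∧ b = 0)) (s : ℂ) (i : Fin N) :
    cherednikOp a he s i = (mulX i - s • dunklOp a e b i) * dunklOp a e b i + b • reflOp i
      + ∑ k ∈ Finset.univ.filter (fun k => i < k), a • reflPair e i k := rfl

theorem cherednikOp_comm (a : ℂ) {e b : ℂ} (he : e = 1 ∨ (e = 0 ∧ b = 0)) (s : ℂ) (i j : Fin N) :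
    cherednikOp a he s i * cherednikOp a he s j = cherednikOp a he s j * cherednikOp a he s i :=
  ((dunklSystem N a he).shift (dunklOp_comm a he) s).d_comm
    (DunklSystem.shift_X_comm _ (dunklOp_comm a he) mulX_comm s) (dunklOp_comm a he) i j

/-- The part of the Cherednik operator that preserves the degree. -/
def leadOp (a e b : ℂ) (i : Fin N) : Op N :=
  mulX i * deriv i
    + a • ∑ k ∈ Finset.univ.erase i, (pairOp i k + e • (reflOp k * pairOp i k * reflOp k))
    + b • 1

/-- As t_k commutes with x_i, conjugation by t_k carries the type A half of the pair, with its
correction, to the half with x_i + x_k. -/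
theorem mulX_mul_pair {i k : Fin N} (h : k ≠ i) (e : ℂ) :
    mulX i * (divOp i k + e • divOp' i k) + (if i < k then reflPair e i k else 0)
      = pairOp i k + e • (reflOp k * pairOp i k * reflOp k) := by
  have h1 : mulX i * divOp' i k = reflOp k * (mulX i * divOp i k) * reflOp k := by
    unfold divOp'
    simp only [← mul_assoc]
    rw [reflOp_mul_mulX_of_ne h.symm]
  have h2 : reflOp k * exchOp i k * reflOp k = reflOp i * reflOp k * exchOp i k := by
    rw [mul_assoc, exchOp_mul_reflOp_right, ← mul_assoc, reflOp_comm]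
  rw [mul_add, mul_smul_comm, h1, pairOp]
  split_ifs
  · rw [mul_add, add_mul, h2, reflPair]
    module
  · rw [add_zero, add_zero]

theorem leadOp_eq (a e b : ℂ) (i : Fin N) :
    mulX i * dunklOp a e b i + b • reflOp i
      + ∑ k ∈ Finset.univ.filter (fun k => i < k), a • reflPair e i k = leadOp a e b i := by
  have hset : Finset.univ.filter (fun k => i < k) = (Finset.univ.erase i).filter fun k => i < k := by
    ext k
    simp only [Finset.mem_filter, Finset.mem_univ, true_and, Finset.mem_erase, and_true]
    exact ⟨fun h => ⟨h.ne', h⟩, fun h => h.2⟩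
  have hsum : ∑ k, (divOp i k + e • divOp' i k)
      = ∑ k ∈ Finset.univ.erase i, (divOp i k + e • divOp' i k) := by
    refine (Finset.sum_erase _ ?_).symm
    rw [divOp_self, divOp'_self, smul_zero, add_zero]
  have hpair : mulX i * ∑ k ∈ Finset.univ.erase i, (divOp i k + e • divOp' i k)
      + ∑ k ∈ (Finset.univ.erase i).filter (fun k => i < k), reflPair e i k
      = ∑ k ∈ Finset.univ.erase i, (pairOp i k + e • (reflOp k * pairOp i k * reflOp k)) := by
    rw [Finset.mul_sum, Finset.sum_filter, ← Finset.sum_add_distrib]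
    exact Finset.sum_congr rfl fun k hk => mulX_mul_pair (Finset.ne_of_mem_erase hk) e
  -- The contributions b(1 - t_i) and b t_i add up to the scalar b.
  have hR := mulX_mul_reflDivOp i
  rw [← Finset.smul_sum, hset, leadOp, ← hpair, dunklOp, hsum, mul_add, mul_add, mul_smul_comm,
    mul_smul_comm, hR]
  module

theorem suppIn_reflOp (i : Fin N) : SuppIn Low (reflOp i) :=
  suppIn_low_of_diagonal (c := fun μ => (-1) ^ μ i) (reflOp_mono i)

theorem suppIn_one : SuppIn Low (1 : Op N) :=
  suppIn_low_of_diagonal (c := fun _ => 1) fun μ => by rw [Module.End.one_apply, one_smul]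

/-- Reflections are diagonal on monomials with entries ±1, so conjugation by t_k does not enlarge
the support. -/
theorem suppIn_leadOp (a e b : ℂ) (i : Fin N) : SuppIn Low (leadOp a e b i) := by
  refine ((suppIn_low_of_diagonal (c := fun μ => (μ i : ℂ)) (mulX_mul_deriv_mono i)).add
    ((SuppIn.sum _ _ fun k hk => ?_).smul a)).add (suppIn_one.smul b)
  have := suppIn_pairOp (Finset.ne_of_mem_erase hk)
  exact this.add ((this.conj_reflOp k).smul e)

theorem diag_leadOp (a e b : ℂ) (i : Fin N) (μ : Fin N → ℕ) :
    diag μ (leadOp a e b i) = μ i + a * (1 + e) * followCount μ i + b := by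
  classical
  have h1 : ∑ k ∈ Finset.univ.erase i,
      diag μ (pairOp i k + e • (reflOp k * pairOp i k * reflOp k))
      = (1 + e) * followCount μ i := by
    have h : ∀ k ∈ Finset.univ.erase i,
        diag μ (pairOp i k + e • (reflOp k * pairOp i k * reflOp k))
          = (1 + e) * if Follows μ k i then 1 else 0 := by
      intro k hk
      rw [map_add, map_smul, diag_conj_reflOp, diag_pairOp (Finset.ne_of_mem_erase hk)]
      split_ifs <;> simp
    rw [Finset.sum_congr rfl h, ← Finset.mul_sum, Finset.sum_erase, Finset.sum_boole, followCount]
    rw [if_neg fun hf : Follows μ i i => hf.asymm hf]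
  rw [leadOp, map_add, map_add, map_smul, map_smul, map_sum, h1,
    diag_eq_of_diagonal (c := fun μ => (μ i : ℂ)) (mulX_mul_deriv_mono i),
    diag_eq_of_diagonal (A := 1) (c := fun _ => 1) fun μ => by rw [Module.End.one_apply, one_smul]]
  simp only [smul_eq_mul]
  ring

theorem suppIn_reflPair (e : ℂ) (i j : Fin N) :
    SuppIn (fun ν μ => degree ν ≤ degree μ) (reflPair e i j) := by
  have h : ∀ k : Fin N, SuppIn (fun ν μ => degree ν ≤ degree μ) (reflOp k) := fun k =>
    (suppIn_reflOp k).mono_rel fun _ _ => Low.degree_le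
  have hle : ∀ κ ν μ : Fin N → ℕ, degree κ ≤ degree ν → degree ν ≤ degree μ →
      degree κ ≤ degree μ := fun _ _ _ => le_trans
  exact (suppIn_permOp _).add ((((h i).mul (h j) hle).mul (suppIn_permOp _) hle).smul e)

/-- x_i∇_i is a combination of operators that do not raise the degree, so ∇_i lowers it. Hence the
ω-dependent term s∇_i² affects neither triangularity nor the diagonal. -/
theorem suppIn_dunklOp (a e b : ℂ) (i : Fin N) :
    SuppIn (fun ν μ => degree ν < degree μ) (dunklOp a e b i) := by
  apply suppIn_degree_lt_of_mulX (j := i)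
  have h : mulX i * dunklOp a e b i = leadOp a e b i - b • reflOp i
      - ∑ k ∈ Finset.univ.filter (fun k => i < k), a • reflPair e i k := by
    rw [← leadOp_eq]
    abel
  rw [h]
  exact (((suppIn_leadOp a e b i).sub ((suppIn_reflOp i).smul b)).mono_rel
    fun _ _ => Low.degree_le).sub (SuppIn.sum _ _ fun k _ => (suppIn_reflPair e i k).smul a)

theorem cherednikOp_eq_leadOp_sub (a : ℂ) {e b : ℂ} (he : e = 1 ∨ (e = 0 ∧ b = 0)) (s : ℂ)
    (i : Fin N) :
    cherednikOp a he s i = leadOp a e b i - s • (dunklOp a e b i * dunklOp a e b i) := by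
  rw [cherednikOp_eq, ← leadOp_eq, sub_mul, smul_mul_assoc]
  abel

theorem suppIn_dunklOp_sq (a e b : ℂ) (i : Fin N) :
    SuppIn (fun ν μ => degree ν < degree μ) (dunklOp a e b i * dunklOp a e b i) :=
  (suppIn_dunklOp a e b i).mul (suppIn_dunklOp a e b i) fun _ _ _ => lt_trans

theorem suppIn_cherednikOp (a : ℂ) {e b : ℂ} (he : e = 1 ∨ (e = 0 ∧ b = 0)) (s : ℂ) (i : Fin N) :
    SuppIn Low (cherednikOp a he s i) := by
  rw [cherednikOp_eq_leadOp_sub]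
  exact (suppIn_leadOp a e b i).sub
    (((suppIn_dunklOp_sq a e b i).mono_rel fun _ _ h => Or.inl h).smul s)

theorem diag_cherednikOp (a : ℂ) {e b : ℂ} (he : e = 1 ∨ (e = 0 ∧ b = 0)) (s : ℂ) {κ β : ℝ}
    (hκ : (κ : ℂ) = a * (1 + e)) (hβ : (β : ℂ) = b) (i : Fin N) (μ : Fin N → ℕ) :
    diag μ (cherednikOp a he s i) = eta κ β μ i := by
  have h : diag μ (dunklOp a e b i * dunklOp a e b i) = 0 := by
    by_contra hne
    exact lt_irrefl _ (suppIn_dunklOp_sq a e b i μ μ hne)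
  rw [cherednikOp_eq_leadOp_sub, map_sub, map_smul, h, smul_zero, sub_zero, diag_leadOp, eta]
  push_cast
  rw [hκ, hβ]

/-! ## Joint eigenvectors of commuting triangular operators -/

/-- Commuting triangular operators with diagonal coefficients `eta`. -/
structure TriangularSystem (N : ℕ) (κ β : ℝ) where
  d : Fin N → Op N
  comm : ∀ i j, d i * d j = d j * d i
  supp : ∀ i, SuppIn Low (d i)
  diag_eq : ∀ i μ, diag μ (d i) = eta κ β μ i

/-- A contribution to x^ν from another monomial of g would put ν strictly below the exponent of that
monomial, against the maximality of its rank. -/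
theorem cf_apply_of_maximal {A : Op N} (hA : SuppIn Low A) {g : MvPolynomial (Fin N) ℂ}
    {ν : Fin N → ℕ} (hν : ∀ κ ∈ expts g, rank κ ≤ rank ν) : cf ν (A g) = cf ν g * diag ν A := by
  rw [cf_op_apply, Finset.sum_eq_single ν]
  · rfl
  · intro κ hκ hne
    by_contra h
    exact ((hA κ ν (right_ne_zero_of_mul h)).rank_lt hne.symm).not_ge (hν κ hκ)
  · intro h
    rw [mem_expts, not_not] at h
    rw [h, zero_mul]

theorem diag_mul {A B : Op N} (hA : SuppIn Low A) (hB : SuppIn Low B) (μ : Fin N → ℕ) :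
    diag μ (A * B) = diag μ A * diag μ B := by
  rw [diag_apply, Module.End.mul_apply, cf_apply_of_maximal hA, mul_comm]
  · rfl
  · intro κ hκ
    by_cases h : κ = μ
    · rw [h]
    · exact ((hB μ κ (mem_expts.1 hκ)).rank_lt h).le

theorem exists_low_of_cf_ne_zero {A : Op N} (hA : SuppIn Low A) {g : MvPolynomial (Fin N) ℂ}
    {κ : Fin N → ℕ} (h : cf κ (A g) ≠ 0) : ∃ ν ∈ expts g, Low κ ν := by
  rw [cf_op_apply] at h
  obtain ⟨ν, hν, hne⟩ := Finset.exists_ne_zero_of_sum_ne_zero h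
  exact ⟨ν, hν, hA ν κ (right_ne_zero_of_mul hne)⟩

theorem eq_zero_of_expts_eq_empty {g : MvPolynomial (Fin N) ℂ} (h : expts g = ∅) : g = 0 := by
  rw [eq_sum_mono g, h, Finset.sum_empty]

namespace TriangularSystem

variable {κ β : ℝ} (T : TriangularSystem N κ β)

/-- At an exponent of maximal rank the operators act by their diagonal entries, so its spectral
vector must be ζ. -/
theorem eq_zero_of_eigen {g : MvPolynomial (Fin N) ℂ} {ζ : Fin N → ℂ}
    (hg : ∀ i, T.d i g = ζ i • g)
    (h : ∀ ν, (∀ i, (eta κ β ν i : ℂ) = ζ i) → cf ν g = 0) : g = 0 := by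
  by_contra hne
  obtain ⟨ν, hν, hmax⟩ := Finset.exists_max_image (expts g) rank
    (Finset.nonempty_iff_ne_empty.2 fun e => hne (eq_zero_of_expts_eq_empty e))
  rw [mem_expts] at hν
  refine hν (h ν fun i => ?_)
  have h1 := cf_apply_of_maximal (T.supp i) hmax
  rw [hg, map_smul, smul_eq_mul, T.diag_eq, mul_comm] at h1
  exact (mul_left_cancel₀ hν h1).symm

/-- Induction on the size of the lower set S. For ν of maximal rank in S, the factor d_i - η_i(ν)
maps polynomials supported in S to polynomials supported in S without ν, again a lower set, on which
the previous product vanishes. -/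
theorem exists_annihilator (hκ : 0 ≤ κ) (μ : Fin N → ℕ) (n : ℕ) :
    ∀ S : Finset (Fin N → ℕ), S.card = n → (∀ ν ∈ S, ∀ ρ, Low ρ ν → ρ ∈ S) → μ ∉ S →
      ∃ P : Op N, (∀ i, P * T.d i = T.d i * P) ∧ SuppIn Low P ∧ diag μ P ≠ 0 ∧
        ∀ g, expts g ⊆ S → P g = 0 := by
  induction n with
  | zero =>
    intro S hS _ _
    rw [Finset.card_eq_zero] at hS
    refine ⟨1, fun i => by rw [one_mul, mul_one], suppIn_one, ?_, fun g hg => ?_⟩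
    · rw [diag_apply, Module.End.one_apply, cf_mono, if_pos rfl]
      exact one_ne_zero
    · rw [hS, Finset.subset_empty] at hg
      rw [eq_zero_of_expts_eq_empty hg, map_zero]
  | succ n ih =>
    intro S hS hlow hμ
    obtain ⟨ν, hν, hmax⟩ := Finset.exists_max_image S rank (Finset.card_pos.1 (by omega))
    obtain ⟨P, hP, hPs, hPd, hPk⟩ := ih (S.erase ν) (by rw [Finset.card_erase_of_mem hν]; omega)
      (fun ν' hν' ρ hρ => by
        have h1 := Finset.mem_erase.1 hν'
        refine Finset.mem_erase.2 ⟨?_, hlow ν' h1.2 ρ hρ⟩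
        rintro rfl
        exact (hρ.rank_lt h1.1.symm).not_ge (hmax ν' h1.2))
      (fun h => hμ (Finset.mem_of_mem_erase h))
    -- Spectral vectors separate compositions; choosing i this way keeps the diagonal entry of the
    -- product at μ nonzero.
    obtain ⟨i, hi⟩ : ∃ i, eta κ β ν i ≠ eta κ β μ i := by
      by_contra! h
      have := eq_comp_of_eta_eq hκ β (1 : Equiv.Perm (Fin N)) h
      exact hμ (by rwa [← (funext this : ν = μ)])
    have hQ : SuppIn Low (T.d i - (eta κ β ν i : ℂ) • 1) := (T.supp i).sub (suppIn_one.smul _)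
    have hQd : ∀ ρ, diag ρ (T.d i - (eta κ β ν i : ℂ) • 1) = eta κ β ρ i - eta κ β ν i := by
      intro ρ
      rw [map_sub, map_smul, T.diag_eq, diag_apply ρ 1, Module.End.one_apply, cf_mono, if_pos rfl,
        smul_eq_mul, mul_one]
    refine ⟨P * (T.d i - (eta κ β ν i : ℂ) • 1), fun j => ?_, hPs.mul hQ fun _ _ _ => Low.trans,
      ?_, fun g hg => hPk _ ?_⟩
    · rw [mul_assoc, sub_mul, smul_mul_assoc, one_mul, T.comm i j, ← mul_assoc, ← hP j, mul_assoc,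
        mul_sub (T.d j), mul_smul_comm, mul_one]
    · rw [diag_mul hPs hQ, hQd]
      refine mul_ne_zero hPd (sub_ne_zero.2 ?_)
      exact_mod_cast hi.symm
    · intro ρ hρ
      have hρ' := mem_expts.1 hρ
      obtain ⟨ν', hν', hl⟩ := exists_low_of_cf_ne_zero hQ hρ'
      refine Finset.mem_erase.2 ⟨?_, hlow ν' (hg hν') ρ hl⟩
      rintro rfl
      rw [cf_apply_of_maximal hQ fun κ' hκ' => hmax κ' (hg hκ'), hQd, sub_self, mul_zero] at hρ'
      exact hρ' rfl

theorem finite_setOf_low (μ : Fin N → ℕ) : {ν : Fin N → ℕ | Low ν μ}.Finite := by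
  refine (Set.finite_Iic fun _ : Fin N => degree μ).subset fun ν hν i => ?_
  exact (Finset.single_le_sum (fun _ _ => Nat.zero_le _) (Finset.mem_univ i)).trans
    (Low.degree_le hν)

/-- The eigenvector is P x^μ, normalized, where P annihilates everything strictly below μ: (d_i -
η_i(μ))x^μ is such a polynomial, and P commutes with d_i. -/
theorem exists_eigen (hκ : 0 ≤ κ) (μ : Fin N → ℕ) :
    ∃ h, IsMonicTriangular μ h ∧ ∀ i, T.d i h = (eta κ β μ i : ℂ) • h := by
  have hmem : ∀ ν, ν ∈ (finite_setOf_low μ).toFinset.erase μ ↔ ν ≠ μ ∧ Low ν μ := fun ν => by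
    rw [Finset.mem_erase, Set.Finite.mem_toFinset]
    rfl
  obtain ⟨P, hP, hPs, hPd, hPk⟩ := T.exists_annihilator hκ μ _
    ((finite_setOf_low μ).toFinset.erase μ) rfl
    (fun ν hν ρ hρ => by
      rw [hmem] at hν ⊢
      refine ⟨?_, hρ.trans hν.2⟩
      rintro rfl
      exact lt_asymm (hρ.rank_lt hν.1.symm) (hν.2.rank_lt hν.1))
    (fun h => ((hmem μ).1 h).1 rfl)
  refine ⟨(diag μ P)⁻¹ • P (mono μ), ⟨?_, fun ν hν hne => ?_⟩, fun i => ?_⟩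
  · rw [← cf_apply, map_smul, ← diag_apply, smul_eq_mul, inv_mul_cancel₀ hPd]
  · rw [← cf_apply, map_smul] at hne
    exact (hPs μ ν (right_ne_zero_of_mul hne)).compLE_or
  · have h1 : P (T.d i (mono μ) - (eta κ β μ i : ℂ) • mono μ) = 0 := by
      refine hPk _ fun ν hν => ?_
      rw [mem_expts, map_sub, map_smul, cf_mono] at hν
      rw [hmem]
      by_cases e : ν = μ
      · subst e
        rw [← diag_apply, T.diag_eq, if_pos rfl, smul_eq_mul, mul_one, sub_self] at hν
        exact absurd rfl hν
      · rw [if_neg e, smul_zero, sub_zero] at hν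
        exact ⟨e, T.supp i μ ν hν⟩
    rw [map_sub, map_smul, sub_eq_zero, ← Module.End.mul_apply, hP, Module.End.mul_apply] at h1
    rw [map_smul, h1, smul_comm]

theorem eq_zero_of_eigen_eta (hκ : 0 ≤ κ) {μ : Fin N → ℕ} {g : MvPolynomial (Fin N) ℂ}
    (hg : ∀ i, T.d i g = (eta κ β μ i : ℂ) • g) (h : cf μ g = 0) : g = 0 := by
  refine T.eq_zero_of_eigen hg fun ν hν => ?_
  rwa [show ν = μ from funext (eq_comp_of_eta_eq hκ β (1 : Equiv.Perm (Fin N)) fun i => by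
    exact_mod_cast hν i)]

theorem existsUnique_eigen (hκ : 0 ≤ κ) (μ : Fin N → ℕ) :
    ∃! h, IsMonicTriangular μ h ∧ ∀ i, T.d i h = (eta κ β μ i : ℂ) • h := by
  obtain ⟨h, hm, he⟩ := T.exists_eigen hκ μ
  refine ⟨h, ⟨hm, he⟩, fun h' ⟨hm', he'⟩ => ?_⟩
  refine sub_eq_zero.1 (T.eq_zero_of_eigen_eta hκ (μ := μ) (fun i => ?_) ?_)
  · rw [map_sub, he, he', smul_sub]
  · rw [map_sub, cf_apply, cf_apply, hm.1, hm'.1, sub_self]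

end TriangularSystem

/-! ## Intertwining by adjacent transpositions -/

/-- The triangular system of the Cherednik operators. -/
def cherednikSystem (N : ℕ) (a : ℂ) {e b : ℂ} (he : e = 1 ∨ (e = 0 ∧ b = 0)) (s : ℂ) {κ β : ℝ}
    (hκ : (κ : ℂ) = a * (1 + e)) (hβ : (β : ℂ) = b) : TriangularSystem N κ β where
  d := cherednikOp a he s
  comm := cherednikOp_comm a he s
  supp := suppIn_cherednikOp a he s
  diag_eq := diag_cherednikOp a he s hκ hβ

section Intertwining

variable (a : ℂ) {e b : ℂ} (he : e = 1 ∨ (e = 0 ∧ b = 0)) (s : ℂ)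

theorem exchOp_mul_cherednikOp_right {i i' : Fin N} (hi : (i : ℕ) + 1 = i') :
    exchOp i i' * cherednikOp a he s i'
      = (cherednikOp a he s i - a • reflPair e i i') * exchOp i i' :=
  ((dunklSystem N a he).shift (dunklOp_comm a he) s).P_swap_mul_d hi

theorem exchOp_mul_cherednikOp_of_ne {i i' j : Fin N} (hi : (i : ℕ) + 1 = i') (hj : j ≠ i)
    (hj' : j ≠ i') :
    exchOp i i' * cherednikOp a he s j = cherednikOp a he s j * exchOp i i' :=
  ((dunklSystem N a he).shift (dunklOp_comm a he) s).P_swap_mul_d_of_ne hi hj hj'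

theorem reflPair_mul_exchOp (e : ℂ) (i j : Fin N) :
    reflPair e i j * exchOp i j = 1 + e • (reflOp i * reflOp j) := by
  rw [reflPair, add_mul, smul_mul_assoc, mul_assoc, exchOp_mul_self, mul_one]

theorem exchOp_mul_cherednikOp_left {i i' : Fin N} (hi : (i : ℕ) + 1 = i') :
    exchOp i i' * cherednikOp a he s i
      = cherednikOp a he s i' * exchOp i i' + a • (1 + e • (reflOp i * reflOp i')) := by
  have h1 := exchOp_mul_cherednikOp_right a he s hi
  have h2 := exchOp_mul_self i i'
  have h3 : exchOp i i' * reflPair e i i' = reflPair e i i' * exchOp i i' := by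
    rw [permOp_mul_reflPair, Equiv.swap_apply_left, Equiv.swap_apply_right, reflPair_comm]
  have h4 : exchOp i i' * (exchOp i i' * cherednikOp a he s i') * exchOp i i'
      = cherednikOp a he s i' * exchOp i i' := by
    rw [← mul_assoc, h2, one_mul]
  rw [h1, mul_assoc, mul_assoc, h2, mul_one, mul_sub, mul_smul_comm, h3, reflPair_mul_exchOp] at h4
  rw [← h4]
  abel

variable {κ β : ℝ} {μ : Fin N → ℕ} {h : MvPolynomial (Fin N) ℂ}

/-- The condition `hp`, void for e = 0, makes the reflection term a(1 + e t_i t_{i'}) of the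
exchange relation act on h as the scalar κ. So the d_j preserve the span of h and its exchange. -/
theorem cherednikOp_exchOp_apply (hκ : (κ : ℂ) = a * (1 + e)) {i i' : Fin N}
    (hi : (i : ℕ) + 1 = i') (hh : ∀ j, cherednikOp a he s j h = (eta κ β μ j : ℂ) • h)
    (hp : e • (reflOp i * reflOp i') h = e • h) (j : Fin N) :
    cherednikOp a he s j (exchOp i i' h) = (eta κ β μ (Equiv.swap i i' j) : ℂ) • exchOp i i' h
      + (if j = i then (κ : ℂ) else if j = i' then -(κ : ℂ) else 0) • h := by
  have hS : (a • (1 + e • (reflOp i * reflOp i'))) h = (κ : ℂ) • h := by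
    rw [LinearMap.smul_apply, LinearMap.add_apply, LinearMap.smul_apply, hp, Module.End.one_apply,
      hκ]
    module
  by_cases hj : j = i
  · subst hj
    have h1 := exchOp_mul_cherednikOp_right a he s hi
    rw [sub_mul, smul_mul_assoc, reflPair_mul_exchOp, eq_sub_iff_add_eq] at h1
    have h2 := LinearMap.congr_fun h1 h
    rw [LinearMap.add_apply, hS, Module.End.mul_apply, Module.End.mul_apply, hh, map_smul] at h2
    rw [← h2, if_pos rfl, Equiv.swap_apply_left]
  by_cases hj' : j = i'
  · subst hj'
    have h2 := LinearMap.congr_fun (exchOp_mul_cherednikOp_left a he s hi) h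
    rw [LinearMap.add_apply, hS, Module.End.mul_apply, Module.End.mul_apply, hh, map_smul] at h2
    rw [if_neg hj, if_pos rfl, Equiv.swap_apply_right, h2]
    module
  · have h2 := LinearMap.congr_fun (exchOp_mul_cherednikOp_of_ne a he s hi hj hj') h
    rw [Module.End.mul_apply, Module.End.mul_apply, hh, map_smul] at h2
    rw [if_neg hj, if_neg hj', Equiv.swap_apply_of_ne_of_ne hj hj', ← h2, zero_smul, add_zero]

/-- Because η_i = η_{i'} + κ, the difference K h - h is an eigenvector for the exchanged spectral
vector. Any exponent with that spectrum is the exchange of μ, which is μ itself, and K h - h has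
coefficient 0 there. -/
theorem exchOp_apply_of_eq (hκ : (κ : ℂ) = a * (1 + e)) (hβ : (β : ℂ) = b) (hκ0 : 0 ≤ κ)
    {i i' : Fin N} (hi : (i : ℕ) + 1 = i')
    (hh : ∀ j, cherednikOp a he s j h = (eta κ β μ j : ℂ) • h)
    (hp : e • (reflOp i * reflOp i') h = e • h) (heq : μ i = μ i') : exchOp i i' h = h := by
  have hc := cherednikOp_exchOp_apply a he s hκ hi hh hp
  have hx : (eta κ β μ i : ℂ) = eta κ β μ i' + κ := by
    exact_mod_cast eta_sub_eta_of_eq κ β hi heq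
  have hμ : ∀ j, μ (Equiv.swap i i' j) = μ j := fun j => by
    rw [Equiv.swap_apply_def]
    split_ifs with h1 h2
    · rw [h1, heq]
    · rw [h2, heq]
    · rfl
  refine sub_eq_zero.1 ((cherednikSystem N a he s hκ hβ).eq_zero_of_eigen
    (ζ := fun j => (eta κ β μ (Equiv.swap i i' j) : ℂ)) (fun j => ?_) fun ν hν => ?_)
  · change cherednikOp a he s j _ = _
    rw [map_sub, hc, hh]
    by_cases hj : j = i
    · subst hj
      rw [if_pos rfl, Equiv.swap_apply_left, hx]
      module
    by_cases hj' : j = i'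
    · subst hj'
      rw [if_neg hj, if_pos rfl, Equiv.swap_apply_right, hx]
      module
    · rw [if_neg hj, if_neg hj', Equiv.swap_apply_of_ne_of_ne hj hj']
      module
  · have h1 : ν = μ := funext fun j => by
      rw [← hμ]
      exact eq_comp_of_eta_eq hκ0 β (Equiv.swap i i') (fun j => by exact_mod_cast hν j) j
    rw [h1, map_sub, cf_permOp, show μ ∘ Equiv.swap i i' = μ from funext hμ, sub_self]

/-- Subtracting x h with x = κ/(η_i - η_{i'}) diagonalizes the action on the span: K h - x h has the
spectrum of sμ. Its coefficient at x^{sμ} is 1, since x^{sμ} does not occur in h, so uniqueness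
identifies it with h'. -/
theorem exchOp_apply_of_lt (hκ : (κ : ℂ) = a * (1 + e)) (hβ : (β : ℂ) = b) (hκ0 : 0 ≤ κ)
    {i i' : Fin N} (hi : (i : ℕ) + 1 = i') (hm : IsMonicTriangular μ h)
    (hh : ∀ j, cherednikOp a he s j h = (eta κ β μ j : ℂ) • h)
    (hp : e • (reflOp i * reflOp i') h = e • h) (hlt : μ i < μ i') {h' : MvPolynomial (Fin N) ℂ}
    (hm' : IsMonicTriangular (μ ∘ Equiv.swap i i') h')
    (hh' : ∀ j, cherednikOp a he s j h' = (eta κ β (μ ∘ Equiv.swap i i') j : ℂ) • h') :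
    exchOp i i' h = ((κ / (eta κ β μ i - eta κ β μ i') : ℝ) : ℂ) • h + h' := by
  have hc := cherednikOp_exchOp_apply a he s hκ hi hh hp
  have hii : i < i' := by rw [Fin.lt_def]; omega
  have hne : (eta κ β μ i : ℂ) - eta κ β μ i' ≠ 0 := by
    exact_mod_cast (sub_neg.2 (eta_lt_of_lt hκ0 β hlt)).ne
  set x : ℂ := ((κ / (eta κ β μ i - eta κ β μ i') : ℝ) : ℂ) with hx
  have hxκ : (κ : ℂ) = x * (eta κ β μ i - eta κ β μ i') := by
    rw [hx]
    push_cast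
    field_simp
  have hcf : cf (μ ∘ Equiv.swap i i') h = 0 := by
    by_contra h0
    refine not_compLE_comp_swap hii hlt (hm.2 _ (fun e => ?_) h0)
    have := congrFun e i
    simp only [Function.comp_apply, Equiv.swap_apply_left] at this
    omega
  rw [← sub_eq_zero]
  refine (cherednikSystem N a he s hκ hβ).eq_zero_of_eigen_eta hκ0 (μ := μ ∘ Equiv.swap i i')
    (fun j => ?_) ?_
  · change cherednikOp a he s j _ = _
    rw [map_sub, map_add, map_smul, hc, hh, hh', eta_comp_swap κ β hi hlt.ne, hxκ]
    by_cases hj : j = i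
    · subst hj
      rw [if_pos rfl, Equiv.swap_apply_left]
      module
    by_cases hj' : j = i'
    · subst hj'
      rw [if_neg hj, if_pos rfl, Equiv.swap_apply_right]
      module
    · rw [if_neg hj, if_neg hj', Equiv.swap_apply_of_ne_of_ne hj hj']
      module
  · rw [map_sub, map_add, map_smul, cf_permOp, hcf,
      show (μ ∘ Equiv.swap i i') ∘ Equiv.swap i i' = μ from funext fun j => by simp,
      cf_apply, cf_apply, hm.1, hm'.1, smul_zero, zero_add, sub_self]

end Intertwining

/-! ## Symmetrization -/

theorem comp_swap_mem_orbit {μp μ : Fin N → ℕ} (h : μ ∈ orbit μp) (i i' : Fin N) :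
    μ ∘ Equiv.swap i i' ∈ orbit μp := by
  obtain ⟨w, rfl⟩ := mem_orbit.1 h
  exact mem_orbit.2 ⟨w * Equiv.swap i i', rfl⟩

/-- K mixes h_μ only with h_{sμ}, so the claim is one scalar identity for each μ in the orbit. -/
theorem exchOp_sum_orbit (a : ℂ) {e b : ℂ} (he : e = 1 ∨ (e = 0 ∧ b = 0)) (s : ℂ) {κ β ε : ℝ}
    (hκ : (κ : ℂ) = a * (1 + e)) (hβ : (β : ℂ) = b) (hκ0 : 0 ≤ κ)
    {μp : Fin N → ℕ} (hpart : IsPartition μp) (h : (Fin N → ℕ) → MvPolynomial (Fin N) ℂ)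
    (hm : ∀ μ, IsMonicTriangular μ (h μ))
    (hh : ∀ μ j, cherednikOp a he s j (h μ) = (eta κ β μ j : ℂ) • h μ) {i i' : Fin N}
    (hi : (i : ℕ) + 1 = i')
    (hp : ∀ μ ∈ orbit μp, e • (reflOp i * reflOp i') (h μ) = e • h μ)
    (hε : ε = 1 ∨ (ε = -1 ∧ Function.Injective μp)) :
    exchOp i i' (∑ μ ∈ orbit μp, ((symCoeff κ ε μp μ : ℝ) : ℂ) • h μ)
      = (ε : ℂ) • ∑ μ ∈ orbit μp, ((symCoeff κ ε μp μ : ℝ) : ℂ) • h μ := by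
  set σ := Equiv.swap i i'
  have hii : i < i' := by rw [Fin.lt_def]; omega
  have hσ : ∀ μ : Fin N → ℕ, (μ ∘ σ) ∘ σ = μ := fun μ => funext fun j => by simp [σ]
  set x : (Fin N → ℕ) → ℝ := fun μ => κ / (eta κ β μ i - eta κ β μ i') with hx
  have hxσ : ∀ μ, μ i ≠ μ i' → x (μ ∘ σ) = -x μ := fun μ hne => by
    simp only [hx, σ, eta_comp_swap κ β hi hne, Equiv.swap_apply_left, Equiv.swap_apply_right]
    rw [← neg_sub (eta κ β μ i), div_neg]
  have hKlt : ∀ μ ∈ orbit μp, μ i < μ i' → exchOp i i' (h μ) = (x μ : ℂ) • h μ + h (μ ∘ σ) :=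
    fun μ hμ hlt => exchOp_apply_of_lt a he s hκ hβ hκ0 hi (hm μ) (hh μ) (hp μ hμ) hlt (hm _) (hh _)
  -- Apply K to the formula for sμ, where x changes sign, and use K² = 1.
  have hKgt : ∀ μ ∈ orbit μp, μ i' < μ i →
      exchOp i i' (h μ) = (x μ : ℂ) • h μ + (1 - (x μ : ℂ) ^ 2) • h (μ ∘ σ) := fun μ hμ hlt => by
    have h1 := hKlt (μ ∘ σ) (comp_swap_mem_orbit hμ i i') (by simpa [σ] using hlt)
    rw [hσ, hxσ μ hlt.ne'] at h1
    have h2 := congrArg (exchOp i i') h1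
    rw [← Module.End.mul_apply, exchOp_mul_self, Module.End.one_apply, map_add, map_smul, h1] at h2
    push_cast at h2
    have h3 : exchOp i i' (h μ) = h (μ ∘ σ) - (-(x μ : ℂ)) • (-(x μ : ℂ) • h (μ ∘ σ) + h μ) :=
      eq_sub_of_add_eq' h2.symm
    rw [h3]
    module
  -- For equal parts sμ = μ; the value 0 avoids counting h_μ twice.
  set y : (Fin N → ℕ) → ℂ := fun μ =>
    if μ i = μ i' then 0 else if μ i < μ i' then 1 else 1 - (x μ : ℂ) ^ 2 with hy
  set z : (Fin N → ℕ) → ℂ := fun μ => if μ i = μ i' then 1 else (x μ : ℂ) with hz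
  have hK : ∀ μ ∈ orbit μp, exchOp i i' (h μ) = z μ • h μ + y μ • h (μ ∘ σ) := by
    intro μ hμ
    rcases lt_trichotomy (μ i) (μ i') with hlt | heq | hlt
    · rw [hKlt μ hμ hlt]
      simp only [hy, hz]
      rw [if_neg hlt.ne, if_neg hlt.ne, if_pos hlt, one_smul]
    · rw [exchOp_apply_of_eq a he s hκ hβ hκ0 hi (hh μ) (hp μ hμ) heq]
      simp only [hy, hz]
      rw [if_pos heq, if_pos heq, one_smul, zero_smul, add_zero]
    · rw [hKgt μ hμ hlt]
      simp only [hy, hz]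
      rw [if_neg hlt.ne', if_neg hlt.ne', if_neg hlt.le.not_gt]
  have hε2 : ε * ε = 1 := by rcases hε with rfl | ⟨rfl, -⟩ <;> norm_num
  have hb : ∀ μ ∈ orbit μp, μ i < μ i' →
      symCoeff κ ε μp μ = (ε + x μ) * symCoeff κ ε μp (μ ∘ σ) := by
    intro μ hμ hlt
    rw [symCoeff_eq_mul hκ0 β ε hpart hμ hi hlt]
    congr 1
    simp only [hx]
    rw [← neg_sub (eta κ β μ i'), div_neg]
    linear_combination -(κ / (eta κ β μ i' - eta κ β μ i)) * hε2
  -- The coefficient of h_μ in K H collects a term from h_μ and one from h_{sμ}. For μ_i < μ_{i'} it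
  -- is b_{sμ}((ε + x)x + 1 - x²) = b_{sμ}(1 + εx) = ε b_μ, by ε² = 1.
  have hcoef : ∀ μ ∈ orbit μp, ((symCoeff κ ε μp μ : ℝ) : ℂ) * z μ
      + ((symCoeff κ ε μp (μ ∘ σ) : ℝ) : ℂ) * y (μ ∘ σ) = ε * ((symCoeff κ ε μp μ : ℝ) : ℂ) := by
    intro μ hμ
    have hσi : (μ ∘ σ) i = μ i' := by simp [σ]
    have hσi' : (μ ∘ σ) i' = μ i := by simp [σ]
    have hε2' : (ε : ℂ) * ε = 1 := by exact_mod_cast hε2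
    simp only [hy, hz, hσi, hσi']
    rcases lt_trichotomy (μ i) (μ i') with hlt | heq | hlt
    · rw [if_neg hlt.ne, if_neg hlt.ne', if_neg hlt.le.not_gt, hxσ μ hlt.ne, hb μ hμ hlt]
      push_cast
      linear_combination -((symCoeff κ ε μp (μ ∘ σ) : ℝ) : ℂ) * hε2'
    -- Here K fixes h_μ, in agreement with ε = 1; for ε = -1 the case is empty because the parts are
    -- distinct.
    · rw [if_pos heq, if_pos heq.symm]
      rcases hε with rfl | ⟨-, hinj⟩
      · simp
      · obtain ⟨w, rfl⟩ := mem_orbit.1 hμ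
        exact absurd (w.injective (hinj heq)) hii.ne
    · have h1 := hb (μ ∘ σ) (comp_swap_mem_orbit hμ i i') (by rwa [hσi, hσi'])
      rw [hσ, hxσ μ hlt.ne'] at h1
      rw [if_neg hlt.ne', if_neg hlt.ne, if_pos hlt, h1]
      push_cast
      ring
  rw [map_sum, Finset.smul_sum]
  have h1 : ∑ μ ∈ orbit μp, exchOp i i' (((symCoeff κ ε μp μ : ℝ) : ℂ) • h μ)
      = ∑ μ ∈ orbit μp, (((symCoeff κ ε μp μ : ℝ) : ℂ) * z μ) • h μ
        + ∑ μ ∈ orbit μp, (((symCoeff κ ε μp μ : ℝ) : ℂ) * y μ) • h (μ ∘ σ) := by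
    rw [← Finset.sum_add_distrib]
    refine Finset.sum_congr rfl fun μ hμ => ?_
    rw [map_smul, hK μ hμ]
    module
  have h2 : ∑ μ ∈ orbit μp, (((symCoeff κ ε μp μ : ℝ) : ℂ) * y μ) • h (μ ∘ σ)
      = ∑ μ ∈ orbit μp, (((symCoeff κ ε μp (μ ∘ σ) : ℝ) : ℂ) * y (μ ∘ σ)) • h μ := by
    refine Finset.sum_bij (fun μ _ => μ ∘ σ) (fun μ hμ => comp_swap_mem_orbit hμ i i') ?_ ?_ ?_
    · intro μ _ ν _ heq
      rw [← hσ μ, ← hσ ν]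
      exact congrArg (fun f => f ∘ σ) heq
    · exact fun μ hμ => ⟨μ ∘ σ, comp_swap_mem_orbit hμ i i', hσ μ⟩
    · intro μ _
      simp only [hσ]
  rw [h1, h2, ← Finset.sum_add_distrib]
  refine Finset.sum_congr rfl fun μ hμ => ?_
  rw [← add_smul, hcoef μ hμ, mul_smul]

/-- Adjacent transpositions generate the symmetric group. One character χ serves both cases: trivial
and sign. -/
theorem permOp_apply_of_adjacent {F : MvPolynomial (Fin N) ℂ} (χ : Equiv.Perm (Fin N) →* ℂ)
    (h : ∀ i i' : Fin N, (i : ℕ) + 1 = i' → exchOp i i' F = χ (Equiv.swap i i') • F)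
    (w : Equiv.Perm (Fin N)) : permOp w F = χ w • F := by
  have h1 : permOp (1 : Equiv.Perm (Fin N)) F = χ 1 • F := by
    rw [permOp_one, Module.End.one_apply, map_one, one_smul]
  cases N with
  | zero => rwa [Subsingleton.elim w 1]
  | succ n =>
    have hw : w ∈ Submonoid.closure
        (Set.range fun i : Fin n => Equiv.swap i.castSucc i.succ) := by
      rw [Equiv.Perm.mclosure_swap_castSucc_succ]
      trivial
    induction hw using Submonoid.closure_induction with
    | mem w hw =>
      obtain ⟨i, rfl⟩ := hw
      exact h _ _ (by simp)
    | one => exact h1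
    | mul w w' _ _ hw hw' =>
      rw [← permOp_mul, Module.End.mul_apply, hw', map_smul, hw, map_mul, smul_smul, mul_comm]

theorem isSymmetric_of_adjacent {F : MvPolynomial (Fin N) ℂ}
    (h : ∀ i i' : Fin N, (i : ℕ) + 1 = i' → exchOp i i' F = F) : F.IsSymmetric := fun w => by
  have := permOp_apply_of_adjacent (F := F) 1 (fun i i' hi => by
    rw [h i i' hi, MonoidHom.one_apply, one_smul]) w
  rwa [MonoidHom.one_apply, one_smul] at this

theorem isAntisymmetric_of_adjacent {F : MvPolynomial (Fin N) ℂ}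
    (h : ∀ i i' : Fin N, (i : ℕ) + 1 = i' → exchOp i i' F = (-1 : ℂ) • F) :
    IsAntisymmetric F :=
  permOp_apply_of_adjacent (((Int.castRingHom ℂ).toMonoidHom.comp (Units.coeHom ℤ)).comp
    Equiv.Perm.sign) fun i i' hi => by
      have hne : i ≠ i' := fun e => by rw [e] at hi; omega
      rw [h i i' hi]
      simp [Equiv.Perm.sign_swap hne]

/-! ## The reflections act on the Laguerre polynomials by signs -/

/-- Signs occur only for equal indices, where x_i∇_i and ∇_i² each pick up two. The pair operators
commute with t_j even if j is one of their indices, because t_i and t_k agree on them. -/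
theorem reflOp_mul_cherednikOp (a b s : ℂ) (i j : Fin N) :
    reflOp j * cherednikOp a (e := 1) (b := b) (Or.inl rfl) s i
      = cherednikOp a (e := 1) (b := b) (Or.inl rfl) s i * reflOp j := by
  have h1 : reflOp j * (mulX i * dunklOp a 1 b i) = mulX i * dunklOp a 1 b i * reflOp j := by
    by_cases h : j = i
    · subst h
      rw [← mul_assoc, reflOp_mul_mulX, op_neg_mul, mul_assoc, reflOp_mul_dunklOp, op_mul_neg,
        neg_neg, mul_assoc]
    · rw [← mul_assoc, reflOp_mul_mulX_of_ne (Ne.symm h), mul_assoc, reflOp_mul_dunklOp_of_ne a b h,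
        mul_assoc]
  have h2 : reflOp j * (dunklOp a 1 b i * dunklOp a 1 b i)
      = dunklOp a 1 b i * dunklOp a 1 b i * reflOp j := by
    by_cases h : j = i
    · subst h
      rw [← mul_assoc, reflOp_mul_dunklOp, op_neg_mul, mul_assoc, reflOp_mul_dunklOp, op_mul_neg,
        neg_neg, mul_assoc]
    · rw [← mul_assoc, reflOp_mul_dunklOp_of_ne a b h, mul_assoc, reflOp_mul_dunklOp_of_ne a b h,
        mul_assoc]
  have h3 : ∀ k, reflOp j * reflPair 1 i k = reflPair 1 i k * reflOp j := by
    intro k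
    by_cases h : j = i
    · subst h
      rw [reflPair_mul_reflOp, reflOp_mul_reflPair_one]
    by_cases h' : j = k
    · subst h'
      rw [reflPair_comm, reflPair_mul_reflOp, reflOp_mul_reflPair_one]
    · rw [reflPair_mul_reflOp_of_ne 1 h h']
  rw [cherednikOp_eq, sub_mul, smul_mul_assoc, mul_add, mul_add, op_mul_sub, add_mul, add_mul,
    op_sub_mul, h1, mul_smul_comm, h2, smul_mul_assoc, mul_smul_comm, smul_mul_assoc,
    reflOp_comm j i, Finset.mul_sum, Finset.sum_mul]
  congr 1
  refine Finset.sum_congr rfl fun k _ => ?_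
  rw [mul_smul_comm, smul_mul_assoc, h3]

/-- Both sides have the spectrum of h and the same coefficient at x^μ. -/
theorem reflOp_apply_eigen (a b s : ℂ) {κ β : ℝ} (hκ : (κ : ℂ) = a * (1 + 1)) (hβ : (β : ℂ) = b)
    (hκ0 : 0 ≤ κ) {μ : Fin N → ℕ} {h : MvPolynomial (Fin N) ℂ}
    (hh : ∀ j, cherednikOp a (e := 1) (b := b) (Or.inl rfl) s j h = (eta κ β μ j : ℂ) • h)
    (i : Fin N) : reflOp i h = (-1 : ℂ) ^ μ i • h := by
  rw [← sub_eq_zero]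
  refine (cherednikSystem N a (Or.inl rfl) s hκ hβ).eq_zero_of_eigen_eta hκ0 (μ := μ)
    (fun j => ?_) ?_
  · change cherednikOp a (Or.inl rfl) s j _ = _
    rw [map_sub, map_smul, hh, ← Module.End.mul_apply, ← reflOp_mul_cherednikOp,
      Module.End.mul_apply, hh, map_smul]
    module
  · rw [map_sub, map_smul, cf_reflOp, smul_eq_mul, sub_self]

/-! ## Comparison with the definitions of the two types -/

/-- Conjugation by t_k turns x_j - x_k into x_j + x_k and K_{jk} into t_j t_k K_{jk}. -/
theorem mul_divOp' (j k : Fin N) (hkj : k ≠ j) (f : MvPolynomial (Fin N) ℂ) :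
    (MvPolynomial.X j + MvPolynomial.X k) * divOp' j k f
      = f - ((reflect j).comp ((reflect k).comp (exch j k))) f := by
  have h1 := congrArg (reflOp k) (mul_divOp j k (reflOp k f))
  rw [reflOp_mul_apply, map_sub, map_sub, reflOp_X_self, reflOp_X_of_ne hkj.symm, sub_neg_eq_add,
    ← Module.End.mul_apply (reflOp k) (reflOp k), reflOp_mul_self, Module.End.one_apply] at h1
  refine h1.trans (congrArg (fun g => f - g) ?_)
  have h2 : reflOp k * (exchOp j k * reflOp k) = reflOp j * (reflOp k * exchOp j k) := by
    rw [exchOp_mul_reflOp_right, ← mul_assoc, ← mul_assoc, reflOp_comm]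
  exact LinearMap.congr_fun h2 f

theorem divDiff_eq_divOp' (j k : Fin N) (h : k ≠ j) :
    divDiff (MvPolynomial.X j + MvPolynomial.X k)
      ((reflect j).comp ((reflect k).comp (exch j k))) (X_add_X_ne_zero h)
      (dvd_sub_reflect_exch j k h) = divOp' j k :=
  LinearMap.ext fun f => mul_left_cancel₀ (X_add_X_ne_zero h)
    ((mul_divDiff _ _ _ _ f).trans (mul_divOp' j k h f).symm)

theorem divDiff_eq_divOp (j k : Fin N) (h : k ≠ j) :
    divDiff (MvPolynomial.X j - MvPolynomial.X k) (exch j k) (X_sub_X_ne_zero h)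
      (dvd_sub_exch j k) = divOp j k := by
  rw [divOp, dif_pos h]

theorem sum_subtype_ne {M : Type*} [AddCommMonoid M] (j : Fin N) (f : Fin N → M) (h : f j = 0) :
    ∑ k : {k : Fin N // k ≠ j}, f k = ∑ k, f k := by
  rw [← Finset.sum_erase _ h]
  exact (Finset.sum_subtype _ (fun k => by simp) f).symm

theorem dunklA_eq (a : ℝ) (j : Fin N) : dunklA a j = dunklOp (a : ℂ) 0 0 j := by
  unfold dunklA dunklOp
  simp only [zero_smul, add_zero]
  congr 2
  rw [← sum_subtype_ne j (fun k => divOp j k) (divOp_self j)]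
  exact Finset.sum_congr rfl fun k _ => divDiff_eq_divOp j k.1 k.2

theorem dunklB_eq (a b : ℝ) (j : Fin N) : dunklB a b j = dunklOp (a : ℂ) 1 b j := by
  unfold dunklB dunklOp
  simp only [one_smul]
  congr 3
  rw [← sum_subtype_ne j (fun k => divOp j k + divOp' j k)
    (by rw [divOp_self, divOp'_self, add_zero])]
  exact Finset.sum_congr rfl fun k _ => by
    rw [divDiff_eq_divOp j k.1 k.2, divDiff_eq_divOp' j k.1 k.2]

theorem creation_mul_annihilation {ω : ℝ} (hω : ω ≠ 0) (j : Fin N) (D : Op N) :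
    (2 * (ω : ℂ)) • (creation ω j D * annihilation ω D) = (mulX j - (1 / (2 * (ω : ℂ))) • D) * D := by
  have h : (2 * (ω : ℂ)) ≠ 0 := mul_ne_zero two_ne_zero (by exact_mod_cast hω)
  unfold creation annihilation
  rw [mul_smul_comm, smul_smul, mul_one_div_cancel h, one_smul]

theorem cherednikA_eq (a : ℝ) {ω : ℝ} (hω : ω ≠ 0) (j : Fin N) :
    cherednikA a ω j
      = cherednikOp (a : ℂ) (e := 0) (b := 0) (Or.inr ⟨rfl, rfl⟩) (1 / (2 * (ω : ℂ))) j := by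
  rw [cherednikOp_eq, cherednikA, creation_mul_annihilation hω, dunklA_eq, zero_smul, add_zero,
    Finset.smul_sum]
  congr 1
  refine Finset.sum_congr rfl fun k _ => ?_
  rw [reflPair, zero_smul, add_zero]
  rfl

theorem cherednikB_eq (a b : ℝ) {ω : ℝ} (hω : ω ≠ 0) (j : Fin N) :
    cherednikB a b ω j
      = cherednikOp (a : ℂ) (e := 1) (b := b) (Or.inl rfl) (1 / (2 * (ω : ℂ))) j := by
  rw [cherednikOp_eq, cherednikB, creation_mul_annihilation hω, dunklB_eq, Finset.smul_sum,
    add_right_comm]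
  congr 1
  refine Finset.sum_congr rfl fun k _ => ?_
  rw [reflPair, one_smul, add_mul, one_mul]
  rfl

theorem forall_weighted_sum_iff (d : Fin N → Op N) (η : Fin N → ℝ) (h : MvPolynomial (Fin N) ℂ) :
    (∀ lam : Fin N → ℕ, (∑ j, (lam j : ℂ) • d j) h = ((toVec lam ⬝ᵥ η : ℝ) : ℂ) • h) ↔
      ∀ j, d j h = (η j : ℂ) • h := by
  constructor
  · intro H j
    -- The unit compositions already separate the individual operators.
    have := H (Pi.single j 1)
    rw [LinearMap.sum_apply, Finset.sum_eq_single j] at this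
    · simpa [toVec, dotProduct, Pi.single_apply] using this
    · intro k _ hk
      simp [Pi.single_apply, hk]
    · simp
  · intro H lam
    simp only [LinearMap.sum_apply, LinearMap.smul_apply, H, dotProduct, toVec]
    push_cast
    rw [Finset.sum_smul]
    exact Finset.sum_congr rfl fun j _ => by rw [mul_smul]

theorem isNonsymHermite_iff (a : ℝ) {ω : ℝ} (hω : ω ≠ 0) (μ : Fin N → ℕ)
    (h : MvPolynomial (Fin N) ℂ) :
    IsNonsymHermite a ω μ h ↔ IsMonicTriangular μ h ∧ ∀ j,
      cherednikOp (a : ℂ) (e := 0) (b := 0) (Or.inr ⟨rfl, rfl⟩) (1 / (2 * (ω : ℂ))) j h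
        = (eta a 0 μ j : ℂ) • h := by
  unfold IsNonsymHermite cherednikPowA
  rw [eta_eq_hermite, forall_weighted_sum_iff]
  simp only [cherednikA_eq a hω]

theorem isNonsymLaguerre_iff (a b : ℝ) {ω : ℝ} (hω : ω ≠ 0) (μ : Fin N → ℕ)
    (h : MvPolynomial (Fin N) ℂ) :
    IsNonsymLaguerre a b ω μ h ↔ IsMonicTriangular μ h ∧ ∀ j,
      cherednikOp (a : ℂ) (e := 1) (b := b) (Or.inl rfl) (1 / (2 * (ω : ℂ))) j h
        = (eta (2 * a) b μ j : ℂ) • h := by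
  unfold IsNonsymLaguerre cherednikPowB
  rw [eta_eq_laguerre, forall_weighted_sum_iff]
  simp only [cherednikB_eq a b hω]

theorem existsUnique_isNonsymHermite {a ω : ℝ} (ha : 0 ≤ a) (hω : ω ≠ 0) (μ : Fin N → ℕ) :
    ∃! h, IsNonsymHermite a ω μ h := by
  simp only [isNonsymHermite_iff a hω]
  exact (cherednikSystem N (a : ℂ) (Or.inr ⟨rfl, rfl⟩) _ (by simp) (by simp)).existsUnique_eigen
    ha μ

theorem existsUnique_isNonsymLaguerre {a b ω : ℝ} (ha : 0 ≤ a) (hω : ω ≠ 0) (μ : Fin N → ℕ) :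
    ∃! h, IsNonsymLaguerre a b ω μ h := by
  simp only [isNonsymLaguerre_iff a b hω]
  exact (cherednikSystem N (a : ℂ) (Or.inl rfl) _ (by push_cast; ring) rfl).existsUnique_eigen
    (by positivity) μ

theorem exchOp_hermiteH {a ω ε : ℝ} (ha : 0 ≤ a) (hω : ω ≠ 0) {μp : Fin N → ℕ}
    (hpart : IsPartition μp) (hε : ε = 1 ∨ (ε = -1 ∧ Function.Injective μp)) {i i' : Fin N}
    (hi : (i : ℕ) + 1 = i') : exchOp i i' (hermiteH a ω ε μp) = (ε : ℂ) • hermiteH a ω ε μp := by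
  have hspec := fun μ : Fin N → ℕ => (isNonsymHermite_iff a hω μ _).1
    (Classical.epsilon_spec (existsUnique_isNonsymHermite ha hω μ).exists)
  exact exchOp_sum_orbit (a : ℂ) (e := 0) (b := 0) (Or.inr ⟨rfl, rfl⟩) (1 / (2 * (ω : ℂ)))
    (by simp) (by simp) ha hpart (nonsymHermite a ω) (fun μ => (hspec μ).1) (fun μ => (hspec μ).2)
    hi (fun μ _ => by rw [zero_smul, zero_smul]) hε

theorem exchOp_laguerreH {a b ω ε : ℝ} (ha : 0 ≤ a) (hω : ω ≠ 0) {μp : Fin N → ℕ}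
    (hpart : IsPartition μp) (hpar : SameParity μp)
    (hε : ε = 1 ∨ (ε = -1 ∧ Function.Injective μp)) {i i' : Fin N} (hi : (i : ℕ) + 1 = i') :
    exchOp i i' (laguerreH a b ω ε μp) = (ε : ℂ) • laguerreH a b ω ε μp := by
  have hspec := fun μ : Fin N → ℕ => (isNonsymLaguerre_iff a b hω μ _).1
    (Classical.epsilon_spec (existsUnique_isNonsymLaguerre (b := b) ha hω μ).exists)
  have hκ : ((2 * a : ℝ) : ℂ) = a * (1 + 1) := by push_cast; ring
  refine exchOp_sum_orbit (a : ℂ) (e := 1) (b := b) (Or.inl rfl) (1 / (2 * (ω : ℂ)))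
    hκ rfl (by positivity) hpart (nonsymLaguerre a b ω) (fun μ => (hspec μ).1)
    (fun μ => (hspec μ).2) hi (fun μ hμ => ?_) hε
  have ht := reflOp_apply_eigen (a : ℂ) b _ hκ rfl (by positivity) (hspec μ).2
  -- This is where the parity condition enters: two parts of equal parity have an even sum, so t_i
  -- t_{i'} fixes the polynomial.
  have hsgn : (-1 : ℂ) ^ μ i' * (-1) ^ μ i = 1 := by
    obtain ⟨w, rfl⟩ := mem_orbit.1 hμ
    rw [← pow_add]
    refine Even.neg_one_pow ?_
    rcases hpar with h | h
    · exact (h _).add (h _)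
    · exact (h _).add_odd (h _)
  change (1 : ℂ) • (reflOp i * reflOp i') (nonsymLaguerre a b ω μ) = _
  rw [Module.End.mul_apply]
  refine congrArg _ ?_
  refine (congrArg (reflOp i) (ht i')).trans ?_
  rw [map_smul]
  refine (congrArg _ (ht i)).trans ?_
  rw [smul_smul, hsgn, one_smul]
  rfl

theorem delta_strictAnti : StrictAnti (delta N) := fun i j h => by
  unfold delta
  omega

theorem strictAnti_add_delta {κ : Fin N → ℕ} (hκ : IsPartition κ) : StrictAnti (κ + delta N) :=
  Antitone.add_strictAnti hκ delta_strictAnti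

theorem strictAnti_add_two_delta {κ : Fin N → ℕ} (hκ : IsPartition κ) :
    StrictAnti (κ + 2 • delta N) := by
  rw [two_nsmul, ← add_assoc]
  exact (strictAnti_add_delta hκ).add delta_strictAnti

end

end Calogero

theorem mainTheorem7 (N : ℕ) (a b ω : ℝ) (ha : 0 ≤ a) (hb : 0 ≤ b) (hω : 0 < ω) :
    -- the non-symmetric polynomials are well defined
    (∀ μ : Fin N → ℕ, ∃! h, Calogero.IsNonsymHermite a ω μ h) ∧
    (∀ μ : Fin N → ℕ, ∃! h, Calogero.IsNonsymLaguerre a b ω μ h) ∧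
    -- type A, symmetric: `μ⁺ ∈ P_+`
    (∀ μp : Fin N → ℕ, Calogero.IsPartition μp →
      (Calogero.hermiteH a ω 1 μp).IsSymmetric) ∧
    -- type A, anti-symmetric: `μ⁺ ∈ P_+ + δ`
    (∀ κ : Fin N → ℕ, Calogero.IsPartition κ →
      Calogero.IsAntisymmetric (Calogero.hermiteH a ω (-1) (κ + Calogero.delta N))) ∧
    -- type B, symmetric: `μ⁺ ∈ P_+`, all parts of the same parity
    (∀ μp : Fin N → ℕ, Calogero.IsPartition μp → Calogero.SameParity μp →
      (Calogero.laguerreH a b ω 1 μp).IsSymmetric) ∧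
    -- type B, anti-symmetric: `μ⁺ ∈ P_+ + 2δ`, all parts of the same parity
    (∀ κ : Fin N → ℕ, Calogero.IsPartition κ →
      Calogero.SameParity (κ + 2 • Calogero.delta N) →
      Calogero.IsAntisymmetric
        (Calogero.laguerreH a b ω (-1) (κ + 2 • Calogero.delta N))) := by
  refine ⟨Calogero.existsUnique_isNonsymHermite ha hω.ne',
    Calogero.existsUnique_isNonsymLaguerre ha hω.ne',
    fun μp hp => Calogero.isSymmetric_of_adjacent fun i i' hi => ?_,
    fun κ hκ => Calogero.isAntisymmetric_of_adjacent fun i i' hi => ?_,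
    fun μp hp hpar => Calogero.isSymmetric_of_adjacent fun i i' hi => ?_,
    fun κ hκ hpar => Calogero.isAntisymmetric_of_adjacent fun i i' hi => ?_⟩
  · rw [Calogero.exchOp_hermiteH ha hω.ne' hp (Or.inl rfl) hi, Complex.ofReal_one, one_smul]
  · rw [Calogero.exchOp_hermiteH ha hω.ne' (Calogero.strictAnti_add_delta hκ).antitone
      (Or.inr ⟨rfl, (Calogero.strictAnti_add_delta hκ).injective⟩) hi,
      Complex.ofReal_neg, Complex.ofReal_one]
  · rw [Calogero.exchOp_laguerreH ha hω.ne' hp hpar (Or.inl rfl) hi, Complex.ofReal_one, one_smul]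
  · rw [Calogero.exchOp_laguerreH ha hω.ne' (Calogero.strictAnti_add_two_delta hκ).antitone hpar
      (Or.inr ⟨rfl, (Calogero.strictAnti_add_two_delta hκ).injective⟩) hi, Complex.ofReal_neg,
      Complex.ofReal_one]
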